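/- Let $\mathcal O_p$ be the ring of germs at $p\in\mathbb C^2$ of holomorphic functions, $\mathcal O=\mathcal O_0$, and let $m_p(f,g)=\dim_{\mathbb C}\mathcal O_p/\langle f,g\rangle\in\mathbb N\cup\{\infty\}$, $m=m_0$. Let $\gamma=(x,y):(\mathbb C,0)\to(\mathbb C^2,0)$ be a non-constant holomorphic germ (for instance an $\mathcal A$-finite one), and let $f:(\mathbb C^2,0)\to(\mathbb C,0)$ be a holomorphic germ without repeated factors in $\mathcal O$ (in particular $f\ne0$); $C_\gamma$ is the germ at $0$ of the image of $\gamma$ and $C_f$ that of $\{f=0\}$. Put $$i_\gamma=x'y''-y'x'',\qquad v_\gamma=(x'^2+y'^2)(x'y'''-x'''y')+3(x'x''+y'y'')(x''y'-x'y''),$$ $$i_f=f_y^2f_{xx}-2f_xf_yf_{xy}+f_x^2f_{yy},$$ $$v_f=(f_x^2+f_y^2)(f_x^3f_{yyy}-3f_x^2f_yf_{xyy}+3f_xf_y^2f_{xxy}-f_y^3f_{xxx})-3\big((f_x^2-f_y^2)f_{xy}-f_xf_y(f_{xx}-f_{yy})\big)i_f,$$ $I_\gamma=\mathrm{ord}_0\,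 i_\gamma$, $V_\gamma=\mathrm{ord}_0\, v_\gamma$, $I_f=m(f,i_f)$, $V_f=m(f,v_f)$, all in $\mathbb N\cup\{\infty\}$ (and with $m_p$ instead of $m$ for an equation at another point $p$). The origin is an inflection (resp. a vertex) of $C_f$ if $i_f(0)=0$ (resp. $v_f(0)=0$), and an ordinary one if moreover $I_f=1$ (resp. $V_f=1$). Lines and circles through $0$ are the curves $A(x^2+y^2)+2Bx+2Cy=0$ with $(A,B,C)\neq0$; the lines are those with $A=0$. If $f$ is a submersion at $0$, the order of contact of $C_f$ with $\{g=0\}$ is the order at $0$ of $g\circ\alpha$, where $\alpha$ is a regular parametrisation of $C_f$ with $\alpha(0)=0$; an osculating circle or line is a circle or line through $0$ with maximal order of contact; and the centre of curvature is the point of the projective plane with homogeneous coordinates $(-(f_x^2+f_y^2)f_x:-(f_x^2+f_y^2)f_y:i_f)$ at $0$ (undefined if all three vanish), which is finite if the last coordinate is non-zero and infinite otherwise. A similarity is an affine automorphism of $\mathbb C^2$ with linear part $(x,y)\mapsto(ax+by,-bx+ay)$ or $(x,y)\mapsto(ax+by,bx-ay)$, $a^2+b^2\neq0$. Then: (1)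 For every affine automorphism $A$ of $\mathbb C^2$, $I_{A\circ\gamma}=I_\gamma$, and $I$ of $f\circ A^{-1}$ at $A(0)$ equals $I_f$; if $A$ is a similarity, the same holds for $V_\gamma$ and $V_f$. One has $I_f=1$ if and only if $f$ is a submersion at $0$ and $C_f$ has order of contact exactly $3$ with its tangent line. One has $V_f=1$ if and only if $f$ is a submersion at $0$, $f_x^2+f_y^2\ne0$ at $0$ (the tangent line is not isotropic), and $C_f$ has order of contact exactly $4$ with an osculating circle or line. (2) Suppose $f$ is a submersion at $0$. Then $0$ is an inflection if and only if some line has order of contact at least $3$ with $C_f$, and a vertex if and only if some circle or line has order of contact at least $4$. The order of contact of $C_f$ with its tangent line is $I_f+2$. If the centre of curvature is defined and finite, there is an osculating circle, every osculating circle or line is the circle centred at the centre of curvature, and its order of contact with $C_f$ is $V_f+3$. If the centre of curvature is defined and infinite, then $0$ is an inflection and $I_f=V_f+1$. (3) If $f$ is not a submersion at $0$, then $0$ is both an inflection and a vertex of $C_f$. (4) If $I_\gamma$ is finite, there is $k$ such that $I_\delta=I_\gamma$ for every holomorphic germ $\delta$ with the same $k$-jet at $0$ as $\gamma$; likewise for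 $V_\gamma$, $I_f$ and $V_f$. (5) Suppose $f=gh$ with holomorphic germs $g,h:(\mathbb C^2,0)\to(\mathbb C,0)$. If $I_g$ and $I_h$ are finite, then $I_f$ is finite and $I_f=I_g+I_h+6\,m(g,h)$. If $V_g$ and $V_h$ are finite, then $V_f$ is finite and $V_f=V_g+V_h+12\,m(g,h)$. (6) $I_{\gamma\circ\varphi}=I_\gamma$ and $V_{\gamma\circ\varphi}=V_\gamma$ for every biholomorphic germ $\varphi:(\mathbb C,0)\to(\mathbb C,0)$; $I_{af}=I_f$ and $V_{af}=V_f$ for every unit $a\in\mathcal O$. (7) $I_\gamma=\infty$ (resp. $I_f=\infty$) if and only if $C_\gamma$ (resp. $C_f$) contains the germ at $0$ of a line. $V_\gamma=\infty$ (resp. $V_f=\infty$) if and only if $C_\gamma$ (resp. $C_f$) contains the germ at $0$ of a circle or line. -/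

import Mathlib

open Filter Topology

noncomputable section

namespace PlaneCurve

/-! ### Germs of holomorphic functions and intersection numbers -/

instance germAlgebra (p : ℂ × ℂ) : Algebra ℂ (Germ (𝓝 p) ℂ) :=
  Algebra.ofModule
    (fun r x y => Germ.inductionOn₂ x y fun f g => by
      change ((fun z => (r * f z) * g z : ℂ × ℂ → ℂ) : Germ (𝓝 p) ℂ)
        = ((fun z => r * (f z * g z) : ℂ × ℂ → ℂ) : Germ (𝓝 p) ℂ)
      simp only [mul_assoc])
    (fun r x y => Germ.inductionOn₂ x y fun f g => by
      change ((fun z => f z * (r * g z) : ℂ × ℂ → ℂ) : Germ (𝓝 p) ℂ)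
        = ((fun z => r * (f z * g z) : ℂ × ℂ → ℂ) : Germ (𝓝 p) ℂ)
      simp only [mul_left_comm])

/-- The ring of germs at `p` of holomorphic functions on `ℂ²`. -/
def holGerms (p : ℂ × ℂ) : Subalgebra ℂ (Germ (𝓝 p) ℂ) where
  carrier := {φ | ∃ f : ℂ × ℂ → ℂ, AnalyticAt ℂ f p ∧ (f : Germ (𝓝 p) ℂ) = φ}
  mul_mem' := by
    rintro _ _ ⟨f, hf, rfl⟩ ⟨g, hg, rfl⟩
    exact ⟨f * g, hf.mul hg, rfl⟩
  add_mem' := by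
    rintro _ _ ⟨f, hf, rfl⟩ ⟨g, hg, rfl⟩
    exact ⟨f + g, hf.add hg, rfl⟩
  algebraMap_mem' := by
    intro r
    refine ⟨fun _ => r * 1, analyticAt_const, ?_⟩
    rw [Algebra.algebraMap_eq_smul_one]
    rfl

open Classical in
/-- The germ at `p` of a function holomorphic near `p` (and `0` for all other functions). -/
def germAt (f : ℂ × ℂ → ℂ) (p : ℂ × ℂ) : holGerms p :=
  if hf : AnalyticAt ℂ f p then ⟨(f : Germ (𝓝 p) ℂ), f, hf, rfl⟩ else 0

/-- The intersection number of `f` and `g` at `p`: the dimension over `ℂ` of the ring of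
holomorphic germs at `p` modulo the ideal generated by `f` and `g`. -/
def intersectionNumber (f g : ℂ × ℂ → ℂ) (p : ℂ × ℂ) : ℕ∞ :=
  Cardinal.toENat
    (Module.rank ℂ (holGerms p ⧸ Ideal.span {germAt f p, germAt g p}))

/-! ### The curves -/

/-- `f = 0` is a reduced equation of a germ of curve at `p`: `f` is holomorphic near `p`,
vanishes at `p` and its germ has no repeated factors. -/
structure IsReducedEquation (f : ℂ × ℂ → ℂ) (p : ℂ × ℂ) : Prop where
  analyticAt : AnalyticAt ℂ f p
  map_eq_zero : f p = 0
  squarefree : Squarefree (germAt f p)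

/-- `γ` represents a non-constant holomorphic germ `(ℂ, 0) → (ℂ², 0)`. -/
structure IsParametrisation (γ : ℂ → ℂ × ℂ) : Prop where
  analyticAt : AnalyticAt ℂ γ 0
  map_zero : γ 0 = 0
  nonconstant : ¬ ∀ᶠ t in 𝓝 (0 : ℂ), γ t = 0

/-- Two maps have the same `k`-jet at the origin. -/
def SameJet {E F : Type*} [NormedAddCommGroup E] [NormedSpace ℂ E]
    [NormedAddCommGroup F] [NormedSpace ℂ F] (k : ℕ) (f g : E → F) : Prop :=
  ∀ j ≤ k, iteratedFDeriv ℂ j f 0 = iteratedFDeriv ℂ j g 0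

/-! ### Inflections and vertices of parametrised curves -/

/-- `i_γ = x' y'' - y' x''`. -/
def iParam (γ : ℂ → ℂ × ℂ) (t : ℂ) : ℂ :=
  let x := fun s => (γ s).1
  let y := fun s => (γ s).2
  deriv x t * iteratedDeriv 2 y t - deriv y t * iteratedDeriv 2 x t

/-- `v_γ = (x'² + y'²)(x' y''' - x''' y') + 3 (x' x'' + y' y'')(x'' y' - x' y'')`. -/
def vParam (γ : ℂ → ℂ × ℂ) (t : ℂ) : ℂ :=
  let x := fun s => (γ s).1
  let y := fun s => (γ s).2
  (deriv x t ^ 2 + deriv y t ^ 2)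
      * (deriv x t * iteratedDeriv 3 y t - iteratedDeriv 3 x t * deriv y t)
    + 3 * (deriv x t * iteratedDeriv 2 x t + deriv y t * iteratedDeriv 2 y t)
      * (iteratedDeriv 2 x t * deriv y t - deriv x t * iteratedDeriv 2 y t)

/-- The number `I_γ` of inflections of a parametrised curve concentrated at the parameter `0`. -/
def inflParam (γ : ℂ → ℂ × ℂ) : ℕ∞ := analyticOrderAt (iParam γ) 0

/-- The number `V_γ` of vertices of a parametrised curve concentrated at the parameter `0`. -/
def vertParam (γ : ℂ → ℂ × ℂ) : ℕ∞ := analyticOrderAt (vParam γ) 0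

/-! ### Inflections and vertices of curves given by an equation -/

/-- The partial derivative with respect to the first variable. -/
def dx (f : ℂ × ℂ → ℂ) (p : ℂ × ℂ) : ℂ := fderiv ℂ f p (1, 0)

/-- The partial derivative with respect to the second variable. -/
def dy (f : ℂ × ℂ → ℂ) (p : ℂ × ℂ) : ℂ := fderiv ℂ f p (0, 1)

/-- `i_f = f_y² f_xx - 2 f_x f_y f_xy + f_x² f_yy`. -/
def iEq (f : ℂ × ℂ → ℂ) (p : ℂ × ℂ) : ℂ :=
  dy f p ^ 2 * dx (dx f) p - 2 * dx f p * dy f p * dx (dy f) p + dx f p ^ 2 * dy (dy f) p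

/-- `v_f = (f_x² + f_y²)(f_x³ f_yyy - 3 f_x² f_y f_xyy + 3 f_x f_y² f_xxy - f_y³ f_xxx)
- 3 ((f_x² - f_y²) f_xy - f_x f_y (f_xx - f_yy)) i_f`. -/
def vEq (f : ℂ × ℂ → ℂ) (p : ℂ × ℂ) : ℂ :=
  (dx f p ^ 2 + dy f p ^ 2)
      * (dx f p ^ 3 * dy (dy (dy f)) p - 3 * dx f p ^ 2 * dy f p * dx (dy (dy f)) p
        + 3 * dx f p * dy f p ^ 2 * dx (dx (dy f)) p - dy f p ^ 3 * dx (dx (dx f)) p)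
    - 3 * ((dx f p ^ 2 - dy f p ^ 2) * dx (dy f) p
        - dx f p * dy f p * (dx (dx f) p - dy (dy f) p)) * iEq f p

/-- The point `p` is an inflection of the curve `f = 0`. -/
def IsInflection (f : ℂ × ℂ → ℂ) (p : ℂ × ℂ) : Prop := f p = 0 ∧ iEq f p = 0

/-- The point `p` is a vertex of the curve `f = 0`. -/
def IsVertex (f : ℂ × ℂ → ℂ) (p : ℂ × ℂ) : Prop := f p = 0 ∧ vEq f p = 0

/-- The number `I_f` of inflections of the curve `f = 0` concentrated at `p`. -/
def inflEq (f : ℂ × ℂ → ℂ) (p : ℂ × ℂ) : ℕ∞ := intersectionNumber f (iEq f) p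

/-- The number `V_f` of vertices of the curve `f = 0` concentrated at `p`. -/
def vertEq (f : ℂ × ℂ → ℂ) (p : ℂ × ℂ) : ℕ∞ := intersectionNumber f (vEq f) p

/-! ### Similarities, circles, lines and contact -/

/-- Complex similarities of `ℂ²`: the affine automorphisms whose extension to the projective plane
preserves the pair of circular points at infinity. The first linear form fixes each of these two
points, the second one exchanges them. -/
def IsSimilarity (A : (ℂ × ℂ) ≃ᵃ[ℂ] (ℂ × ℂ)) : Prop :=
  ∃ a b : ℂ, a ^ 2 + b ^ 2 ≠ 0 ∧
    ((∀ x y : ℂ, A.linear (x, y) = (a * x + b * y, -b * x + a * y)) ∨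
      (∀ x y : ℂ, A.linear (x, y) = (a * x + b * y, b * x - a * y)))

/-- The complex circles and lines `A (x² + y²) + 2 B x + 2 C y = 0` through the origin; the lines
are those with `A = 0`. -/
structure CircleOrLine where
  A : ℂ
  B : ℂ
  C : ℂ
  nonzero : (A, B, C) ≠ 0

/-- The left-hand side of the equation of a circle or line. -/
def CircleOrLine.eqn (c : CircleOrLine) (z : ℂ × ℂ) : ℂ :=
  c.A * (z.1 ^ 2 + z.2 ^ 2) + 2 * c.B * z.1 + 2 * c.C * z.2

/-- The set of points of a circle or line. -/
def CircleOrLine.carrier (c : CircleOrLine) : Set (ℂ × ℂ) := {z | c.eqn z = 0}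

/-- A line through the origin. -/
def CircleOrLine.IsLine (c : CircleOrLine) : Prop := c.A = 0

/-- The image germ of `γ` at the origin contains the germ of `S` at the origin. -/
def ParamContains (γ : ℂ → ℂ × ℂ) (S : Set (ℂ × ℂ)) : Prop :=
  ∀ U ∈ 𝓝 (0 : ℂ), ∀ᶠ z in 𝓝[S] (0 : ℂ × ℂ), z ∈ γ '' U

/-- The germ at the origin of the curve `f = 0` contains the germ of `S` at the origin. -/
def EqContains (f : ℂ × ℂ → ℂ) (S : Set (ℂ × ℂ)) : Prop :=
  ∀ᶠ z in 𝓝[S] (0 : ℂ × ℂ), f z = 0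

/-- The order of contact at the origin of the curve `f = 0`, smooth there, with the curve `g = 0`
is `k`: this is the order of `g ∘ γ`, where `γ` is a regular parametrisation of `f = 0`. -/
def HasContact (f g : ℂ × ℂ → ℂ) (k : ℕ∞) : Prop :=
  ∃ γ : ℂ → ℂ × ℂ, AnalyticAt ℂ γ 0 ∧ γ 0 = 0 ∧ deriv γ 0 ≠ 0 ∧
    (∀ᶠ t in 𝓝 (0 : ℂ), f (γ t) = 0) ∧ analyticOrderAt (fun t => g (γ t)) 0 = k

/-- The linear equation of the tangent line at the origin of the curve `f = 0`, smooth there. -/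
def tangentLine (f : ℂ × ℂ → ℂ) (z : ℂ × ℂ) : ℂ := dx f 0 * z.1 + dy f 0 * z.2

/-- `c` is an osculating circle or line at the origin of the curve `f = 0`, smooth there: its order
of contact is maximal among all circles and lines. -/
def IsOsculating (f : ℂ × ℂ → ℂ) (c : CircleOrLine) : Prop :=
  ∃ k, HasContact f c.eqn k ∧ ∀ (c' : CircleOrLine) (k' : ℕ∞), HasContact f c'.eqn k' → k' ≤ k

/-- Homogeneous coordinates `(X : Y : Z)` of the centre of curvature at the origin of the curve
`f = 0`, smooth there. In affine coordinates it is `- (f_x² + f_y²) / i_f • (f_x, f_y)`, that is,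
`γ + (x'² + y'²) / (x' y'' - x'' y') • (-y', x')` for a regular parametrisation `γ = (x, y)`.
The centre is undefined when the three coordinates vanish. -/
def centreOfCurvature (f : ℂ × ℂ → ℂ) : ℂ × ℂ × ℂ :=
  (-(dx f 0 ^ 2 + dy f 0 ^ 2) * dx f 0, -(dx f 0 ^ 2 + dy f 0 ^ 2) * dy f 0, iEq f 0)

/-- The centre of curvature is a point of `ℂ²`. -/
def HasFiniteCentre (f : ℂ × ℂ → ℂ) : Prop := (centreOfCurvature f).2.2 ≠ 0

/-- The centre of curvature is a point of the line at infinity. -/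
def HasInfiniteCentre (f : ℂ × ℂ → ℂ) : Prop :=
  centreOfCurvature f ≠ 0 ∧ (centreOfCurvature f).2.2 = 0

/-- `c` is a circle and its centre is the (finite) centre of curvature of `f = 0`. -/
def IsCentredAtCentreOfCurvature (f : ℂ × ℂ → ℂ) (c : CircleOrLine) : Prop :=
  c.A ≠ 0 ∧
    -c.B / c.A = (centreOfCurvature f).1 / (centreOfCurvature f).2.2 ∧
    -c.C / c.A = (centreOfCurvature f).2.1 / (centreOfCurvature f).2.2

end PlaneCurve

end

open PlaneCurve

/-! Everything is computed in the ring `OO` of germs at the origin, where i_f and v_f become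
expressions `iO` and `vO` in the commuting derivations `dX` and `dY`. Parametrised curves are placed
in the same ring: a germ in t is regarded as a germ of the first coordinate, an element of `RX`, so
that `dX` is d/dt and the invariants become `iP` and `vP`, measured by `ordX`.

The formal core is that v is built from i by one derivation. With E = x'² + y'², v = E i' - (3/2) E'
i along a parametrised curve; for an equation, with D = f_y ∂_x - f_x ∂_y and E = f_x² + f_y², v_f =
(3/2) D(E) i_f - E D(i_f). A similarity rescales E, i and D by constants, and a change of parameter
multiplies i and v by the powers 3 and 6 of its derivative. Modulo f one has i_{af} ≡ a³ i_f and
v_{af} ≡ a⁶ v_f (`dvd_iO_vO_mul_sub`); with additivity of intersection numbers (`inum_mul`) this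
gives invariance under units and the constants 6 = 3 + 3 and 12 = 6 + 6 of the product formulas.

The local algebra rests on Weierstrass division, proved by inverting an operator on the disc algebra
that depends analytically on x. It shows that germs with infinite intersection number share a prime
factor (`exists_common_prime`), and that the intersection number with a smooth curve is the order
along any regular parametrisation (`IsSmoothGerm.inum_eq_ordAlong`). Finite determinacy is
Nakayama's lemma. An invariant equal to 1 forces smoothness, since at a singular point both
generators of the ideal lie in the square of the maximal ideal.

Infinite invariants: on an irreducible curve i = 0 makes the slope of the tangent constant, and v =
0 with i ≠ 0 makes the centre of curvature constant; integrating gives a line or a circle. The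
algebraic form of "derivative zero implies constant" on a possibly singular curve is
`exists_dvd_sub_smul`: a quotient of two germs killed by D is algebraic over the functions of x, a
minimal equation has constant coefficients up to a factor, and ℂ is algebraically closed.

At a smooth point, let l be the restriction of the equation of a circle to a regular
parametrisation. Its first three derivatives at 0 are linear in (A, B, C), with determinant a
multiple of v. The Wronskian of x', y', l' equals -2A v, which gives order of contact V + 3 when i ≠
0 (`IsRegularPair.ordX_along_eq`); for lines the Wronskian of x' or y' with l' is a multiple of i,
which gives I + 2 (`IsRegularPair.ordX_along_tangent`). -/

open Filter Topology

noncomputable section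

namespace PlaneCurve

/-! ### Weierstrass division -/

/-- A continuous function with values in a Banach space which is holomorphic when tested against a
separating family of functionals is analytic. -/
theorem analyticAt_of_separating {E ι : Type*} [NormedAddCommGroup E] [NormedSpace ℂ E]
    [CompleteSpace E] {F : ℂ → E} {R : ℝ} (hR : 0 < R)
    (hF : ContinuousOn F (Metric.closedBall 0 R)) (φ : ι → E →L[ℂ] ℂ)
    (hsep : ∀ u v : E, (∀ i, φ i u = φ i v) → u = v)
    (hd : ∀ i, DifferentiableOn ℂ (fun z => φ i (F z)) (Metric.ball 0 R)) :
    AnalyticAt ℂ F 0 := by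
  lift R to NNReal using hR.le
  have hR' : (0 : NNReal) < R := by exact_mod_cast hR
  have hci : CircleIntegrable F 0 R :=
    (hF.mono Metric.sphere_subset_closedBall).circleIntegrable hR.le
  -- The Cauchy integral of a merely continuous function already has a power series. Holomorphy is
  -- needed only to identify this integral with F, and that may be checked one functional at a time.
  have hp := hasFPowerSeriesOn_cauchy_integral hci hR'
  refine hp.analyticAt.congr ?_
  filter_upwards [Metric.ball_mem_nhds (0 : ℂ) hR] with w hw
  apply hsep
  intro i
  have hdc : DiffContOnCl ℂ (fun z => φ i (F z)) (Metric.ball 0 R) := by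
    refine ⟨hd i, ?_⟩
    rw [closure_ball _ hR.ne']
    exact (φ i).continuous.comp_continuousOn hF
  have h1 := hdc.circleIntegral_sub_inv_smul hw
  have hcont : ContinuousOn (fun z => (z - w)⁻¹ • F z) (Metric.sphere 0 R) := by
    refine ContinuousOn.smul (ContinuousOn.inv₀ (by fun_prop) ?_)
      (hF.mono Metric.sphere_subset_closedBall)
    intro z hz h
    rw [sub_eq_zero] at h
    subst h
    simp only [Metric.mem_sphere, Metric.mem_ball] at hz hw
    exact absurd hz hw.ne
  have h2 : φ i (∮ z in C(0, R), (z - w)⁻¹ • F z) = ∮ z in C(0, R), (z - w)⁻¹ • φ i (F z) := by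
    unfold circleIntegral
    rw [← ContinuousLinearMap.intervalIntegral_comp_comm _ (hcont.circleIntegrable hR.le).out]
    simp
  rw [map_smul, h2, h1, smul_smul, inv_mul_cancel₀ Complex.two_pi_I_ne_zero, one_smul]

variable {s : ℝ}

/-- The extension by zero of a continuous function on a closed disc. -/
def discExt (h : C(Metric.closedBall (0 : ℂ) s, ℂ)) (z : ℂ) : ℂ :=
  Function.extend Subtype.val h 0 z

theorem discExt_coe (h : C(Metric.closedBall (0 : ℂ) s, ℂ)) (z : Metric.closedBall (0 : ℂ) s) :
    discExt h z = h z :=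
  Subtype.val_injective.extend_apply _ _ _

theorem discExt_of_mem (h : C(Metric.closedBall (0 : ℂ) s, ℂ)) {z : ℂ}
    (hz : z ∈ Metric.closedBall (0 : ℂ) s) : discExt h z = h ⟨z, hz⟩ :=
  discExt_coe h ⟨z, hz⟩

theorem differentiableOn_discExt_iff (h : C(Metric.closedBall (0 : ℂ) s, ℂ)) :
    DifferentiableOn ℂ (discExt h) (Metric.ball 0 s) ↔
      ∃ f : ℂ → ℂ, DifferentiableOn ℂ f (Metric.ball 0 s) ∧
        ∀ (z : ℂ) (hz : z ∈ Metric.ball (0 : ℂ) s),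
          h ⟨z, Metric.ball_subset_closedBall hz⟩ = f z := by
  constructor
  · intro H
    exact ⟨_, H, fun z hz => (discExt_of_mem h _).symm⟩
  · rintro ⟨f, hf, hh⟩
    refine hf.congr fun z hz => ?_
    rw [discExt_of_mem h (Metric.ball_subset_closedBall hz), hh z hz]

variable (s) in
/-- The disc algebra of radius `s`. -/
def discAlgebra : Subalgebra ℂ C(Metric.closedBall (0 : ℂ) s, ℂ) where
  carrier := {h | DifferentiableOn ℂ (discExt h) (Metric.ball 0 s)}
  mul_mem' := by
    intro a b ha hb
    refine (differentiableOn_discExt_iff _).2 ⟨_, DifferentiableOn.mul ha hb, fun z hz => ?_⟩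
    simp [discExt_of_mem _ (Metric.ball_subset_closedBall hz)]
  add_mem' := by
    intro a b ha hb
    refine (differentiableOn_discExt_iff _).2 ⟨_, DifferentiableOn.add ha hb, fun z hz => ?_⟩
    simp [discExt_of_mem _ (Metric.ball_subset_closedBall hz)]
  algebraMap_mem' := fun r =>
    (differentiableOn_discExt_iff _).2 ⟨fun _ => r, differentiableOn_const _, fun z hz => rfl⟩

/-- Uniform limits of holomorphic functions are holomorphic. Closedness makes the disc algebra a
Banach space, as the inversion of operators below requires. -/
theorem isClosed_discAlgebra :
    IsClosed (discAlgebra s : Set C(Metric.closedBall (0 : ℂ) s, ℂ)) := by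
  refine IsSeqClosed.isClosed fun u h hu hlim => ?_
  have hunif := ContinuousMap.tendsto_iff_tendstoUniformly.1 hlim
  have : TendstoUniformlyOn (fun n => discExt (u n)) (discExt h) atTop (Metric.ball 0 s) := by
    rw [Metric.tendstoUniformlyOn_iff]
    intro ε hε
    filter_upwards [Metric.tendstoUniformly_iff.1 hunif ε hε] with n hn z hz
    rw [discExt_of_mem _ (Metric.ball_subset_closedBall hz),
      discExt_of_mem _ (Metric.ball_subset_closedBall hz)]
    exact hn _
  exact this.tendstoLocallyUniformlyOn.differentiableOn (Eventually.of_forall hu)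
    Metric.isOpen_ball

instance : CompleteSpace (discAlgebra s) := isClosed_discAlgebra.completeSpace_coe

theorem norm_discExt_le (h : discAlgebra s) {z : ℂ} (hz : z ∈ Metric.closedBall (0 : ℂ) s) :
    ‖discExt h.1 z‖ ≤ ‖h‖ := by
  rw [discExt_of_mem _ hz]
  exact h.1.norm_coe_le_norm _

theorem continuousOn_discExt (h : C(Metric.closedBall (0 : ℂ) s, ℂ)) :
    ContinuousOn (discExt h) (Metric.closedBall 0 s) := by
  rw [continuousOn_iff_continuous_domRestrict]
  convert h.continuous using 1
  ext z
  exact discExt_coe h z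

open Classical in
variable (s) in
/-- Evaluation at a point as a functional on the disc algebra. -/
def discEval (z : ℂ) : discAlgebra s →L[ℂ] ℂ :=
  if hz : z ∈ Metric.closedBall (0 : ℂ) s then
    (ContinuousMap.evalCLM ℂ (⟨z, hz⟩ : Metric.closedBall (0 : ℂ) s)).comp
      (discAlgebra s).toSubmodule.subtypeL
  else 0

theorem discEval_apply {z : ℂ} (hz : z ∈ Metric.closedBall (0 : ℂ) s) (h : discAlgebra s) :
    discEval s z h = discExt h.1 z := by
  rw [discEval, dif_pos hz, discExt_of_mem _ hz]
  rfl

theorem discAlgebra_ext {u v : discAlgebra s}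
    (h : ∀ z ∈ Metric.closedBall (0 : ℂ) s, discExt u.1 z = discExt v.1 z) : u = v := by
  apply Subtype.ext
  ext z
  rw [← discExt_coe, ← discExt_coe]
  exact h z z.2

/-- On a fixed function this is holomorphy. Cauchy's estimate for the derivative, uniform on the
unit ball of the disc algebra, makes evaluation Lipschitz in operator norm, so the criterion with
separating functionals applies. -/
theorem analyticAt_discEval (hs : 0 < s) : AnalyticAt ℂ (discEval s) 0 := by
  have hsub : Metric.closedBall (0 : ℂ) (s / 2) ⊆ Metric.closedBall 0 s :=
    Metric.closedBall_subset_closedBall (by linarith)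
  have hsub' : Metric.closedBall (0 : ℂ) (s / 2) ⊆ Metric.ball 0 s :=
    Metric.closedBall_subset_ball (by linarith)
  refine analyticAt_of_separating (half_pos hs) ?_
    (fun h : discAlgebra s => ContinuousLinearMap.apply ℂ ℂ h)
    (fun u v huv => ContinuousLinearMap.ext fun h => huv h) ?_
  · have : LipschitzOnWith (Real.toNNReal (3 / s)) (discEval s)
        (Metric.closedBall (0 : ℂ) (s / 2)) := by
      refine LipschitzOnWith.of_dist_le_mul fun z hz w hw => ?_
      rw [dist_eq_norm, dist_eq_norm, Real.coe_toNNReal _ (by positivity)]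
      refine ContinuousLinearMap.opNorm_le_bound _ (by positivity) fun h => ?_
      rw [sub_apply, discEval_apply (hsub hz), discEval_apply (hsub hw)]
      have hb : ∀ x ∈ Metric.closedBall (0 : ℂ) (s / 2), ‖deriv (discExt h.1) x‖ ≤ 3 / s * ‖h‖ := by
        intro x hx
        -- Since 1/2 + 1/3 < 1, discs of radius s/3 about points of the half-size disc stay inside;
        -- this is the origin of the Lipschitz constant 3/s.
        have hx' : Metric.closedBall x (s / 3) ⊆ Metric.ball 0 s := by
          refine Metric.closedBall_subset_ball' ?_
          rw [Metric.mem_closedBall] at hx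
          linarith
        have := Complex.norm_deriv_le_of_forall_mem_sphere_norm_le (c := x) (R := s / 3)
          (C := ‖h‖) (f := discExt h.1) (by positivity)
          (DifferentiableOn.diffContOnCl_ball h.2 hx')
          (fun z hz => norm_discExt_le h (Metric.ball_subset_closedBall
            (hx' (Metric.sphere_subset_closedBall hz))))
        calc _ ≤ ‖h‖ / (s / 3) := this
          _ = 3 / s * ‖h‖ := by rw [div_div_eq_mul_div, mul_comm, mul_div_right_comm]
      have := (convex_closedBall (0 : ℂ) (s / 2)).norm_image_sub_le_of_norm_deriv_le
        (fun x hx => (h.2.differentiableAt (Metric.isOpen_ball.mem_nhds (hsub' hx)))) hb hw hz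
      calc _ ≤ 3 / s * ‖h‖ * ‖z - w‖ := this
        _ = _ := by ring
    exact this.continuousOn
  · intro h
    refine (h.2.mono (Metric.ball_subset_closedBall.trans hsub')).congr fun z hz => ?_
    exact discEval_apply (hsub (Metric.ball_subset_closedBall hz)) h

variable {s : ℝ}

open Classical in
/-- The slices `f (x, ·)` of an analytic function form an analytic family in the disc algebra. -/
theorem exists_analyticAt_slice {f : ℂ × ℂ → ℂ} {R : ℝ} (hR : 0 < R)
    (hf : AnalyticOnNhd ℂ f (Metric.closedBall 0 R ×ˢ Metric.closedBall 0 s)) :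
    ∃ F : ℂ → discAlgebra s, AnalyticAt ℂ F 0 ∧ ∀ x ∈ Metric.closedBall (0 : ℂ) R,
      ∀ y ∈ Metric.closedBall (0 : ℂ) s, discExt (F x).1 y = f (x, y) := by
  let f' : C(Metric.closedBall (0 : ℂ) R × Metric.closedBall (0 : ℂ) s, ℂ) :=
    ⟨fun z => f (z.1, z.2), by
      refine hf.continuousOn.comp_continuous (by fun_prop) fun z => ⟨z.1.2, z.2.2⟩⟩
  have hmem : ∀ x : Metric.closedBall (0 : ℂ) R, f'.curry x ∈ discAlgebra s := by
    intro x
    refine (differentiableOn_discExt_iff _).2 ⟨fun y => f (x, y), fun y hy => ?_, fun y hy => rfl⟩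
    have h1 : AnalyticAt ℂ f (x, y) := hf _ ⟨x.2, Metric.ball_subset_closedBall hy⟩
    have h2 : DifferentiableAt ℂ (fun y : ℂ => f (x, y)) y := by
      have := h1.differentiableAt.comp y
        ((differentiableAt_const (x : ℂ)).prodMk (differentiableAt_id (x := y)))
      exact this
    exact h2.differentiableWithinAt
  let F : ℂ → discAlgebra s := fun x =>
    if hx : x ∈ Metric.closedBall (0 : ℂ) R then ⟨f'.curry ⟨x, hx⟩, hmem _⟩ else 0
  have hF : ∀ x ∈ Metric.closedBall (0 : ℂ) R, ∀ y ∈ Metric.closedBall (0 : ℂ) s,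
      discExt (F x).1 y = f (x, y) := by
    intro x hx y hy
    simp only [F, dif_pos hx]
    rw [discExt_of_mem _ hy]
    rfl
  refine ⟨F, ?_, hF⟩
  refine analyticAt_of_separating hR ?_
    (fun y : Metric.closedBall (0 : ℂ) s => discEval s y) (fun u v huv => ?_) ?_
  · rw [continuousOn_iff_continuous_domRestrict]
    have : (Metric.closedBall (0 : ℂ) R).domRestrict F = fun x => ⟨f'.curry x, hmem x⟩ := by
      funext x
      exact dif_pos x.2
    rw [this]
    exact Continuous.subtype_mk f'.curry.continuous _
  · apply discAlgebra_ext
    intro z hz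
    have := huv ⟨z, hz⟩
    rwa [discEval_apply hz, discEval_apply hz] at this
  · intro y
    have : DifferentiableOn ℂ (fun x => f (x, y)) (Metric.ball 0 R) := by
      intro x hx
      have h1 : AnalyticAt ℂ f (x, y) := hf _ ⟨Metric.ball_subset_closedBall hx, y.2⟩
      have h2 : DifferentiableAt ℂ (fun x : ℂ => f (x, y)) x := by
        exact DifferentiableAt.comp (g := f) (f := fun x : ℂ => (x, (y : ℂ))) x
          h1.differentiableAt (by fun_prop)
      exact h2.differentiableWithinAt
    refine this.congr fun x hx => ?_
    rw [discEval_apply y.2]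
    exact hF x (Metric.ball_subset_closedBall hx) y y.2

/-- Functions continuous on a disc and holomorphic inside, as elements of the disc algebra. -/
theorem exists_discAlgebra {k : ℂ → ℂ} (hc : ContinuousOn k (Metric.closedBall 0 s))
    (hd : DifferentiableOn ℂ k (Metric.ball 0 s)) :
    ∃ h : discAlgebra s, ∀ y ∈ Metric.closedBall (0 : ℂ) s, discExt h.1 y = k y := by
  let k' : C(Metric.closedBall (0 : ℂ) s, ℂ) :=
    ⟨(Metric.closedBall (0 : ℂ) s).domRestrict k, continuousOn_iff_continuous_domRestrict.1 hc⟩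
  refine ⟨⟨k', (differentiableOn_discExt_iff _).2 ⟨k, hd, fun z hz => rfl⟩⟩, fun y hy => ?_⟩
  rw [discExt_of_mem _ hy]
  rfl

/-- The quotient is the difference quotient at 0, which stays in the disc algebra because its
singularity is removable. Iterating it gives division by powers of y. -/
theorem exists_eq_add_mul (hs : 0 < s) (h : discAlgebra s) :
    ∃ k : discAlgebra s, ∀ y ∈ Metric.closedBall (0 : ℂ) s,
      discExt h.1 y = discExt h.1 0 + y * discExt k.1 y := by
  have h0 : Metric.ball (0 : ℂ) s ∈ 𝓝 0 := Metric.ball_mem_nhds _ hs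
  have hd : DifferentiableAt ℂ (discExt h.1) 0 := h.2.differentiableAt h0
  obtain ⟨k, hk⟩ := exists_discAlgebra (s := s) (k := dslope (discExt h.1) 0)
    ((continuousOn_dslope (Metric.closedBall_mem_nhds _ hs)).2 ⟨continuousOn_discExt _, hd⟩)
    ((Complex.differentiableOn_dslope h0).2 h.2)
  refine ⟨k, fun y hy => ?_⟩
  have := sub_smul_dslope (discExt h.1) 0 y
  rw [hk y hy]
  simp only [sub_zero, smul_eq_mul] at this
  rw [this]
  ring

theorem discAlgebra_division (hs : 0 < s) (n : ℕ) (h : discAlgebra s) :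
    ∃ (q : discAlgebra s) (r : Fin n → ℂ), ∀ y ∈ Metric.closedBall (0 : ℂ) s,
      discExt h.1 y = discExt q.1 y * y ^ n + ∑ j, r j * y ^ (j : ℕ) := by
  induction n generalizing h with
  | zero => exact ⟨h, Fin.elim0, by simp⟩
  | succ n ih =>
    obtain ⟨k, hk⟩ := exists_eq_add_mul hs h
    obtain ⟨q, r, hq⟩ := ih k
    refine ⟨q, Fin.cons (discExt h.1 0) r, fun y hy => ?_⟩
    rw [hk y hy, hq y hy, Fin.sum_univ_succ]
    simp only [Fin.cons_zero, Fin.cons_succ, Fin.val_zero, Fin.val_succ, pow_succ, pow_zero,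
      mul_one, mul_add, Finset.mul_sum]
    rw [add_comm, add_assoc, add_comm (discExt h.1 0)]
    congr 1
    · ring
    · congr 1
      exact Finset.sum_congr rfl fun j _ => by ring

/-- Uniqueness in division by a power of y: evaluation at 0 kills the constant term, and dividing by
y lowers n. Continuity of q is enough, the value at 0 of the divided relation being a limit from y ≠
0. -/
theorem eq_zero_of_mul_pow_add_sum_eq_zero {n : ℕ} {q : ℂ → ℂ} (hq : ContinuousAt q 0)
    {r : Fin n → ℂ} (h : ∀ᶠ y in 𝓝 (0 : ℂ), q y * y ^ n + ∑ j, r j * y ^ (j : ℕ) = 0) :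
    r = 0 := by
  induction n with
  | zero => exact Subsingleton.elim _ _
  | succ n ih =>
    have h0 : r 0 = 0 := by
      have := h.self_of_nhds
      simpa [Fin.sum_univ_succ] using this
    let p : ℂ → ℂ := fun y => q y * y ^ n + ∑ j : Fin n, r j.succ * y ^ (j : ℕ)
    have hp : ∀ᶠ y in 𝓝[≠] (0 : ℂ), p y = 0 := by
      filter_upwards [h.filter_mono nhdsWithin_le_nhds, self_mem_nhdsWithin] with y hy hy0
      refine (mul_eq_zero.1 (?_ : y * p y = 0)).resolve_left hy0
      rw [Fin.sum_univ_succ, h0] at hy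
      rw [← hy]
      simp only [p, mul_add, Finset.mul_sum, Fin.val_succ, zero_mul, zero_add, pow_succ]
      congr 1
      · ring
      · exact Finset.sum_congr rfl fun j _ => by ring
    have hpc : ContinuousAt p 0 := by
      refine (hq.mul (by fun_prop)).add (by fun_prop)
    have hp0 : p 0 = 0 := by
      refine tendsto_nhds_unique (hpc.tendsto.mono_left nhdsWithin_le_nhds) ?_ (l := 𝓝[≠] (0 : ℂ))
      exact tendsto_const_nhds.congr' (hp.mono fun y hy => hy.symm)
    have hr := ih (r := fun j => r j.succ) (by
      rw [eventually_nhdsWithin_iff] at hp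
      filter_upwards [hp] with y hy
      by_cases hy0 : y = 0
      · subst hy0; exact hp0
      · exact hy hy0)
    funext j
    refine Fin.cases h0 (fun j => congrFun hr j) j

/-- The operator `(q, r) ↦ q g + ∑ r_j y ^ j` on the disc algebra. -/
theorem exists_division_operator (n : ℕ) :
    ∃ L : discAlgebra s →L[ℂ] ((discAlgebra s × (Fin n → ℂ)) →L[ℂ] discAlgebra s),
    ∃ L₀ : (discAlgebra s × (Fin n → ℂ)) →L[ℂ] discAlgebra s,
      ∀ g q r, ∀ y ∈ Metric.closedBall (0 : ℂ) s, discExt ((L g + L₀) (q, r)).1 y =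
        discExt q.1 y * discExt g.1 y + ∑ j, r j * y ^ (j : ℕ) := by
  obtain ⟨Y, hY⟩ := exists_discAlgebra (s := s) (k := id) continuousOn_id differentiableOn_id
  have hY' : ∀ (j : ℕ), ∀ y ∈ Metric.closedBall (0 : ℂ) s, discExt (Y ^ j).1 y = y ^ j := by
    intro j y hy
    have := hY y hy
    rw [discExt_of_mem _ hy] at this ⊢
    simp [this]
  let L : discAlgebra s →L[ℂ] ((discAlgebra s × (Fin n → ℂ)) →L[ℂ] discAlgebra s) :=
    ((ContinuousLinearMap.compL ℂ (discAlgebra s × (Fin n → ℂ)) (discAlgebra s)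
      (discAlgebra s)).flip (ContinuousLinearMap.fst ℂ _ _)).comp
        (ContinuousLinearMap.mul ℂ (discAlgebra s)).flip
  let L₀ : (discAlgebra s × (Fin n → ℂ)) →L[ℂ] discAlgebra s :=
    ∑ j : Fin n, ((ContinuousLinearMap.proj (R := ℂ) (φ := fun _ : Fin n => ℂ) j).comp
      (ContinuousLinearMap.snd ℂ _ _)).smulRight (Y ^ (j : ℕ))
  refine ⟨L, L₀, fun g q r y hy => ?_⟩
  have h1 : L g (q, r) = q * g := rfl
  have h2 : L₀ (q, r) = ∑ j, r j • Y ^ (j : ℕ) := by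
    simp [L₀]
  rw [add_apply, h1, h2]
  rw [← discEval_apply hy, map_add, map_sum]
  congr 1
  · rw [discEval_apply hy, discExt_of_mem _ hy, discExt_of_mem _ hy, discExt_of_mem _ hy]
    rfl
  · refine Finset.sum_congr rfl fun j _ => ?_
    rw [map_smul, discEval_apply hy, hY' j y hy, smul_eq_mul]

theorem analyticAt_clm_apply {X E F : Type*} [NormedAddCommGroup X] [NormedSpace ℂ X]
    [NormedAddCommGroup E] [NormedSpace ℂ E] [NormedAddCommGroup F] [NormedSpace ℂ F]
    {A : X → E →L[ℂ] F} {b : X → E} {x : X} (hA : AnalyticAt ℂ A x) (hb : AnalyticAt ℂ b x) :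
    AnalyticAt ℂ (fun x => A x (b x)) x :=
  AnalyticAt.comp (g := fun p : (E →L[ℂ] F) × E => p.1 p.2) (f := fun x => (A x, b x))
    (isBoundedBilinearMap_apply.contDiff (n := ⊤)).contDiffAt.analyticAt (hA.prod hb)

/-- A linear equation depending analytically on a parameter and uniquely solvable at `0` has an
analytic solution. -/
theorem exists_analytic_solution {A E F : Type*} [NormedAddCommGroup A] [NormedSpace ℂ A]
    [NormedAddCommGroup E] [NormedSpace ℂ E] [CompleteSpace E]
    [NormedAddCommGroup F] [NormedSpace ℂ F] [CompleteSpace F]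
    (L : A →L[ℂ] E →L[ℂ] F) (L₀ : E →L[ℂ] F) {G : ℂ → A} {v : ℂ → F} (hG : AnalyticAt ℂ G 0)
    (hv : AnalyticAt ℂ v 0) (hinj : Function.Injective (L (G 0) + L₀))
    (hsurj : Function.Surjective (L (G 0) + L₀)) :
    ∃ S : ℂ → E, AnalyticAt ℂ S 0 ∧ ∀ᶠ x in 𝓝 (0 : ℂ), (L (G x) + L₀) (S x) = v x := by
  let e := ContinuousLinearEquiv.ofBijective (L (G 0) + L₀) (LinearMap.ker_eq_bot.2 hinj)
    (LinearMap.range_eq_top.2 hsurj)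
  let T : ℂ → E →L[ℂ] F := fun x => L (G x) + L₀
  have hT : AnalyticAt ℂ T 0 := by
    have hLG : AnalyticAt ℂ (fun x => L (G x)) 0 :=
      AnalyticAt.comp (g := fun v => L v) (f := G) (L.analyticAt (G 0)) hG
    exact hLG.add analyticAt_const
  have hinv : AnalyticAt ℂ (fun x => ContinuousLinearMap.inverse (T x)) 0 := by
    have h7 : ContDiffAt ℂ ⊤ ContinuousLinearMap.inverse (T 0) :=
      contDiffAt_map_inverse (𝕜 := ℂ) (n := ⊤) e
    exact h7.analyticAt.comp hT
  refine ⟨fun x => ContinuousLinearMap.inverse (T x) (v x), analyticAt_clm_apply hinv hv, ?_⟩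
  have h9 : ∀ᶠ x in 𝓝 (0 : ℂ), T x ∈ Set.range ((↑) : (E ≃L[ℂ] F) → _) :=
    hT.continuousAt.preimage_mem_nhds (ContinuousLinearEquiv.nhds e)
  filter_upwards [h9] with x hx
  obtain ⟨e', he'⟩ := hx
  change T x (ContinuousLinearMap.inverse (T x) (v x)) = v x
  rw [← he', ContinuousLinearMap.inverse_equiv]
  simp

set_option maxHeartbeats 1000000 in
/-- **Weierstrass division theorem** for germs of holomorphic functions of two variables. -/
theorem weierstrass_division {g f : ℂ × ℂ → ℂ} (hg : AnalyticAt ℂ g 0) (hf : AnalyticAt ℂ f 0)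
    {n : ℕ} (hn : analyticOrderAt (fun y => g (0, y)) 0 = n) :
    ∃ (q : ℂ × ℂ → ℂ) (r : Fin n → ℂ → ℂ), AnalyticAt ℂ q 0 ∧ (∀ j, AnalyticAt ℂ (r j) 0) ∧
      ∀ᶠ z in 𝓝 (0 : ℂ × ℂ), f z = q z * g z + ∑ j, r j z.1 * z.2 ^ (j : ℕ) := by
  have hga : AnalyticAt ℂ (fun y : ℂ => g (0, y)) 0 :=
    AnalyticAt.comp (g := g) (f := fun y : ℂ => ((0 : ℂ), y)) hg (by fun_prop)
  obtain ⟨u, hu, hu0, hgu⟩ := (hga.analyticOrderAt_eq_natCast).1 hn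
  simp only [sub_zero, smul_eq_mul] at hgu
  have hne : ∀ᶠ y in 𝓝 (0 : ℂ), u y ≠ 0 := hu.continuousAt.eventually_ne hu0
  obtain ⟨s₁, hs₁, h₁⟩ := Metric.eventually_nhds_iff_ball.1 (hgu.and hne)
  obtain ⟨s₂, hs₂, h₂⟩ := Metric.eventually_nhds_iff_ball.1
    (hg.eventually_analyticAt.and hf.eventually_analyticAt)
  let s := min s₁ s₂ / 2
  have hm : 0 < min s₁ s₂ := lt_min hs₁ hs₂
  have hs : 0 < s := half_pos hm
  have hss : s < min s₁ s₂ := half_lt_self hm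
  have hball : ∀ z ∈ Metric.closedBall (0 : ℂ) s ×ˢ Metric.closedBall (0 : ℂ) s,
      z ∈ Metric.ball (0 : ℂ × ℂ) s₂ := by
    intro z hz
    rw [closedBall_prod_same] at hz
    exact Metric.closedBall_subset_ball (hss.trans_le (min_le_right _ _)) hz
  obtain ⟨G, hG, hG'⟩ := exists_analyticAt_slice hs fun z hz => (h₂ z (hball z hz)).1
  obtain ⟨F, hF, hF'⟩ := exists_analyticAt_slice hs fun z hz => (h₂ z (hball z hz)).2
  have h0s : (0 : ℂ) ∈ Metric.closedBall (0 : ℂ) s := Metric.mem_closedBall_self hs.le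
  have hsnhds : Metric.closedBall (0 : ℂ) s ∈ 𝓝 0 := Metric.closedBall_mem_nhds _ hs
  have hca : ∀ h : discAlgebra s, ContinuousAt (discExt h.1) 0 := fun h =>
    (continuousOn_discExt h.1).continuousAt hsnhds
  -- The slice x = 0 of g has order n, so its remainder modulo y ^ n vanishes and it equals e y ^ n.
  -- The radius was chosen so that e has no zero on the closed disc, hence is invertible in the disc
  -- algebra.
  obtain ⟨e, r₀, he⟩ := discAlgebra_division hs n (G 0)
  have hr₀ : r₀ = 0 := by
    refine eq_zero_of_mul_pow_add_sum_eq_zero (q := fun y => discExt e.1 y - u y)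
      ((hca e).sub hu.continuousAt) ?_
    filter_upwards [hgu, hsnhds] with y hy hys
    have h3 := he y hys
    rw [hG' 0 h0s y hys, hy] at h3
    linear_combination -h3
  subst hr₀
  simp only [Pi.zero_apply, zero_mul, Finset.sum_const_zero, add_zero] at he
  have he0 : ∀ y ∈ Metric.closedBall (0 : ℂ) s, y ≠ 0 → discExt e.1 y = u y := by
    intro y hy hy0
    have h3 := he y hy
    rw [hG' 0 h0s y hy, (h₁ y (Metric.closedBall_subset_ball
      (hss.trans_le (min_le_left _ _)) hy)).1, mul_comm] at h3
    exact (mul_right_cancel₀ (pow_ne_zero n hy0) h3).symm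
  have he0' : discExt e.1 0 = u 0 := by
    refine tendsto_nhds_unique (l := 𝓝[≠] (0 : ℂ)) ((hca e).tendsto.mono_left nhdsWithin_le_nhds)
      ((hu.continuousAt.tendsto.mono_left nhdsWithin_le_nhds).congr' ?_)
    filter_upwards [self_mem_nhdsWithin, mem_nhdsWithin_of_mem_nhds hsnhds] with y hy hys
    exact (he0 y hys hy).symm
  have he' : ∀ y ∈ Metric.closedBall (0 : ℂ) s, discExt e.1 y ≠ 0 := by
    intro y hy
    by_cases hy0 : y = 0
    · rw [hy0, he0']; exact hu0
    · rw [he0 y hy hy0]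
      exact (h₁ y (Metric.closedBall_subset_ball (hss.trans_le (min_le_left _ _)) hy)).2
  obtain ⟨e', hee'⟩ := exists_discAlgebra (s := s) (k := fun y => (discExt e.1 y)⁻¹)
    ((continuousOn_discExt e.1).inv₀ he')
    (DifferentiableOn.inv e.2 fun y hy => he' y (Metric.ball_subset_closedBall hy))
  have hmul : ∀ a b : discAlgebra s, ∀ y ∈ Metric.closedBall (0 : ℂ) s,
      discExt (a * b).1 y = discExt a.1 y * discExt b.1 y := by
    intro a b y hy
    rw [discExt_of_mem _ hy, discExt_of_mem _ hy, discExt_of_mem _ hy]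
    rfl
  obtain ⟨L, L₀, hL⟩ := exists_division_operator (s := s) n
  -- At x = 0 the operator (q, r) ↦ q g + ∑ r_j y ^ j is division by y ^ n up to the unit e, so it
  -- is bijective; invertibility then persists for small x with an analytic inverse.
  have hinj : Function.Injective (L (G 0) + L₀) := by
    rw [injective_iff_map_eq_zero]
    rintro ⟨q, r⟩ hqr
    have h4 : ∀ y ∈ Metric.closedBall (0 : ℂ) s,
        (discExt q.1 y * discExt e.1 y) * y ^ n + ∑ j, r j * y ^ (j : ℕ) = 0 := by
      intro y hy
      have h5 := hL (G 0) q r y hy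
      rw [hqr, he y hy, ← discEval_apply hy, map_zero] at h5
      linear_combination -h5
    have hr : r = 0 := by
      refine eq_zero_of_mul_pow_add_sum_eq_zero ((hca q).mul (hca e)) ?_
      filter_upwards [hsnhds] with y hy using h4 y hy
    subst hr
    have h6 : ∀ y ∈ Metric.closedBall (0 : ℂ) s, y ≠ 0 → discExt q.1 y = 0 := by
      intro y hy hy0
      have := h4 y hy
      simpa [he' y hy, hy0] using this
    have hq : q = 0 := by
      apply discAlgebra_ext
      intro y hy
      have hz : discExt (0 : discAlgebra s).1 y = 0 := by
        rw [← discEval_apply hy, map_zero]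
      rw [hz]
      by_cases hy0 : y = 0
      · rw [hy0]
        refine tendsto_nhds_unique (l := 𝓝[≠] (0 : ℂ))
          ((hca q).tendsto.mono_left nhdsWithin_le_nhds) (tendsto_const_nhds.congr' ?_)
        filter_upwards [self_mem_nhdsWithin, mem_nhdsWithin_of_mem_nhds hsnhds] with y hy hys
        exact (h6 y hys hy).symm
      · exact h6 y hy hy0
    rw [hq]
    rfl
  have hsurj : Function.Surjective (L (G 0) + L₀) := by
    intro h
    obtain ⟨q, r, hqr⟩ := discAlgebra_division hs n h
    refine ⟨(q * e', r), ?_⟩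
    apply discAlgebra_ext
    intro y hy
    rw [hL _ _ _ y hy, hmul _ _ y hy, hee' y hy, he y hy, hqr y hy]
    have := he' y hy
    congr 1
    field_simp
  obtain ⟨S, hS, hTS⟩ := exists_analytic_solution L L₀ hG hF hinj hsurj
  refine ⟨fun z => discEval s z.2 (S z.1).1, fun j x => (S x).2 j, ?_, fun j => ?_, ?_⟩
  · have h10 : AnalyticAt ℂ (fun z : ℂ × ℂ => discEval s z.2) 0 :=
      AnalyticAt.comp (g := discEval s) (f := fun z : ℂ × ℂ => z.2) (analyticAt_discEval hs)
        analyticAt_snd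
    have h11 : AnalyticAt ℂ (fun z : ℂ × ℂ => (S z.1).1) 0 :=
      AnalyticAt.comp (g := fun x => (S x).1) (f := fun z : ℂ × ℂ => z.1)
        (((ContinuousLinearMap.fst ℂ (discAlgebra s) (Fin n → ℂ)).analyticAt _).comp hS)
        analyticAt_fst
    exact analyticAt_clm_apply h10 h11
  · exact (((ContinuousLinearMap.proj (R := ℂ) (φ := fun _ : Fin n => ℂ) j).comp
      (ContinuousLinearMap.snd ℂ (discAlgebra s) (Fin n → ℂ))).analyticAt _).comp hS
  · have h12 : ∀ᶠ z : ℂ × ℂ in 𝓝 0, (L (G z.1) + L₀) (S z.1) = F z.1 :=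
      (continuous_fst.tendsto (0 : ℂ × ℂ)).eventually hTS
    have h13 : ∀ᶠ z : ℂ × ℂ in 𝓝 0, z.1 ∈ Metric.closedBall (0 : ℂ) s :=
      (continuous_fst.tendsto (0 : ℂ × ℂ)).eventually hsnhds
    have h14 : ∀ᶠ z : ℂ × ℂ in 𝓝 0, z.2 ∈ Metric.closedBall (0 : ℂ) s :=
      (continuous_snd.tendsto (0 : ℂ × ℂ)).eventually hsnhds
    filter_upwards [h12, h13, h14] with z hz hz1 hz2
    have h15 := hL (G z.1) (S z.1).1 (S z.1).2 z.2 hz2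
    rw [discEval_apply hz2, ← hG' z.1 hz1 z.2 hz2, ← h15, ← hF' z.1 hz1 z.2 hz2, ← hz]

/-! ### The ring of holomorphic germs -/

section germs

variable {p q : ℂ × ℂ} {f g : ℂ × ℂ → ℂ}

theorem coe_germAt (hf : AnalyticAt ℂ f p) :
    ((germAt f p : holGerms p) : Germ (𝓝 p) ℂ) = (f : Germ (𝓝 p) ℂ) := by
  rw [germAt, dif_pos hf]

theorem germAt_eq_iff (hf : AnalyticAt ℂ f p) (hg : AnalyticAt ℂ g p) :
    germAt f p = germAt g p ↔ f =ᶠ[𝓝 p] g := by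
  rw [← Germ.coe_eq, ← coe_germAt hf, ← coe_germAt hg, Subtype.ext_iff]

theorem germAt_congr (h : f =ᶠ[𝓝 p] g) : germAt f p = germAt g p := by
  by_cases hf : AnalyticAt ℂ f p
  · exact (germAt_eq_iff hf (hf.congr h)).2 h
  · have hg : ¬ AnalyticAt ℂ g p := fun hg => hf (hg.congr h.symm)
    rw [germAt, germAt, dif_neg hf, dif_neg hg]

theorem exists_germAt_eq (F : holGerms p) : ∃ f, AnalyticAt ℂ f p ∧ germAt f p = F := by
  obtain ⟨f, hf, h⟩ := F.2
  exact ⟨f, hf, Subtype.ext ((coe_germAt hf).trans h)⟩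

/-- A function representing a holomorphic germ. -/
def rep (F : holGerms p) : ℂ × ℂ → ℂ := (exists_germAt_eq F).choose

theorem analyticAt_rep (F : holGerms p) : AnalyticAt ℂ (rep F) p :=
  (exists_germAt_eq F).choose_spec.1

theorem germAt_rep (F : holGerms p) : germAt (rep F) p = F :=
  (exists_germAt_eq F).choose_spec.2

theorem rep_germAt (hf : AnalyticAt ℂ f p) : rep (germAt f p) =ᶠ[𝓝 p] f :=
  (germAt_eq_iff (analyticAt_rep _) hf).1 (germAt_rep _)

theorem germAt_add (hf : AnalyticAt ℂ f p) (hg : AnalyticAt ℂ g p) :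
    germAt (fun z => f z + g z) p = germAt f p + germAt g p := by
  apply Subtype.ext
  rw [AddMemClass.coe_add, coe_germAt hf, coe_germAt hg]
  exact coe_germAt (hf.fun_add hg)

theorem germAt_mul (hf : AnalyticAt ℂ f p) (hg : AnalyticAt ℂ g p) :
    germAt (fun z => f z * g z) p = germAt f p * germAt g p := by
  apply Subtype.ext
  rw [MulMemClass.coe_mul, coe_germAt hf, coe_germAt hg]
  exact coe_germAt (hf.fun_mul hg)

theorem germAt_const (c : ℂ) : germAt (fun _ => c) p = algebraMap ℂ (holGerms p) c := by
  apply Subtype.ext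
  rw [coe_germAt analyticAt_const, Subalgebra.coe_algebraMap, Algebra.algebraMap_eq_smul_one]
  change _ = ((fun _ => c * 1 : ℂ × ℂ → ℂ) : Germ (𝓝 p) ℂ)
  simp only [mul_one]

theorem germAt_one : germAt (fun _ => 1) p = 1 := by rw [germAt_const, map_one]

theorem germAt_zero : germAt (fun _ => 0) p = 0 := by rw [germAt_const, map_zero]

theorem germAt_neg (hf : AnalyticAt ℂ f p) : germAt (fun z => - f z) p = - germAt f p := by
  apply Subtype.ext
  rw [NegMemClass.coe_neg, coe_germAt hf]
  exact coe_germAt hf.neg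

theorem germAt_sub (hf : AnalyticAt ℂ f p) (hg : AnalyticAt ℂ g p) :
    germAt (fun z => f z - g z) p = germAt f p - germAt g p := by
  simp only [sub_eq_add_neg]
  rw [germAt_add hf hg.fun_neg, germAt_neg hg]

theorem germAt_pow (hf : AnalyticAt ℂ f p) (n : ℕ) :
    germAt (fun z => f z ^ n) p = germAt f p ^ n := by
  induction n with
  | zero => simpa using germAt_one
  | succ n ih =>
    simp only [pow_succ]
    rw [germAt_mul (hf.fun_pow n) hf, ih]

theorem germAt_sum {ι : Type*} (t : Finset ι) {h : ι → ℂ × ℂ → ℂ}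
    (hh : ∀ i ∈ t, AnalyticAt ℂ (h i) p) :
    germAt (fun z => ∑ i ∈ t, h i z) p = ∑ i ∈ t, germAt (h i) p := by
  classical
  induction t using Finset.induction_on with
  | empty => simpa using germAt_zero
  | insert a t ha ih =>
    simp only [Finset.sum_insert ha]
    rw [germAt_add (hh a (Finset.mem_insert_self a t))
        (t.analyticAt_fun_sum fun i hi => hh i (Finset.mem_insert_of_mem hi)),
      ih fun i hi => hh i (Finset.mem_insert_of_mem hi)]

/-- Pullback of germs along a germ of analytic map. -/
def pullback (φ : ℂ × ℂ → ℂ × ℂ) (hφ : AnalyticAt ℂ φ p) (h : φ p = q) :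
    holGerms q →ₐ[ℂ] holGerms p := by
  have hcomp : ∀ {f : ℂ × ℂ → ℂ}, AnalyticAt ℂ f q → AnalyticAt ℂ (fun z => f (φ z)) p := by
    intro f hf
    exact AnalyticAt.comp (g := f) (h ▸ hf) hφ
  have htend : Tendsto φ (𝓝 p) (𝓝 q) := h ▸ hφ.continuousAt
  have key : ∀ {f : ℂ × ℂ → ℂ}, AnalyticAt ℂ f q →
      germAt (fun z => rep (germAt f q) (φ z)) p = germAt (fun z => f (φ z)) p := fun hf =>
    germAt_congr (htend.eventually (rep_germAt hf))
  refine AlgHom.mk ⟨⟨⟨fun F => germAt (fun z => rep F (φ z)) p, ?_⟩, ?_⟩, ?_, ?_⟩ ?_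
  · rw [← germAt_one, key analyticAt_const, germAt_one]
  · intro F G
    obtain ⟨f, hf, rfl⟩ := exists_germAt_eq F
    obtain ⟨g, hg, rfl⟩ := exists_germAt_eq G
    simp only
    rw [← germAt_mul hf hg, key (hf.fun_mul hg), key hf, key hg, germAt_mul (hcomp hf) (hcomp hg)]
  · simp only
    rw [← germAt_zero, key analyticAt_const, germAt_zero]
  · intro F G
    obtain ⟨f, hf, rfl⟩ := exists_germAt_eq F
    obtain ⟨g, hg, rfl⟩ := exists_germAt_eq G
    simp only
    rw [← germAt_add hf hg, key (hf.fun_add hg), key hf, key hg, germAt_add (hcomp hf) (hcomp hg)]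
  · intro c
    simp only
    rw [← germAt_const, key analyticAt_const, germAt_const]

theorem pullback_germAt {φ : ℂ × ℂ → ℂ × ℂ} (hφ : AnalyticAt ℂ φ p) (h : φ p = q)
    (hf : AnalyticAt ℂ f q) : pullback φ hφ h (germAt f q) = germAt (fun z => f (φ z)) p := by
  have htend : Tendsto φ (𝓝 p) (𝓝 q) := h ▸ hφ.continuousAt
  exact germAt_congr (htend.eventually (rep_germAt hf))

/-- Isomorphism of rings of germs induced by a germ of biholomorphic map. -/
def pullbackEquiv (φ ψ : ℂ × ℂ → ℂ × ℂ) (hφ : AnalyticAt ℂ φ p) (h : φ p = q)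
    (hψ : AnalyticAt ℂ ψ q) (h' : ψ q = p) (h₁ : ∀ z, φ (ψ z) = z) (h₂ : ∀ z, ψ (φ z) = z) :
    holGerms q ≃ₐ[ℂ] holGerms p :=
  AlgEquiv.ofAlgHom (pullback φ hφ h) (pullback ψ hψ h')
    (AlgHom.ext fun F => by
      obtain ⟨f, hf, rfl⟩ := exists_germAt_eq F
      rw [AlgHom.comp_apply, pullback_germAt hψ h' hf, pullback_germAt hφ h]
      · simp [h₂]
      · exact AnalyticAt.comp (g := f) (h' ▸ hf) hψ)
    (AlgHom.ext fun F => by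
      obtain ⟨f, hf, rfl⟩ := exists_germAt_eq F
      rw [AlgHom.comp_apply, pullback_germAt hφ h hf, pullback_germAt hψ h']
      · simp [h₁]
      · exact AnalyticAt.comp (g := f) (h ▸ hf) hφ)

end germs

/-- The ring of germs at the origin. -/
def OO : Type := holGerms (0 : ℂ × ℂ)

instance : CommRing OO := inferInstanceAs (CommRing (holGerms (0 : ℂ × ℂ)))

instance : Algebra ℂ OO := inferInstanceAs (Algebra ℂ (holGerms (0 : ℂ × ℂ)))

/-- The germ at the origin. -/
def germ (f : ℂ × ℂ → ℂ) : OO := germAt f 0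

/-- A function representing a germ at the origin. -/
def repr (F : OO) : ℂ × ℂ → ℂ := rep (p := 0) F

section germ

variable {f g : ℂ × ℂ → ℂ}

theorem germ_eq_iff (hf : AnalyticAt ℂ f 0) (hg : AnalyticAt ℂ g 0) :
    germ f = germ g ↔ f =ᶠ[𝓝 0] g := germAt_eq_iff hf hg

theorem germ_congr (h : f =ᶠ[𝓝 0] g) : germ f = germ g := germAt_congr h

theorem exists_germ_eq (F : OO) : ∃ f, AnalyticAt ℂ f 0 ∧ germ f = F := exists_germAt_eq F

theorem repr_germ (hf : AnalyticAt ℂ f 0) : repr (germ f) =ᶠ[𝓝 0] f := rep_germAt hf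

theorem germ_add (hf : AnalyticAt ℂ f 0) (hg : AnalyticAt ℂ g 0) :
    germ (fun z => f z + g z) = germ f + germ g := germAt_add hf hg

theorem germ_mul (hf : AnalyticAt ℂ f 0) (hg : AnalyticAt ℂ g 0) :
    germ (fun z => f z * g z) = germ f * germ g := germAt_mul hf hg

theorem germ_const (c : ℂ) : germ (fun _ => c) = algebraMap ℂ OO c := germAt_const c

theorem germ_one : germ (fun _ => 1) = 1 := germAt_one

theorem germ_zero : germ (fun _ => 0) = 0 := germAt_zero

theorem germ_sub (hf : AnalyticAt ℂ f 0) (hg : AnalyticAt ℂ g 0) :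
    germ (fun z => f z - g z) = germ f - germ g := germAt_sub hf hg

theorem germ_pow (hf : AnalyticAt ℂ f 0) (n : ℕ) : germ (fun z => f z ^ n) = germ f ^ n :=
  germAt_pow hf n

theorem germ_sum {ι : Type*} (t : Finset ι) {h : ι → ℂ × ℂ → ℂ}
    (hh : ∀ i ∈ t, AnalyticAt ℂ (h i) 0) :
    germ (fun z => ∑ i ∈ t, h i z) = ∑ i ∈ t, germ (h i) := germAt_sum t hh

end germ

/-- Evaluation of a germ at the origin. -/
def ev : OO →ₐ[ℂ] ℂ where
  toFun F := repr F 0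
  map_one' := by rw [← germ_one, (repr_germ analyticAt_const).self_of_nhds]
  map_mul' F G := by
    obtain ⟨f, hf, rfl⟩ := exists_germ_eq F
    obtain ⟨g, hg, rfl⟩ := exists_germ_eq G
    rw [← germ_mul hf hg, (repr_germ (hf.fun_mul hg)).self_of_nhds,
      (repr_germ hf).self_of_nhds, (repr_germ hg).self_of_nhds]
  map_zero' := by rw [← germ_zero, (repr_germ analyticAt_const).self_of_nhds]
  map_add' F G := by
    obtain ⟨f, hf, rfl⟩ := exists_germ_eq F
    obtain ⟨g, hg, rfl⟩ := exists_germ_eq G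
    rw [← germ_add hf hg, (repr_germ (hf.fun_add hg)).self_of_nhds,
      (repr_germ hf).self_of_nhds, (repr_germ hg).self_of_nhds]
  commutes' c := by
    rw [← germ_const, (repr_germ analyticAt_const).self_of_nhds]
    rfl

theorem ev_germ {f : ℂ × ℂ → ℂ} (hf : AnalyticAt ℂ f 0) : ev (germ f) = f 0 :=
  (repr_germ hf).self_of_nhds

theorem isUnit_iff_ev {F : OO} : IsUnit F ↔ ev F ≠ 0 := by
  constructor
  · exact fun h => (h.map ev).ne_zero
  · intro h
    obtain ⟨f, hf, rfl⟩ := exists_germ_eq F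
    rw [ev_germ hf] at h
    refine IsUnit.of_mul_eq_one (germ fun z => (f z)⁻¹) ?_
    rw [← germ_mul hf (hf.fun_inv h), ← germ_one]
    apply germ_congr
    filter_upwards [hf.continuousAt.eventually_ne h] with z hz
    exact mul_inv_cancel₀ hz

instance : Nontrivial OO := ev.toRingHom.domain_nontrivial

/-- Identity theorem: if f does not vanish at some point of a ball where fg = 0, then g vanishes
near that point, hence on the whole ball. -/
instance : NoZeroDivisors OO where
  eq_zero_or_eq_zero_of_mul_eq_zero := by
    intro F G hFG
    obtain ⟨f, hf, rfl⟩ := exists_germ_eq F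
    obtain ⟨g, hg, rfl⟩ := exists_germ_eq G
    rw [← germ_mul hf hg, ← germ_zero, germ_eq_iff (hf.fun_mul hg) analyticAt_const] at hFG
    obtain ⟨ε, hε, hb⟩ := Metric.eventually_nhds_iff_ball.1
      (hFG.and (hf.eventually_analyticAt.and hg.eventually_analyticAt))
    by_cases hfz : ∀ z ∈ Metric.ball (0 : ℂ × ℂ) ε, f z = 0
    · left
      rw [← germ_zero, germ_eq_iff hf analyticAt_const]
      filter_upwards [Metric.ball_mem_nhds _ hε] with z hz using hfz z hz
    · right
      push Not at hfz
      obtain ⟨a, ha, hfa⟩ := hfz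
      have h1 : g =ᶠ[𝓝 a] 0 := by
        filter_upwards [(hb a ha).2.1.continuousAt.eventually_ne hfa,
          Metric.isOpen_ball.mem_nhds ha] with z hz hz'
        exact (mul_eq_zero.1 (hb z hz').1).resolve_left hz
      have h2 := AnalyticOnNhd.eqOn_zero_of_preconnected_of_eventuallyEq_zero
        (fun z hz => (hb z hz).2.2) (convex_ball _ _).isPreconnected ha h1
      rw [← germ_zero, germ_eq_iff hg analyticAt_const]
      filter_upwards [Metric.ball_mem_nhds _ hε] with z hz using h2 hz

instance : IsDomain OO := NoZeroDivisors.to_isDomain _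

/-! ### Orders along curves -/

/-- The order of the restriction of a germ to a parametrised curve. -/
def ordAlong (γ : ℂ → ℂ × ℂ) (F : OO) : ℕ∞ := analyticOrderAt (fun t => repr F (γ t)) 0

section ordAlong

variable {γ : ℂ → ℂ × ℂ}

theorem tendsto_of_analyticAt (hγ : AnalyticAt ℂ γ 0) (h0 : γ 0 = 0) :
    Tendsto γ (𝓝 0) (𝓝 0) := by
  simpa [h0] using hγ.continuousAt.tendsto

theorem analyticAt_comp_curve {f : ℂ × ℂ → ℂ} (hf : AnalyticAt ℂ f 0) (hγ : AnalyticAt ℂ γ 0)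
    (h0 : γ 0 = 0) : AnalyticAt ℂ (fun t => f (γ t)) 0 :=
  AnalyticAt.comp (g := f) (h0.symm ▸ hf) hγ

theorem ordAlong_germ {f : ℂ × ℂ → ℂ} (hγ : AnalyticAt ℂ γ 0) (h0 : γ 0 = 0)
    (hf : AnalyticAt ℂ f 0) : ordAlong γ (germ f) = analyticOrderAt (fun t => f (γ t)) 0 :=
  analyticOrderAt_congr ((tendsto_of_analyticAt hγ h0).eventually (repr_germ hf))

theorem ordAlong_mul (hγ : AnalyticAt ℂ γ 0) (h0 : γ 0 = 0) (F G : OO) :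
    ordAlong γ (F * G) = ordAlong γ F + ordAlong γ G := by
  obtain ⟨f, hf, rfl⟩ := exists_germ_eq F
  obtain ⟨g, hg, rfl⟩ := exists_germ_eq G
  rw [← germ_mul hf hg, ordAlong_germ hγ h0 (hf.fun_mul hg), ordAlong_germ hγ h0 hf,
    ordAlong_germ hγ h0 hg,
    ← analyticOrderAt_mul (analyticAt_comp_curve hf hγ h0) (analyticAt_comp_curve hg hγ h0)]
  rfl

theorem le_ordAlong_add (hγ : AnalyticAt ℂ γ 0) (h0 : γ 0 = 0) (F G : OO) :
    min (ordAlong γ F) (ordAlong γ G) ≤ ordAlong γ (F + G) := by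
  obtain ⟨f, hf, rfl⟩ := exists_germ_eq F
  obtain ⟨g, hg, rfl⟩ := exists_germ_eq G
  rw [← germ_add hf hg, ordAlong_germ hγ h0 (hf.fun_add hg), ordAlong_germ hγ h0 hf,
    ordAlong_germ hγ h0 hg]
  exact le_analyticOrderAt_add

theorem ordAlong_zero (hγ : AnalyticAt ℂ γ 0) (h0 : γ 0 = 0) : ordAlong γ 0 = ⊤ := by
  rw [← germ_zero, ordAlong_germ hγ h0 analyticAt_const, analyticOrderAt_eq_top]
  simp

theorem ordAlong_eq_zero_iff (hγ : AnalyticAt ℂ γ 0) (h0 : γ 0 = 0) {F : OO} :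
    ordAlong γ F = 0 ↔ IsUnit F := by
  obtain ⟨f, hf, rfl⟩ := exists_germ_eq F
  rw [ordAlong_germ hγ h0 hf, (analyticAt_comp_curve hf hγ h0).analyticOrderAt_eq_zero, h0,
    isUnit_iff_ev, ev_germ hf]

end ordAlong

/-! ### Coordinates -/

/-- The germ of the first coordinate. -/
def cX : OO := germ Prod.fst

/-- The germ of the second coordinate. -/
def cY : OO := germ Prod.snd

/-- The germ of a function of the first variable only. -/
def germX (r : ℂ → ℂ) : OO := germ fun z => r z.1

/-- The germ of a function of the second variable only. -/
def germY (r : ℂ → ℂ) : OO := germ fun z => r z.2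

theorem analyticAt_comp_fst {r : ℂ → ℂ} (hr : AnalyticAt ℂ r 0) :
    AnalyticAt ℂ (fun z : ℂ × ℂ => r z.1) 0 :=
  AnalyticAt.comp (g := r) (f := fun z : ℂ × ℂ => z.1) hr analyticAt_fst

theorem analyticAt_comp_snd {r : ℂ → ℂ} (hr : AnalyticAt ℂ r 0) :
    AnalyticAt ℂ (fun z : ℂ × ℂ => r z.2) 0 :=
  AnalyticAt.comp (g := r) (f := fun z : ℂ × ℂ => z.2) hr analyticAt_snd

/-- The second coordinate axis. -/
def axisY (t : ℂ) : ℂ × ℂ := (0, t)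

/-- The first coordinate axis. -/
def axisX (t : ℂ) : ℂ × ℂ := (t, 0)

theorem analyticAt_axisY : AnalyticAt ℂ axisY 0 := by unfold axisY; fun_prop

theorem analyticAt_axisX : AnalyticAt ℂ axisX 0 := by unfold axisX; fun_prop

theorem axisY_zero : axisY 0 = 0 := rfl

theorem axisX_zero : axisX 0 = 0 := rfl

/-- The order of `F (0, y)` at `0`. -/
abbrev yord (F : OO) : ℕ∞ := ordAlong axisY F

theorem weierstrass_germ {G : OO} {n : ℕ} (hn : yord G = n) (F : OO) :
    ∃ (Q : OO) (r : Fin n → ℂ → ℂ), (∀ j, AnalyticAt ℂ (r j) 0) ∧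
      F = Q * G + ∑ j, germX (r j) * cY ^ (j : ℕ) := by
  obtain ⟨f, hf, rfl⟩ := exists_germ_eq F
  obtain ⟨g, hg, rfl⟩ := exists_germ_eq G
  rw [yord, ordAlong_germ analyticAt_axisY axisY_zero hg] at hn
  obtain ⟨q, r, hq, hr, h⟩ := weierstrass_division hg hf hn
  refine ⟨germ q, r, hr, ?_⟩
  rw [germ_congr h, germ_add (hq.fun_mul hg), germ_mul hq hg, germ_sum]
  · congr 1
    refine Finset.sum_congr rfl fun j _ => ?_
    rw [germ_mul (analyticAt_comp_fst (hr j)) (analyticAt_snd.fun_pow _),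
      germ_pow analyticAt_snd]
    rfl
  · exact fun j _ => (analyticAt_comp_fst (hr j)).fun_mul (analyticAt_snd.fun_pow _)
  · exact Finset.analyticAt_fun_sum _ fun j _ =>
      (analyticAt_comp_fst (hr j)).fun_mul (analyticAt_snd.fun_pow _)

theorem yord_cY : yord cY = 1 := by
  rw [yord, cY, ordAlong_germ analyticAt_axisY axisY_zero analyticAt_snd]
  exact analyticOrderAt_id

theorem exists_eq_germX_add_mul (F : OO) :
    ∃ (Q : OO) (r : ℂ → ℂ), AnalyticAt ℂ r 0 ∧ F = Q * cY + germX r := by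
  obtain ⟨Q, r, hr, h⟩ := weierstrass_germ (n := 1) yord_cY F
  exact ⟨Q, r 0, hr 0, by simpa using h⟩

/-- Exchange of the two variables. -/
def swapEquiv : OO ≃ₐ[ℂ] OO :=
  pullbackEquiv (p := 0) (q := 0) Prod.swap Prod.swap
    (analyticAt_snd.prod analyticAt_fst) rfl (analyticAt_snd.prod analyticAt_fst) rfl
    (fun _ => rfl) (fun _ => rfl)

theorem swapEquiv_germ {f : ℂ × ℂ → ℂ} (hf : AnalyticAt ℂ f 0) :
    swapEquiv (germ f) = germ fun z => f z.swap :=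
  pullback_germAt (p := 0) (q := 0) (φ := Prod.swap) (analyticAt_snd.prod analyticAt_fst) rfl hf

theorem swapEquiv_cX : swapEquiv cX = cY := swapEquiv_germ analyticAt_fst

theorem swapEquiv_cY : swapEquiv cY = cX := swapEquiv_germ analyticAt_snd

theorem exists_eq_germY_add_mul (F : OO) :
    ∃ (Q : OO) (r : ℂ → ℂ), AnalyticAt ℂ r 0 ∧ F = Q * cX + germY r := by
  obtain ⟨Q, r, hr, h⟩ := exists_eq_germX_add_mul (swapEquiv.symm F)
  refine ⟨swapEquiv Q, r, hr, ?_⟩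
  have := congrArg swapEquiv h
  rw [AlgEquiv.apply_symm_apply, map_add, map_mul, swapEquiv_cY] at this
  rw [this, germX, swapEquiv_germ (analyticAt_comp_fst hr)]
  rfl

/-- The remainder of F modulo x is its restriction to the y-axis. Hence a germ not divisible by x
has finite order in y and can serve as a Weierstrass divisor without any change of coordinates. -/
theorem cX_dvd_iff {F : OO} : cX ∣ F ↔ yord F = ⊤ := by
  constructor
  · rintro ⟨G, rfl⟩
    rw [yord, ordAlong_mul analyticAt_axisY axisY_zero]
    have : ordAlong axisY cX = ⊤ := by
      rw [cX, ordAlong_germ analyticAt_axisY axisY_zero analyticAt_fst, analyticOrderAt_eq_top]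
      simp [axisY]
    rw [this, top_add]
  · intro h
    obtain ⟨Q, r, hr, rfl⟩ := exists_eq_germY_add_mul F
    obtain ⟨q, hq, rfl⟩ := exists_germ_eq Q
    rw [germY, cX, ← germ_mul hq analyticAt_fst,
      ← germ_add (hq.fun_mul analyticAt_fst) (analyticAt_comp_snd hr), yord,
      ordAlong_germ analyticAt_axisY axisY_zero
        ((hq.fun_mul analyticAt_fst).fun_add (analyticAt_comp_snd hr)), analyticOrderAt_eq_top] at h
    simp only [axisY, mul_zero, zero_add] at h
    have : germY r = 0 := by
      rw [germY, ← germ_zero, germ_eq_iff (analyticAt_comp_snd hr) analyticAt_const]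
      exact (continuous_snd.tendsto (0 : ℂ × ℂ)).eventually h
    rw [this, add_zero]
    exact dvd_mul_left _ _

theorem yord_mul (F G : OO) : yord (F * G) = yord F + yord G :=
  ordAlong_mul analyticAt_axisY axisY_zero F G

theorem ev_cX : ev cX = 0 := ev_germ analyticAt_fst

theorem ev_cY : ev cY = 0 := ev_germ analyticAt_snd

theorem cX_prime : Prime cX := by
  refine ⟨?_, ?_, ?_⟩
  · intro h
    have h1 : (Prod.fst : ℂ × ℂ → ℂ) =ᶠ[𝓝 0] fun _ => 0 := by
      rw [← germ_eq_iff analyticAt_fst analyticAt_const, germ_zero]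
      exact h
    have h2 : Tendsto axisX (𝓝 0) (𝓝 0) := tendsto_of_analyticAt analyticAt_axisX axisX_zero
    have h3 := analyticOrderAt_eq_top.2 (h2.eventually h1)
    have h4 : analyticOrderAt (fun t => (axisX t).1) 0 = 1 := analyticOrderAt_id
    rw [h4] at h3
    exact absurd h3 (by simp)
  · rw [isUnit_iff_ev, ev_cX]
    simp
  · intro a b h
    rw [cX_dvd_iff, yord_mul] at h
    rw [cX_dvd_iff, cX_dvd_iff]
    exact WithTop.add_eq_top.1 h

/-! ### Codimension of ideals -/

section codim

variable {O : Type*} [CommRing O] [Algebra ℂ O]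

/-- The codimension of an ideal. -/
def codim (I : Ideal O) : ℕ∞ := Cardinal.toENat (Module.rank ℂ (O ⧸ I))

theorem codim_anti {I J : Ideal O} (h : I ≤ J) : codim J ≤ codim I :=
  Cardinal.toENat.monotone' (LinearMap.rank_le_of_surjective
    (Ideal.Quotient.factorₐ ℂ h).toLinearMap (Ideal.Quotient.factor_surjective h))

theorem codim_ne_top_iff {I : Ideal O} : codim I ≠ ⊤ ↔ Module.Finite ℂ (O ⧸ I) := by
  rw [codim, Ne, Cardinal.toENat_eq_top, not_le, Module.rank_lt_aleph0_iff]

/-- Exact sequence 0 → O/(F, H) → O/(F, GH) → O/(F, G) → 0 whose first map is multiplication by G;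
the hypothesis, that G is a non-zero-divisor modulo F, makes it injective. Ranks add up also when
infinite. -/
theorem codim_span_pair_mul {F G H : O} (h : ∀ u, F ∣ G * u → F ∣ u) :
    codim (Ideal.span {F, G * H}) = codim (Ideal.span {F, G}) + codim (Ideal.span {F, H}) := by
  have hle : Ideal.span {F, G * H} ≤ Ideal.span {F, G} := by
    rw [Ideal.span_le]
    rintro z (rfl | rfl)
    · exact Ideal.subset_span (by simp)
    · exact Ideal.mul_mem_right _ _ (Ideal.subset_span (by simp))
  let f := (Ideal.Quotient.factorₐ ℂ hle).toLinearMap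
  have hf : Function.Surjective f := Ideal.Quotient.factor_surjective hle
  have hcomap : Ideal.span {F, H} ≤ Submodule.comap (LinearMap.mulLeft O G)
      (Ideal.span {F, G * H}) := by
    rw [Ideal.span_le]
    rintro z (rfl | rfl)
    · exact Ideal.mul_mem_left _ _ (Ideal.subset_span (by simp))
    · exact Ideal.subset_span (by simp)
  let φ := (Submodule.mapQ _ _ (LinearMap.mulLeft O G) hcomap).restrictScalars ℂ
  have hφ : ∀ u : O, φ (Ideal.Quotient.mk _ u) = Ideal.Quotient.mk _ (G * u) := fun u => rfl
  have hff : ∀ u : O, f (Ideal.Quotient.mk _ u) = Ideal.Quotient.mk _ u := fun u => rfl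
  have hinj : Function.Injective φ := by
    rw [injective_iff_map_eq_zero]
    intro z hz
    obtain ⟨u, rfl⟩ := Ideal.Quotient.mk_surjective z
    rw [hφ, Ideal.Quotient.eq_zero_iff_mem, Ideal.mem_span_pair] at hz
    obtain ⟨a, b, hab⟩ := hz
    obtain ⟨c, hc⟩ := h (u - b * H) ⟨a, by linear_combination -hab⟩
    rw [Ideal.Quotient.eq_zero_iff_mem, Ideal.mem_span_pair]
    exact ⟨c, b, by linear_combination -hc⟩
  have hrange : LinearMap.range φ = LinearMap.ker f := by
    ext z
    obtain ⟨u, rfl⟩ := Ideal.Quotient.mk_surjective z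
    rw [LinearMap.mem_ker, hff, Ideal.Quotient.eq_zero_iff_mem, Ideal.mem_span_pair]
    constructor
    · rintro ⟨w, hw⟩
      obtain ⟨w, rfl⟩ := Ideal.Quotient.mk_surjective w
      rw [hφ, Ideal.Quotient.eq, Ideal.mem_span_pair] at hw
      obtain ⟨a, b, hab⟩ := hw
      exact ⟨-a, w - b * H, by linear_combination -hab⟩
    · rintro ⟨a, b, hab⟩
      refine ⟨Ideal.Quotient.mk _ b, ?_⟩
      rw [hφ, Ideal.Quotient.eq, Ideal.mem_span_pair]
      exact ⟨-a, 0, by linear_combination -hab⟩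
  have h1 := f.rank_range_add_rank_ker
  rw [rank_range_of_surjective f hf, ← hrange,
    ← (LinearEquiv.ofInjective φ hinj).rank_eq] at h1
  rw [codim, ← h1, map_add]
  rfl

theorem codim_map_equiv {O' : Type*} [CommRing O'] [Algebra ℂ O'] (e : O ≃ₐ[ℂ] O') (I : Ideal O)
    (J : Ideal O') (h : J = I.map (e : O →+* O')) : codim J = codim I := by
  unfold codim
  have h1 := (Ideal.quotientEquivAlg I J e h).toLinearEquiv.lift_rank_eq
  rw [← Cardinal.toENat_lift, ← h1, Cardinal.toENat_lift]

theorem codim_span_pair_equiv {O' : Type*} [CommRing O'] [Algebra ℂ O'] (e : O ≃ₐ[ℂ] O')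
    (F G : O) : codim (Ideal.span {e F, e G}) = codim (Ideal.span {F, G}) := by
  apply codim_map_equiv e
  rw [Ideal.map_span, Set.image_pair]
  rfl

omit [Algebra ℂ O] in
theorem span_pair_unit_mul {a b : O} (ha : IsUnit a) (hb : IsUnit b) (F G : O) :
    Ideal.span {a * F, b * G} = Ideal.span {F, G} := by
  rw [Ideal.span_insert, Ideal.span_insert, Ideal.span_singleton_mul_left_unit ha,
    Ideal.span_singleton_mul_left_unit hb]

omit [Algebra ℂ O] in
theorem span_pair_eq_of_dvd_sub {F G H : O} (h : F ∣ G - H) :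
    Ideal.span {F, G} = Ideal.span {F, H} := by
  obtain ⟨c, hc⟩ := h
  apply le_antisymm <;> rw [Ideal.span_le] <;> rintro z (rfl | rfl)
  · exact Ideal.subset_span (by simp)
  · exact Ideal.mem_span_pair.2 ⟨c, 1, by linear_combination -hc⟩
  · exact Ideal.subset_span (by simp)
  · exact Ideal.mem_span_pair.2 ⟨-c, 1, by linear_combination hc⟩

/-- In a ring with an ideal contained in the Jacobson radical, ideals of finite codimension
contain a power of it. -/
theorem exists_pow_le_of_codim_ne_top {m I : Ideal O} (hm : m ≤ Ideal.jacobson ⊥)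
    (hI : codim I ≠ ⊤) : ∃ n : ℕ, m ^ n ≤ I := by
  have := codim_ne_top_iff.1 hI
  have : IsArtinianRing (O ⧸ I) := IsArtinianRing.of_finite ℂ _
  obtain ⟨n, hn⟩ := IsArtinianRing.isNilpotent_jacobson_bot (R := O ⧸ I)
  have h1 : m.map (Ideal.Quotient.mk I) ≤ Ideal.jacobson ⊥ := by
    rw [Ideal.map_le_iff_le_comap]
    intro a ha
    rw [Ideal.mem_comap, Ideal.mem_jacobson_bot]
    intro b
    obtain ⟨b, rfl⟩ := Ideal.Quotient.mk_surjective b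
    have := (Ideal.mem_jacobson_bot.1 (hm ha) b).map (Ideal.Quotient.mk I)
    simpa using this
  refine ⟨n, ?_⟩
  have h2 : (m ^ n).map (Ideal.Quotient.mk I) = ⊥ := by
    rw [Ideal.map_pow, eq_bot_iff]
    exact (Ideal.pow_right_mono h1 n).trans hn.le
  rw [Ideal.map_eq_bot_iff_le_ker, Ideal.mk_ker] at h2
  exact h2

-- Nakayama's lemma: perturbations in m ^ (n + 1) lie in m · (F, G), so (F, G) is contained in (F',
-- G') + m · (F, G). This is the source of finite determinacy for equations.
omit [Algebra ℂ O] in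
theorem span_pair_eq_of_sub_mem_pow {m : Ideal O} (hm : m ≤ Ideal.jacobson ⊥) {F G F' G' : O}
    {n : ℕ} (hn : m ^ n ≤ Ideal.span {F, G}) (hF : F' - F ∈ m ^ (n + 1))
    (hG : G' - G ∈ m ^ (n + 1)) : Ideal.span {F', G'} = Ideal.span {F, G} := by
  have hle : m ^ (n + 1) ≤ Ideal.span {F, G} := (Ideal.pow_le_pow_right n.le_succ).trans hn
  apply le_antisymm
  · rw [Ideal.span_le]
    rintro z (rfl | rfl)
    · have := Ideal.add_mem _ (hle hF) (Ideal.subset_span (by simp) : F ∈ Ideal.span {F, G})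
      simpa using this
    · have := Ideal.add_mem _ (hle hG) (Ideal.subset_span (by simp) : G ∈ Ideal.span {F, G})
      simpa using this
  · refine Submodule.le_of_le_smul_of_le_jacobson_bot (I := m)
      (Submodule.fg_span (Set.toFinite {F, G})) hm ?_
    have h1 : m ^ (n + 1) ≤ m • Ideal.span {F, G} := by
      rw [pow_succ', smul_eq_mul]
      exact Ideal.mul_mono_right hn
    rw [Ideal.span_le]
    rintro z (rfl | rfl)
    · have h2 := Ideal.sub_mem _
        (Ideal.mem_sup_left (Ideal.subset_span (by simp) : F' ∈ Ideal.span {F', G'}))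
        (Ideal.mem_sup_right (h1 hF))
      simpa using h2
    · have h2 := Ideal.sub_mem _
        (Ideal.mem_sup_left (Ideal.subset_span (by simp) : G' ∈ Ideal.span {F', G'}))
        (Ideal.mem_sup_right (h1 hG))
      simpa using h2

end codim

/-! ### Intersection numbers at the origin -/

/-- The intersection number of two germs at the origin. -/
abbrev inum (F G : OO) : ℕ∞ := codim (Ideal.span {F, G})

theorem intersectionNumber_eq_inum (f g : ℂ × ℂ → ℂ) :
    intersectionNumber f g 0 = inum (germ f) (germ g) := rfl

theorem inum_comm (F G : OO) : inum F G = inum G F := by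
  rw [inum, Set.pair_comm]

/-- The maximal ideal of the ring of germs. -/
def mm : Ideal OO := Ideal.span {cX, cY}

theorem mem_mm_iff {F : OO} : F ∈ mm ↔ ev F = 0 := by
  constructor
  · intro h
    obtain ⟨a, b, rfl⟩ := Ideal.mem_span_pair.1 h
    simp [ev_cX, ev_cY]
  · intro h
    obtain ⟨Q, r, hr, rfl⟩ := exists_eq_germX_add_mul F
    obtain ⟨Q', r', hr', h'⟩ := exists_eq_germY_add_mul (germX r)
    have h1 : r 0 = 0 := by
      rw [map_add, map_mul, ev_cY, mul_zero, zero_add, germX, ev_germ (analyticAt_comp_fst hr)] at h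
      exact h
    have h2 : germY r' = 0 := by
      obtain ⟨q, hq, rfl⟩ := exists_germ_eq Q'
      rw [germX, germY, cX, ← germ_mul hq analyticAt_fst,
        ← germ_add (hq.fun_mul analyticAt_fst) (analyticAt_comp_snd hr'),
        germ_eq_iff (analyticAt_comp_fst hr)
          ((hq.fun_mul analyticAt_fst).fun_add (analyticAt_comp_snd hr'))] at h'
      have h3 := (tendsto_of_analyticAt analyticAt_axisY axisY_zero).eventually h'
      rw [germY, ← germ_zero, germ_eq_iff (analyticAt_comp_snd hr') analyticAt_const]
      have h4 : ∀ᶠ t in 𝓝 (0 : ℂ), r' t = 0 :=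
        h3.mono fun t ht => by simpa [axisY, h1] using ht.symm
      exact (continuous_snd.tendsto (0 : ℂ × ℂ)).eventually h4
    rw [h', h2, mm, Ideal.mem_span_pair]
    exact ⟨Q', Q, by ring⟩

theorem mm_le_jacobson : mm ≤ Ideal.jacobson ⊥ := by
  intro a ha
  rw [Ideal.mem_jacobson_bot]
  intro b
  rw [isUnit_iff_ev, map_add, map_mul, mem_mm_iff.1 ha]
  simp

theorem exists_cX_cY_pow_mem {F G : OO} (h : inum F G ≠ ⊤) :
    ∃ n : ℕ, cX ^ n ∈ Ideal.span {F, G} ∧ cY ^ n ∈ Ideal.span {F, G} := by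
  obtain ⟨n, hn⟩ := exists_pow_le_of_codim_ne_top mm_le_jacobson h
  exact ⟨n, hn (Ideal.pow_mem_pow (Ideal.subset_span (by simp)) n),
    hn (Ideal.pow_mem_pow (Ideal.subset_span (by simp)) n)⟩

theorem not_cX_dvd_cY : ¬ cX ∣ cY := by
  rw [cX_dvd_iff, yord_cY]
  simp

/-- Germs with finite intersection number form a regular sequence. -/
theorem dvd_of_dvd_mul_of_inum_ne_top {F G u : OO} (h : inum F G ≠ ⊤) (hu : F ∣ G * u) :
    F ∣ u := by
  obtain ⟨n, hx, hy⟩ := exists_cX_cY_pow_mem h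
  rw [Ideal.mem_span_pair] at hx hy
  obtain ⟨a, b, hab⟩ := hx
  obtain ⟨c, d, hcd⟩ := hy
  obtain ⟨w, hw⟩ := hu
  by_cases hF : F = 0
  · subst hF
    have hG : G ≠ 0 := by
      rintro rfl
      have : cX ^ n = 0 := by rw [← hab]; ring
      exact cX_prime.ne_zero (eq_zero_of_pow_eq_zero this)
    rw [zero_mul] at hw
    rw [(mul_eq_zero.1 hw).resolve_left hG]
  -- Both x ^ n u and y ^ n u are multiples of F. Comparing the cofactors, and using that x is prime
  -- and does not divide y, the cofactor of the first is divisible by x ^ n, which can then be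
  -- cancelled.
  · have h1 : cX ^ n * u = (a * u + b * w) * F := by
      rw [← hab]; linear_combination b * hw
    have h2 : cY ^ n * u = (c * u + d * w) * F := by
      rw [← hcd]; linear_combination d * hw
    have h3 : cY ^ n * (a * u + b * w) = cX ^ n * (c * u + d * w) := by
      apply mul_right_cancel₀ hF
      linear_combination cX ^ n * h2 - cY ^ n * h1
    obtain ⟨e, he⟩ := cX_prime.pow_dvd_of_dvd_mul_left n
      (fun hd => not_cX_dvd_cY (cX_prime.dvd_of_dvd_pow hd)) ⟨_, h3⟩
    refine ⟨e, mul_left_cancel₀ (pow_ne_zero n cX_prime.ne_zero) ?_⟩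
    rw [h1, he]
    ring

/-- No finiteness is needed: if (F, G) has infinite codimension, so has the smaller ideal (F, GH);
otherwise the regular-sequence property supplies the exact sequence. -/
theorem inum_mul (F G H : OO) : inum F (G * H) = inum F G + inum F H := by
  by_cases h : inum F G = ⊤
  · rw [h, top_add, eq_top_iff, ← h]
    apply codim_anti
    rw [Ideal.span_le]
    rintro z (rfl | rfl)
    · exact Ideal.subset_span (by simp)
    · exact Ideal.mul_mem_right _ _ (Ideal.subset_span (by simp))
  · exact codim_span_pair_mul fun u => dvd_of_dvd_mul_of_inum_ne_top h

theorem inum_pow (F G : OO) (n : ℕ) : inum F (G ^ n) = n * inum F G := by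
  induction n with
  | zero =>
    have : Ideal.span {F, (1 : OO)} = ⊤ :=
      (Ideal.eq_top_iff_one _).2 (Ideal.subset_span (by simp))
    rw [pow_zero, inum, this, codim]
    have : Subsingleton (OO ⧸ (⊤ : Ideal OO)) := Ideal.Quotient.subsingleton_iff.2 rfl
    simp
  | succ n ih =>
    rw [pow_succ, inum_mul, ih]
    push_cast
    ring

theorem inum_congr {F G H : OO} (h : F ∣ G - H) : inum F G = inum F H := by
  rw [inum, span_pair_eq_of_dvd_sub h]

theorem inum_unit_mul {a b : OO} (ha : IsUnit a) (hb : IsUnit b) (F G : OO) :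
    inum (a * F) (b * G) = inum F G := by
  rw [inum, span_pair_unit_mul ha hb]

/-! ### Derivations -/

section derivations

variable {f : ℂ × ℂ → ℂ} {p : ℂ × ℂ}

theorem analyticAt_fderiv_apply (hf : AnalyticAt ℂ f p) (v : ℂ × ℂ) :
    AnalyticAt ℂ (fun q => fderiv ℂ f q v) p :=
  analyticAt_clm_apply hf.fderiv analyticAt_const

theorem analyticAt_dx (hf : AnalyticAt ℂ f p) : AnalyticAt ℂ (dx f) p :=
  analyticAt_fderiv_apply hf _

theorem analyticAt_dy (hf : AnalyticAt ℂ f p) : AnalyticAt ℂ (dy f) p :=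
  analyticAt_fderiv_apply hf _

/-- The derivation of the ring of germs in the direction of a vector. -/
def dGerm (v : ℂ × ℂ) : Derivation ℂ OO OO := by
  have key : ∀ {f : ℂ × ℂ → ℂ}, AnalyticAt ℂ f 0 →
      germ (fun q => fderiv ℂ (repr (germ f)) q v) = germ fun q => fderiv ℂ f q v := fun hf =>
    germ_congr (((repr_germ hf).fderiv (𝕜 := ℂ)).mono fun z hz => by simp only [hz])
  refine Derivation.mk' ⟨⟨fun F => germ fun q => fderiv ℂ (repr F) q v, ?_⟩, ?_⟩ ?_
  · intro F G
    obtain ⟨f, hf, rfl⟩ := exists_germ_eq F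
    obtain ⟨g, hg, rfl⟩ := exists_germ_eq G
    rw [← germ_add hf hg, key (hf.fun_add hg), key hf, key hg,
      ← germ_add (analyticAt_fderiv_apply hf v) (analyticAt_fderiv_apply hg v)]
    apply germ_congr
    filter_upwards [hf.eventually_analyticAt, hg.eventually_analyticAt] with z hfz hgz
    rw [fderiv_fun_add hfz.differentiableAt hgz.differentiableAt]
    rfl
  · intro c F
    obtain ⟨f, hf, rfl⟩ := exists_germ_eq F
    simp only
    rw [Algebra.smul_def, ← germ_const, ← germ_mul analyticAt_const hf,
      key (analyticAt_const.fun_mul hf), key hf, RingHom.id_apply, Algebra.smul_def,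
      ← germ_const, ← germ_mul analyticAt_const (analyticAt_fderiv_apply hf v)]
    apply germ_congr
    filter_upwards [hf.eventually_analyticAt] with z hfz
    rw [fderiv_const_mul hfz.differentiableAt]
    rfl
  · intro F G
    obtain ⟨f, hf, rfl⟩ := exists_germ_eq F
    obtain ⟨g, hg, rfl⟩ := exists_germ_eq G
    simp only [LinearMap.coe_mk, AddHom.coe_mk, smul_eq_mul]
    rw [← germ_mul hf hg, key (hf.fun_mul hg), key hf, key hg,
      ← germ_mul hf (analyticAt_fderiv_apply hg v), ← germ_mul hg (analyticAt_fderiv_apply hf v),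
      ← germ_add (hf.fun_mul (analyticAt_fderiv_apply hg v))
        (hg.fun_mul (analyticAt_fderiv_apply hf v))]
    apply germ_congr
    filter_upwards [hf.eventually_analyticAt, hg.eventually_analyticAt] with z hfz hgz
    rw [fderiv_fun_mul hfz.differentiableAt hgz.differentiableAt]
    rfl

theorem dGerm_germ (hf : AnalyticAt ℂ f 0) (v : ℂ × ℂ) :
    dGerm v (germ f) = germ fun q => fderiv ℂ f q v :=
  germ_congr (((repr_germ hf).fderiv (𝕜 := ℂ)).mono fun z hz => by simp only [hz])

/-- The derivation `∂/∂x`. -/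
abbrev dX : Derivation ℂ OO OO := dGerm (1, 0)

/-- The derivation `∂/∂y`. -/
abbrev dY : Derivation ℂ OO OO := dGerm (0, 1)

theorem dX_germ (hf : AnalyticAt ℂ f 0) : dX (germ f) = germ (dx f) := dGerm_germ hf _

theorem dY_germ (hf : AnalyticAt ℂ f 0) : dY (germ f) = germ (dy f) := dGerm_germ hf _

theorem fderiv_fderiv_apply (hf : AnalyticAt ℂ f p) (v w : ℂ × ℂ) :
    fderiv ℂ (fun q => fderiv ℂ f q w) p v = fderiv ℂ (fderiv ℂ f) p v w := by
  rw [fderiv_clm_apply hf.fderiv.differentiableAt (differentiableAt_const _)]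
  simp

theorem dx_dy_comm (hf : AnalyticAt ℂ f p) : dx (dy f) p = dy (dx f) p := by
  unfold dx dy
  rw [fderiv_fderiv_apply hf, fderiv_fderiv_apply hf]
  exact (hf.contDiffAt (n := ⊤)).isSymmSndFDerivAt (by simp) (1, 0) (0, 1)

theorem dX_dY_comm (F : OO) : dX (dY F) = dY (dX F) := by
  obtain ⟨f, hf, rfl⟩ := exists_germ_eq F
  rw [dY_germ hf, dX_germ hf, dX_germ (analyticAt_dy hf), dY_germ (analyticAt_dx hf)]
  apply germ_congr
  filter_upwards [hf.eventually_analyticAt] with z hz using dx_dy_comm hz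

end derivations

/-! ### Common divisors of germs -/

theorem germX_add {r s : ℂ → ℂ} (hr : AnalyticAt ℂ r 0) (hs : AnalyticAt ℂ s 0) :
    germX (fun t => r t + s t) = germX r + germX s :=
  germ_add (analyticAt_comp_fst hr) (analyticAt_comp_fst hs)

theorem germX_mul {r s : ℂ → ℂ} (hr : AnalyticAt ℂ r 0) (hs : AnalyticAt ℂ s 0) :
    germX (fun t => r t * s t) = germX r * germX s :=
  germ_mul (analyticAt_comp_fst hr) (analyticAt_comp_fst hs)

theorem germX_const (c : ℂ) : germX (fun _ => c) = algebraMap ℂ OO c := germ_const c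

theorem germX_id : germX id = cX := rfl

theorem germX_pow (n : ℕ) : germX (fun t => t ^ n) = cX ^ n := germ_pow analyticAt_fst n

theorem germX_congr {r s : ℂ → ℂ} (h : r =ᶠ[𝓝 0] s) : germX r = germX s :=
  germ_congr ((continuous_fst.tendsto (0 : ℂ × ℂ)).eventually h)

theorem germX_eq_zero_iff {r : ℂ → ℂ} (hr : AnalyticAt ℂ r 0) :
    germX r = 0 ↔ ∀ᶠ t in 𝓝 (0 : ℂ), r t = 0 := by
  constructor
  · intro h
    rw [germX, ← germ_zero, germ_eq_iff (analyticAt_comp_fst hr) analyticAt_const] at h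
    exact (tendsto_of_analyticAt analyticAt_axisX axisX_zero).eventually h
  · intro h
    rw [germX_congr (s := fun _ => 0) h, germX_const, map_zero]

/-- The germs of functions of the first variable. -/
def RX : Subalgebra ℂ OO where
  carrier := {F | ∃ r, AnalyticAt ℂ r 0 ∧ germX r = F}
  mul_mem' := by
    rintro _ _ ⟨r, hr, rfl⟩ ⟨s, hs, rfl⟩
    exact ⟨_, hr.fun_mul hs, germX_mul hr hs⟩
  add_mem' := by
    rintro _ _ ⟨r, hr, rfl⟩ ⟨s, hs, rfl⟩
    exact ⟨_, hr.fun_add hs, germX_add hr hs⟩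
  algebraMap_mem' c := ⟨_, analyticAt_const, germX_const c⟩

theorem germX_mem_RX {r : ℂ → ℂ} (hr : AnalyticAt ℂ r 0) : germX r ∈ RX := ⟨r, hr, rfl⟩

theorem exists_eq_cX_pow_mul_unit {r : OO} (hr : r ∈ RX) (h0 : r ≠ 0) :
    ∃ (N : ℕ) (u : OO), IsUnit u ∧ r = cX ^ N * u := by
  obtain ⟨r, hr, rfl⟩ := hr
  have h1 : analyticOrderAt r 0 ≠ ⊤ := by
    rwa [Ne, analyticOrderAt_eq_top, ← germX_eq_zero_iff hr]
  obtain ⟨s, hs, hs0, h⟩ := hr.analyticOrderAt_ne_top.1 h1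
  refine ⟨analyticOrderNatAt r 0, germX s, ?_, ?_⟩
  · rwa [isUnit_iff_ev, germX, ev_germ (analyticAt_comp_fst hs)]
  · rw [← germX_pow, ← germX_mul (by fun_prop) hs]
    apply germX_congr
    filter_upwards [h] with t ht
    rw [ht, sub_zero, smul_eq_mul]

theorem exists_eq_const_add_mul {r : ℂ → ℂ} (hr : AnalyticAt ℂ r 0) :
    ∃ s, AnalyticAt ℂ s 0 ∧ germX r = algebraMap ℂ OO (r 0) + cX * germX s := by
  have h : ((1 : ℕ) : ℕ∞) ≤ analyticOrderAt (fun t => r t - r 0) 0 := by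
    rw [Nat.cast_one, Order.one_le_iff_ne_zero,
      (hr.fun_sub analyticAt_const).analyticOrderAt_ne_zero]
    simp
  obtain ⟨s, hs, h⟩ := (natCast_le_analyticOrderAt (hr.fun_sub analyticAt_const)).1 h
  refine ⟨s, hs, ?_⟩
  rw [← germX_const, ← germX_id, ← germX_mul analyticAt_id hs,
    ← germX_add analyticAt_const (analyticAt_id.fun_mul hs)]
  apply germX_congr
  filter_upwards [h] with t ht
  simp only [sub_zero, pow_one, smul_eq_mul] at ht
  rw [id, ← ht]
  ring

theorem exists_eq_sum_add_cX_pow_mul {r : ℂ → ℂ} (hr : AnalyticAt ℂ r 0) (N : ℕ) :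
    ∃ (c : Fin N → ℂ) (s : OO), germX r = ∑ i, c i • cX ^ (i : ℕ) + cX ^ N * s := by
  induction N generalizing r with
  | zero => exact ⟨Fin.elim0, germX r, by simp⟩
  | succ N ih =>
    obtain ⟨r', hr', h'⟩ := exists_eq_const_add_mul hr
    obtain ⟨c, s, h⟩ := ih hr'
    refine ⟨Fin.cons (r 0) c, s, ?_⟩
    rw [h', h, Fin.sum_univ_succ]
    simp only [Fin.cons_zero, Fin.cons_succ, Fin.val_zero, Fin.val_succ, pow_succ, pow_zero,
      mul_add, Finset.mul_sum, Algebra.smul_def, mul_one]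
    rw [add_assoc]
    congr 2
    · exact Finset.sum_congr rfl fun i _ => by ring
    · ring

/-- Division by G reduces every class to powers y ^ j, with j below the y-order of G, with
coefficients depending on x. Since x ^ N vanishes in the quotient, these can be truncated, and
finitely many monomials remain. -/
theorem inum_ne_top_of_cX_pow_mem {F G : OO} (hG : ¬ cX ∣ G) {N : ℕ}
    (hN : cX ^ N ∈ Ideal.span {F, G}) : inum F G ≠ ⊤ := by
  rw [codim_ne_top_iff]
  rw [cX_dvd_iff] at hG
  obtain ⟨n, hn⟩ := ENat.ne_top_iff_exists.1 hG
  set π := Ideal.Quotient.mk (Ideal.span {F, G}) with hπ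
  let w : Fin n × Fin N → OO ⧸ Ideal.span {F, G} := fun p => π (cX ^ (p.2 : ℕ) * cY ^ (p.1 : ℕ))
  rw [Module.finite_def]
  have : (⊤ : Submodule ℂ (OO ⧸ Ideal.span {F, G})) = Submodule.span ℂ (Set.range w) := by
    symm
    rw [eq_top_iff]
    intro z _
    obtain ⟨z, rfl⟩ := Ideal.Quotient.mk_surjective z
    obtain ⟨Q, r, hr, rfl⟩ := weierstrass_germ hn.symm z
    rw [← hπ, map_add, map_mul, (Ideal.Quotient.eq_zero_iff_mem.2 (Ideal.subset_span (by simp)) :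
      π G = 0), mul_zero, zero_add, map_sum]
    refine Submodule.sum_mem _ fun j _ => ?_
    obtain ⟨c, s, h⟩ := exists_eq_sum_add_cX_pow_mul (hr j) N
    rw [map_mul, h, map_add, map_mul π (cX ^ N), Ideal.Quotient.eq_zero_iff_mem.2 hN, zero_mul,
      add_zero, map_sum, Finset.sum_mul]
    refine Submodule.sum_mem _ fun i _ => ?_
    have h1 : π (c i • cX ^ (i : ℕ)) * π (cY ^ (j : ℕ)) = c i • w (j, i) := by
      rw [← map_mul, smul_mul_assoc]
      rfl
    rw [h1]
    exact Submodule.smul_mem _ _ (Submodule.subset_span ⟨_, rfl⟩)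
  rw [this]
  exact Submodule.fg_span (Set.finite_range w)

theorem finite_RX_quotient {G : OO} (hG : ¬ cX ∣ G) : Module.Finite RX (OO ⧸ Ideal.span {G}) := by
  rw [cX_dvd_iff] at hG
  obtain ⟨n, hn⟩ := ENat.ne_top_iff_exists.1 hG
  set π := Ideal.Quotient.mk (Ideal.span {G}) with hπ
  let w : Fin n → OO ⧸ Ideal.span {G} := fun j => π (cY ^ (j : ℕ))
  rw [Module.finite_def]
  have : (⊤ : Submodule RX (OO ⧸ Ideal.span {G})) = Submodule.span RX (Set.range w) := by
    symm
    rw [eq_top_iff]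
    intro z _
    obtain ⟨z, rfl⟩ := Ideal.Quotient.mk_surjective z
    obtain ⟨Q, r, hr, rfl⟩ := weierstrass_germ hn.symm z
    rw [← hπ, map_add, map_mul, (Ideal.Quotient.eq_zero_iff_mem.2 (Ideal.subset_span (by simp)) :
      π G = 0), mul_zero, zero_add, map_sum]
    refine Submodule.sum_mem _ fun j _ => ?_
    have h1 : π (germX (r j) * cY ^ (j : ℕ)) = (⟨_, germX_mem_RX (hr j)⟩ : RX) • w j := rfl
    rw [h1]
    exact Submodule.smul_mem _ _ (Submodule.subset_span ⟨_, rfl⟩)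
  rw [this]
  exact Submodule.fg_span (Set.finite_range w)

/-- Modulo a germ `G` not divisible by `x`, every non-zero-divisor divides a power of `x`. -/
theorem exists_cX_pow_mem_of_regular {F G : OO} (hG : ¬ cX ∣ G) (hreg : ∀ u, G ∣ F * u → G ∣ u) :
    ∃ N : ℕ, cX ^ N ∈ Ideal.span {F, G} := by
  have := finite_RX_quotient hG
  have : Nontrivial RX := inferInstance
  have halg : IsAlgebraic RX (Ideal.Quotient.mk (Ideal.span {G}) F) :=
    (IsIntegral.of_finite RX _).isAlgebraic
  have hnzd : Ideal.Quotient.mk (Ideal.span {G}) F ∈ nonZeroDivisors (OO ⧸ Ideal.span {G}) := by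
    rw [mem_nonZeroDivisors_iff_right]
    intro z hz
    obtain ⟨u, rfl⟩ := Ideal.Quotient.mk_surjective z
    rw [← map_mul, Ideal.Quotient.eq_zero_iff_mem, Ideal.mem_span_singleton] at hz
    rw [Ideal.Quotient.eq_zero_iff_mem, Ideal.mem_span_singleton]
    exact hreg u (by rwa [mul_comm])
  -- F is integral over `RX` modulo G. As a non-zero-divisor it divides a non-zero constant term of
  -- an algebraic equation, and a non-zero element of `RX` is a power of x times a unit.
  obtain ⟨r, hr0, z, hz⟩ := halg.exists_nonzero_dvd hnzd
  obtain ⟨N, u, hu, hru⟩ := exists_eq_cX_pow_mul_unit r.2 (fun h => hr0 (Subtype.ext h))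
  obtain ⟨a, rfl⟩ := Ideal.Quotient.mk_surjective z
  have h1 : Ideal.Quotient.mk (Ideal.span {G}) (r : OO) = Ideal.Quotient.mk _ (F * a) := by
    rw [map_mul, ← hz]
    rfl
  rw [Ideal.Quotient.eq, Ideal.mem_span_singleton] at h1
  obtain ⟨b, hb⟩ := h1
  refine ⟨N, ?_⟩
  obtain ⟨u, rfl⟩ := hu
  rw [Ideal.mem_span_pair]
  refine ⟨a * (u⁻¹ : OOˣ), b * (u⁻¹ : OOˣ), ?_⟩
  have h2 : cX ^ N = (r : OO) * (u⁻¹ : OOˣ) := by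
    rw [hru, mul_assoc, Units.mul_inv, mul_one]
  rw [h2]
  linear_combination -((u⁻¹ : OOˣ) : OO) * hb

/-- Extracting the largest common power of x from the coefficients leaves one that is non-zero at x
= 0, so that the restriction to the y-axis has order below n. This makes Weierstrass remainders
usable for descent on the y-order. -/
theorem exists_polynomial_reduction {n : ℕ} {r : Fin n → ℂ → ℂ} (hr : ∀ j, AnalyticAt ℂ (r j) 0)
    (h0 : ∑ j, germX (r j) * cY ^ (j : ℕ) ≠ 0) :
    ∃ (k m : ℕ) (H : OO), m < n ∧ yord H = m ∧
      ∑ j, germX (r j) * cY ^ (j : ℕ) = cX ^ k * H := by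
  obtain ⟨j₀, hj₀⟩ : ∃ j, germX (r j) ≠ 0 := by
    by_contra! h
    exact h0 (Finset.sum_eq_zero fun j _ => by rw [h j, zero_mul])
  obtain ⟨j₁, -, hj₁⟩ := Finset.exists_min_image Finset.univ (fun j => analyticOrderAt (r j) 0)
    ⟨j₀, Finset.mem_univ _⟩
  have htop : analyticOrderAt (r j₁) 0 ≠ ⊤ := by
    intro h
    have h1 := hj₁ j₀ (Finset.mem_univ _)
    rw [h, top_le_iff, analyticOrderAt_eq_top, ← germX_eq_zero_iff (hr j₀)] at h1
    exact hj₀ h1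
  obtain ⟨k, hk⟩ := ENat.ne_top_iff_exists.1 htop
  choose s hs hrs using fun j => (natCast_le_analyticOrderAt (hr j)).1
    (hk.le.trans (hj₁ j (Finset.mem_univ _)))
  simp only [sub_zero, smul_eq_mul] at hrs
  have hs0 : s j₁ 0 ≠ 0 := by
    intro h
    have h1 : ((k + 1 : ℕ) : ℕ∞) ≤ analyticOrderAt (r j₁) 0 := by
      rw [analyticOrderAt_congr (hrs j₁), show (fun t => t ^ k * s j₁ t) = (fun t => t ^ k) * s j₁
        from rfl, analyticOrderAt_mul (by fun_prop) (hs j₁)]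
      push_cast
      refine add_le_add ?_ (Order.one_le_iff_ne_zero.2 ((hs j₁).analyticOrderAt_ne_zero.2 h))
      rw [natCast_le_analyticOrderAt (by fun_prop)]
      exact ⟨fun _ => 1, analyticAt_const, by simp⟩
    rw [← hk] at h1
    exact absurd (Nat.cast_le.1 h1) (by simp)
  have hH : AnalyticAt ℂ (fun z : ℂ × ℂ => ∑ j, s j z.1 * z.2 ^ (j : ℕ)) 0 :=
    Finset.analyticAt_fun_sum _ fun j _ =>
      (analyticAt_comp_fst (hs j)).fun_mul (analyticAt_snd.fun_pow _)
  have hHeq : germ (fun z : ℂ × ℂ => ∑ j, s j z.1 * z.2 ^ (j : ℕ)) =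
      ∑ j, germX (s j) * cY ^ (j : ℕ) := by
    rw [germ_sum _ fun j _ => (analyticAt_comp_fst (hs j)).fun_mul (analyticAt_snd.fun_pow _)]
    refine Finset.sum_congr rfl fun j _ => ?_
    rw [germ_mul (analyticAt_comp_fst (hs j)) (analyticAt_snd.fun_pow _),
      germ_pow analyticAt_snd]
    rfl
  have hlt : yord (germ fun z : ℂ × ℂ => ∑ j, s j z.1 * z.2 ^ (j : ℕ)) < n := by
    by_contra! hle
    have ha := analyticAt_comp_curve hH analyticAt_axisY axisY_zero
    rw [yord, ordAlong_germ analyticAt_axisY axisY_zero hH, natCast_le_analyticOrderAt ha] at hle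
    obtain ⟨g, hg, hgs⟩ := hle
    simp only [axisY, sub_zero, smul_eq_mul] at hgs
    have h1 := eq_zero_of_mul_pow_add_sum_eq_zero (q := fun t => - g t) hg.continuousAt.neg
      (r := fun j => s j 0) (by
        filter_upwards [hgs] with t ht
        rw [ht]
        ring)
    exact hs0 (congrFun h1 j₁)
  obtain ⟨m, hm⟩ := ENat.ne_top_iff_exists.1 (hlt.trans (ENat.natCast_lt_top n)).ne
  refine ⟨k, m, _, ?_, hm.symm, ?_⟩
  · rw [← hm] at hlt
    exact_mod_cast hlt
  · rw [hHeq, Finset.mul_sum]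
    refine Finset.sum_congr rfl fun j _ => ?_
    rw [germX_congr (hrs j), germX_mul (by fun_prop) (hs j), germX_pow, mul_assoc]

/-- If F were regular modulo G, the codimension would be finite. Otherwise the ideal of all v with G
∣ Fv is generated by an element w of least y-order, since a non-zero remainder modulo w would, after
cancelling a power of x, have smaller order. From G = wq and Fw = Ga follows F = qa, and q is no
unit because that ideal is larger than (G). -/
theorem exists_common_divisor_aux {F G : OO} (hG : ¬ cX ∣ G) (h : inum F G = ⊤) :
    ∃ d, ¬ IsUnit d ∧ d ∣ F ∧ d ∣ G := by
  by_cases hreg : ∀ u, G ∣ F * u → G ∣ u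
  · obtain ⟨N, hN⟩ := exists_cX_pow_mem_of_regular hG hreg
    exact absurd h (inum_ne_top_of_cX_pow_mem hG hN)
  · push Not at hreg
    obtain ⟨u, hu, hGu⟩ := hreg
    have hex : ∃ m : ℕ, ∃ w, G ∣ F * w ∧ yord w = m := by
      rw [cX_dvd_iff] at hG
      obtain ⟨m, hm⟩ := ENat.ne_top_iff_exists.1 hG
      exact ⟨m, G, dvd_mul_left _ _, hm.symm⟩
    classical
    obtain ⟨w, hw, hwm⟩ := Nat.find_spec hex
    have hdiv : ∀ v, G ∣ F * v → w ∣ v := by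
      intro v hv
      obtain ⟨Q, r, hr, hvr⟩ := weierstrass_germ hwm v
      by_cases h0 : ∑ j, germX (r j) * cY ^ (j : ℕ) = 0
      · rw [h0, add_zero] at hvr
        exact ⟨Q, by rw [hvr, mul_comm]⟩
      · exfalso
        obtain ⟨k, m, H, hmn, hHm, hH⟩ := exists_polynomial_reduction hr h0
        refine Nat.find_min hex hmn ⟨H, ?_, hHm⟩
        have h1 : G ∣ cX ^ k * (F * H) := by
          have : cX ^ k * (F * H) = F * v - Q * (F * w) := by
            rw [hvr, hH]; ring
          rw [this]
          exact dvd_sub hv (hw.mul_left _)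
        obtain ⟨b, hb⟩ := h1
        obtain ⟨c, rfl⟩ := cX_prime.pow_dvd_of_dvd_mul_left k hG ⟨_, hb.symm⟩
        refine ⟨c, mul_left_cancel₀ (pow_ne_zero k cX_prime.ne_zero) ?_⟩
        rw [hb]; ring
    obtain ⟨q, hq⟩ := hdiv G (dvd_mul_left _ _)
    obtain ⟨a, ha⟩ := hw
    have hw0 : w ≠ 0 := by
      rintro rfl
      rw [zero_mul] at hq
      exact hG (hq ▸ dvd_zero _)
    refine ⟨q, fun hqu => hGu ?_, ⟨a, mul_left_cancel₀ hw0 ?_⟩, ⟨w, by rw [hq, mul_comm]⟩⟩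
    · rw [hq, hqu.mul_right_dvd]
      exact hdiv u hu
    · rw [mul_comm, ha, hq]; ring

/-- Germs with infinite intersection number have a common component. -/
theorem exists_common_divisor {F G : OO} (h : inum F G = ⊤) :
    ∃ d, ¬ IsUnit d ∧ d ∣ F ∧ d ∣ G := by
  by_cases hG : cX ∣ G
  · by_cases hF : cX ∣ F
    · exact ⟨cX, cX_prime.not_isUnit, hF, hG⟩
    · obtain ⟨d, hd, h1, h2⟩ := exists_common_divisor_aux hF (inum_comm F G ▸ h)
      exact ⟨d, hd, h2, h1⟩
  · exact exists_common_divisor_aux hG h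

theorem inum_ne_top_of_not_dvd {g a : OO} (hg : Irreducible g) (ha : ¬ g ∣ a) : inum g a ≠ ⊤ := by
  intro htop
  obtain ⟨d, hd, hdg, hda⟩ := exists_common_divisor htop
  obtain ⟨c, hc⟩ := hdg
  have hcu := (hg.isUnit_or_isUnit hc).resolve_left hd
  exact ha (by rw [hc, hcu.mul_right_dvd]; exact hda)

/-- An irreducible g not dividing a has finite intersection number with a, and primeness is then the
regular-sequence property; factoriality of the ring is not invoked. -/
theorem prime_of_irreducible {g : OO} (hg : Irreducible g) : Prime g := by
  refine ⟨hg.ne_zero, hg.not_isUnit, fun a b hab => ?_⟩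
  by_cases ha : g ∣ a
  · exact Or.inl ha
  · exact Or.inr (dvd_of_dvd_mul_of_inum_ne_top (inum_ne_top_of_not_dvd hg ha) hab)

/-- Descent on the order in y, which is finite here, additive on products, and zero only for units.
-/
theorem exists_irreducible_dvd {d : OO} (hd : ¬ IsUnit d) (hX : ¬ cX ∣ d) :
    ∃ g, Irreducible g ∧ g ∣ d := by
  have htop := hX
  rw [cX_dvd_iff] at htop
  obtain ⟨n, hn⟩ := ENat.ne_top_iff_exists.1 htop
  induction n using Nat.strong_induction_on generalizing d with
  | _ n ih =>
    by_cases hirr : Irreducible d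
    · exact ⟨d, hirr, dvd_rfl⟩
    · rw [irreducible_iff] at hirr
      push Not at hirr
      obtain ⟨a, b, hab, ha, hb⟩ := hirr hd
      have hXa : ¬ cX ∣ a := fun h => hX (hab ▸ h.mul_right b)
      have hta := hXa
      rw [cX_dvd_iff] at hta
      obtain ⟨k, hk⟩ := ENat.ne_top_iff_exists.1 hta
      have hkn : k < n := by
        rw [hab, yord_mul, ← hk] at hn
        have hb0 : yord b ≠ 0 := fun h =>
          hb ((ordAlong_eq_zero_iff analyticAt_axisY axisY_zero).1 h)
        have h1 : (k : ℕ∞) < n := by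
          rw [hn, add_comm]
          exact ENat.lt_add_left (ENat.natCast_ne_top k) (pos_iff_ne_zero.2 hb0)
        exact_mod_cast h1
      obtain ⟨g, hg, hga⟩ := ih k hkn ha hXa hta hk
      exact ⟨g, hg, hga.trans ⟨b, hab⟩⟩

/-- Germs with infinite intersection number have a common prime component. -/
theorem exists_common_prime {F G : OO} (h : inum F G = ⊤) :
    ∃ g, Prime g ∧ g ∣ F ∧ g ∣ G := by
  obtain ⟨d, hd, hdF, hdG⟩ := exists_common_divisor h
  by_cases hX : cX ∣ d
  · exact ⟨cX, cX_prime, hX.trans hdF, hX.trans hdG⟩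
  · obtain ⟨g, hg, hgd⟩ := exists_irreducible_dvd hd hX
    exact ⟨g, prime_of_irreducible hg, hgd.trans hdF, hgd.trans hdG⟩

/-! ### Smooth germs of curves -/

theorem dX_germX {r : ℂ → ℂ} (hr : AnalyticAt ℂ r 0) : dX (germX r) = germX (deriv r) := by
  rw [germX, dX_germ (analyticAt_comp_fst hr)]
  apply germ_congr
  filter_upwards [(continuous_fst.tendsto (0 : ℂ × ℂ)).eventually hr.eventually_analyticAt]
    with z hz
  have h1 := (hz.differentiableAt.hasDerivAt.hasFDerivAt.comp z
    (hasFDerivAt_fst (𝕜 := ℂ) (p := z))).fderiv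
  change fderiv ℂ (r ∘ Prod.fst) z (1, 0) = _
  rw [h1]
  simp

theorem dY_germX {r : ℂ → ℂ} (hr : AnalyticAt ℂ r 0) : dY (germX r) = 0 := by
  rw [germX, dY_germ (analyticAt_comp_fst hr), ← germ_zero]
  apply germ_congr
  filter_upwards [(continuous_fst.tendsto (0 : ℂ × ℂ)).eventually hr.eventually_analyticAt]
    with z hz
  have h1 := (hz.differentiableAt.hasDerivAt.hasFDerivAt.comp z
    (hasFDerivAt_fst (𝕜 := ℂ) (p := z))).fderiv
  change fderiv ℂ (r ∘ Prod.fst) z (0, 1) = _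
  rw [h1]
  simp

theorem dX_cX : dX cX = 1 := by
  rw [← germX_id, dX_germX analyticAt_id, deriv_id', germX_const, map_one]

theorem dY_cX : dY cX = 0 := dY_germX analyticAt_id

theorem dGerm_swap (v : ℂ × ℂ) (F : OO) :
    dGerm v (swapEquiv F) = swapEquiv (dGerm v.swap F) := by
  obtain ⟨f, hf, rfl⟩ := exists_germ_eq F
  have hs : AnalyticAt ℂ (Prod.swap : ℂ × ℂ → ℂ × ℂ) 0 := analyticAt_snd.prod analyticAt_fst
  rw [swapEquiv_germ hf, dGerm_germ hf, swapEquiv_germ (analyticAt_fderiv_apply hf _), dGerm_germ]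
  · apply germ_congr
    filter_upwards [hs.continuousAt.tendsto.eventually hf.eventually_analyticAt] with z hz
    let s : ℂ × ℂ →L[ℂ] ℂ × ℂ := (ContinuousLinearMap.snd ℂ ℂ ℂ).prod (ContinuousLinearMap.fst ℂ ℂ ℂ)
    have h1 := (hz.differentiableAt.hasFDerivAt.comp z (f := Prod.swap) s.hasFDerivAt).fderiv
    change fderiv ℂ (f ∘ Prod.swap) z v = _
    rw [h1]
    rfl
  · exact AnalyticAt.comp (g := f) (f := Prod.swap) hf hs

theorem dX_swap (F : OO) : dX (swapEquiv F) = swapEquiv (dY F) := dGerm_swap _ F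

theorem dY_swap (F : OO) : dY (swapEquiv F) = swapEquiv (dX F) := dGerm_swap _ F

theorem ev_swap (F : OO) : ev (swapEquiv F) = ev F := by
  obtain ⟨f, hf, rfl⟩ := exists_germ_eq F
  have hs : AnalyticAt ℂ (Prod.swap : ℂ × ℂ → ℂ × ℂ) 0 := analyticAt_snd.prod analyticAt_fst
  have h : AnalyticAt ℂ (fun z : ℂ × ℂ => f z.swap) 0 :=
    AnalyticAt.comp (g := f) (f := Prod.swap) hf hs
  rw [swapEquiv_germ hf, ev_germ hf, ev_germ h]
  rfl

theorem dX_cY : dX cY = 0 := by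
  rw [← swapEquiv_cX, dX_swap, dY_cX, map_zero]

theorem dY_cY : dY cY = 1 := by
  rw [← swapEquiv_cX, dY_swap, dX_cX, map_one]

theorem yord_dY_add_one {F : OO} (h : ev F = 0) : yord (dY F) + 1 = yord F := by
  obtain ⟨f, hf, rfl⟩ := exists_germ_eq F
  rw [ev_germ hf] at h
  have ha := analyticAt_comp_curve hf analyticAt_axisY axisY_zero
  rw [yord, yord, dY_germ hf, ordAlong_germ analyticAt_axisY axisY_zero (analyticAt_dy hf),
    ordAlong_germ analyticAt_axisY axisY_zero hf]
  have h1 := ha.analyticOrderAt_deriv_add_one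
  rw [axisY_zero, h] at h1
  simp only [sub_zero] at h1
  rw [← h1]
  congr 1
  apply analyticOrderAt_congr
  filter_upwards [(tendsto_of_analyticAt analyticAt_axisY axisY_zero).eventually
    hf.eventually_analyticAt] with t ht
  have h2 : HasDerivAt axisY (0, 1) t := (hasDerivAt_const t (0 : ℂ)).prodMk (hasDerivAt_id t)
  exact (ht.differentiableAt.hasFDerivAt.comp_hasDerivAt t h2).deriv.symm

theorem codim_mm : codim mm = 1 := by
  have h1 : mm = RingHom.ker ev := by
    ext F
    rw [mem_mm_iff, RingHom.mem_ker]
  have hs : Function.Surjective ev := fun c => ⟨algebraMap ℂ OO c, ev.commutes c⟩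
  rw [h1, codim, (Ideal.quotientKerAlgEquivOfSurjective hs).toLinearEquiv.rank_eq, Module.rank_self,
    map_one]

theorem inum_eq_zero_of_isUnit {F u : OO} (hu : IsUnit u) : inum F u = 0 := by
  have h := inum_unit_mul (a := 1) isUnit_one hu F 1
  have h2 := inum_pow F 1 0
  rw [mul_one, one_mul] at h
  rw [pow_zero] at h2
  rw [h, h2]
  simp

/-- A germ of map parametrising a smooth curve regularly. -/
structure IsRegularCurve (γ : ℂ → ℂ × ℂ) : Prop where
  analyticAt : AnalyticAt ℂ γ 0
  map_zero : γ 0 = 0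
  deriv_ne_zero : deriv γ 0 ≠ 0

theorem yord_eq_zero_iff {F : OO} : yord F = 0 ↔ IsUnit F :=
  ordAlong_eq_zero_iff analyticAt_axisY axisY_zero

/-- The implicit function theorem as a division of y by F: the y-order of F is one, so the remainder
depends on x only, and comparison of the y-derivatives at 0 shows that the quotient is a unit. -/
theorem graph_form {F : OO} (h0 : ev F = 0) (hy : ev (dY F) ≠ 0) :
    ∃ φ, AnalyticAt ℂ φ 0 ∧ φ 0 = 0 ∧ ∃ u, IsUnit u ∧ u * F = cY - germX φ := by
  have h1 : yord F = (1 : ℕ) := by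
    rw [← yord_dY_add_one h0, yord_eq_zero_iff.2 (isUnit_iff_ev.2 hy)]
    rfl
  obtain ⟨Q, r, hr, h⟩ := weierstrass_germ h1 cY
  simp only [Finset.univ_unique, Fin.default_eq_zero, Fin.isValue, Finset.sum_singleton,
    Fin.val_zero, pow_zero, mul_one] at h
  have h2 := congrArg ev h
  rw [map_add, map_mul, h0, mul_zero, zero_add, ev_cY, germX,
    ev_germ (analyticAt_comp_fst (hr 0))] at h2
  have h3 := congrArg ev (congrArg dY h)
  rw [dY_cY, map_add, dY_germX (hr 0), add_zero, Derivation.leibniz, map_add] at h3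
  simp only [smul_eq_mul, map_mul, h0, zero_mul, add_zero, map_one] at h3
  refine ⟨r 0, hr 0, h2.symm, Q, isUnit_iff_ev.2 fun hQ => ?_, ?_⟩
  · rw [hQ, zero_mul] at h3
    exact one_ne_zero h3
  · rw [h]; ring

section smooth

variable {F : OO}

theorem exists_regularCurve_aux (h0 : ev F = 0) (hy : ev (dY F) ≠ 0) :
    ∃ γ, IsRegularCurve γ ∧ ordAlong γ F = ⊤ := by
  obtain ⟨φ, hφ, hφ0, u, hu, huF⟩ := graph_form h0 hy
  have hγ : AnalyticAt ℂ (fun t => (t, φ t)) 0 := analyticAt_id.prod hφ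
  have hγ0 : (fun t => (t, φ t)) 0 = 0 := by simp [hφ0]
  refine ⟨fun t => (t, φ t), ⟨hγ, hγ0, ?_⟩, ?_⟩
  · have h1 : HasDerivAt (fun t => (t, φ t)) (1, deriv φ 0) 0 :=
      (hasDerivAt_id 0).prodMk hφ.differentiableAt.hasDerivAt
    rw [h1.deriv]
    simp
  · have h1 := congrArg (ordAlong fun t => (t, φ t)) huF
    rw [ordAlong_mul hγ hγ0, (ordAlong_eq_zero_iff hγ hγ0).2 hu, zero_add, germX, cY,
      ← germ_sub analyticAt_snd (analyticAt_comp_fst hφ),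
      ordAlong_germ hγ hγ0 (analyticAt_snd.fun_sub (analyticAt_comp_fst hφ))] at h1
    rw [h1, analyticOrderAt_eq_top]
    simp

theorem deriv_fst {γ : ℂ → ℂ × ℂ} {t : ℂ} (hγ : AnalyticAt ℂ γ t) :
    deriv (fun t => (γ t).1) t = (deriv γ t).1 :=
  ((ContinuousLinearMap.fst ℂ ℂ ℂ).hasFDerivAt.comp_hasDerivAt t
    hγ.differentiableAt.hasDerivAt).deriv

theorem deriv_snd {γ : ℂ → ℂ × ℂ} {t : ℂ} (hγ : AnalyticAt ℂ γ t) :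
    deriv (fun t => (γ t).2) t = (deriv γ t).2 :=
  ((ContinuousLinearMap.snd ℂ ℂ ℂ).hasFDerivAt.comp_hasDerivAt t
    hγ.differentiableAt.hasDerivAt).deriv

theorem inum_zero_right (F : OO) (hF : inum F cX ≠ 0) : inum F 0 = ⊤ := by
  rw [ENat.eq_top_iff_forall_ge]
  intro N
  have h1 : inum F (cX ^ N) ≤ inum F 0 := by
    apply codim_anti
    rw [Ideal.span_le]
    rintro z (rfl | rfl)
    · exact Ideal.subset_span (by simp)
    · exact Ideal.zero_mem _
  refine le_trans ?_ h1
  rw [inum_pow]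
  exact le_mul_of_one_le_right (zero_le) (Order.one_le_iff_ne_zero.2 hF)

/-- Dividing H by F leaves a function r of x alone. Since F and x generate the maximal ideal, the
intersection number is the order of r; since the curve is a graph, x is a local parameter along γ,
so the order of H ∘ γ is that of r too. -/
theorem inum_eq_ordAlong_aux (h0 : ev F = 0) (hy : ev (dY F) ≠ 0) {γ : ℂ → ℂ × ℂ}
    (hγ : IsRegularCurve γ) (hF : ordAlong γ F = ⊤) (H : OO) : inum F H = ordAlong γ H := by
  obtain ⟨hγa, hγ0, hγd⟩ := hγ
  obtain ⟨φ, hφ, hφ0, u, hu, huF⟩ := graph_form h0 hy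
  have hx : AnalyticAt ℂ (fun t => (γ t).1) 0 := analyticAt_comp_curve analyticAt_fst hγa hγ0
  have hx0 : (γ 0).1 = 0 := by rw [hγ0]; rfl
  have hgr : ∀ᶠ t in 𝓝 (0 : ℂ), (γ t).2 = φ (γ t).1 := by
    have h1 := congrArg (ordAlong γ) huF
    rw [ordAlong_mul hγa hγ0, hF, add_top, germX, cY,
      ← germ_sub analyticAt_snd (analyticAt_comp_fst hφ),
      ordAlong_germ hγa hγ0 (analyticAt_snd.fun_sub (analyticAt_comp_fst hφ)), eq_comm,
      analyticOrderAt_eq_top] at h1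
    filter_upwards [h1] with t ht using sub_eq_zero.1 ht
  have hxd : deriv (fun t => (γ t).1) 0 ≠ 0 := by
    intro h
    apply hγd
    have h2 : deriv (fun t => (γ t).2) 0 = 0 := by
      rw [EventuallyEq.deriv_eq (show (fun t => (γ t).2) =ᶠ[𝓝 0] fun t => φ (γ t).1 from hgr)]
      have hφ' : AnalyticAt ℂ φ (γ 0).1 := by rwa [hx0]
      have h3 := (hφ'.differentiableAt.hasDerivAt.comp (0 : ℂ)
        hx.differentiableAt.hasDerivAt).deriv
      rw [h, mul_zero] at h3
      exact h3
    rw [deriv_fst hγa] at h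
    rw [deriv_snd hγa] at h2
    exact Prod.ext h h2
  have hX1 : inum F cX = 1 := by
    rw [← codim_mm, inum]
    congr 1
    apply le_antisymm
    · rw [Ideal.span_le]
      rintro z (rfl | rfl)
      · exact mem_mm_iff.2 h0
      · exact mem_mm_iff.2 ev_cX
    · rw [mm, Ideal.span_le]
      rintro z (rfl | rfl)
      · exact Ideal.subset_span (by simp)
      · obtain ⟨s, hs, h⟩ := exists_eq_const_add_mul hφ
        rw [hφ0, map_zero, zero_add] at h
        exact Ideal.mem_span_pair.2 ⟨u, germX s, by rw [huF, h]; ring⟩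
  have h1 : yord F = (1 : ℕ) := by
    rw [← yord_dY_add_one h0, yord_eq_zero_iff.2 (isUnit_iff_ev.2 hy)]
    rfl
  obtain ⟨Q, r, hr, h⟩ := weierstrass_germ h1 H
  simp only [Finset.univ_unique, Fin.default_eq_zero, Fin.isValue, Finset.sum_singleton,
    Fin.val_zero, pow_zero, mul_one] at h
  have h2 : inum F H = inum F (germX (r 0)) := inum_congr ⟨Q, by rw [h]; ring⟩
  have h3 : ordAlong γ H = analyticOrderAt (r 0) 0 := by
    obtain ⟨k, hk, hkH⟩ := exists_germ_eq H
    obtain ⟨f, hf, hfF⟩ := exists_germ_eq F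
    obtain ⟨q, hq, hqQ⟩ := exists_germ_eq Q
    rw [← hkH, ← hqQ, ← hfF, germX, ← germ_mul hq hf, ← germ_add (hq.fun_mul hf)
      (analyticAt_comp_fst (hr 0)), germ_eq_iff hk
      ((hq.fun_mul hf).fun_add (analyticAt_comp_fst (hr 0)))] at h
    rw [← hfF, ordAlong_germ hγa hγ0 hf, analyticOrderAt_eq_top] at hF
    rw [← hkH, ordAlong_germ hγa hγ0 hk]
    have h4 := analyticOrderAt_comp_of_deriv_ne_zero (f := r 0) hx hxd
    rw [hx0] at h4
    rw [← h4]
    apply analyticOrderAt_congr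
    filter_upwards [hF, (tendsto_of_analyticAt hγa hγ0).eventually h] with t h5 h6
    rw [h6, h5, mul_zero, zero_add]
    rfl
  rw [h2, h3]
  by_cases htop : analyticOrderAt (r 0) 0 = ⊤
  · rw [htop]
    rw [analyticOrderAt_eq_top, ← germX_eq_zero_iff (hr 0)] at htop
    rw [htop, inum_zero_right F (by rw [hX1]; simp)]
  · obtain ⟨s, hs, hs0, h⟩ := (hr 0).analyticOrderAt_ne_top.1 htop
    have h4 : germX (r 0) = cX ^ (analyticOrderNatAt (r 0) 0) * germX s := by
      rw [← germX_pow, ← germX_mul (by fun_prop) hs]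
      apply germX_congr
      filter_upwards [h] with t ht
      rw [ht, sub_zero, smul_eq_mul]
    have h5 : IsUnit (germX s) := by
      rwa [isUnit_iff_ev, germX, ev_germ (analyticAt_comp_fst hs)]
    rw [h4, inum_mul, inum_pow, hX1, mul_one, inum_eq_zero_of_isUnit h5, add_zero,
      Nat.cast_analyticOrderNatAt htop]

theorem ordAlong_swap {γ : ℂ → ℂ × ℂ} (hγ : AnalyticAt ℂ γ 0) (h0 : γ 0 = 0) (H : OO) :
    ordAlong (fun t => (γ t).swap) (swapEquiv H) = ordAlong γ H := by
  obtain ⟨k, hk, rfl⟩ := exists_germ_eq H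
  have hs : ∀ p, AnalyticAt ℂ (Prod.swap : ℂ × ℂ → ℂ × ℂ) p := fun p =>
    analyticAt_snd.prod analyticAt_fst
  have hsw : AnalyticAt ℂ (fun t => (γ t).swap) 0 := (hs _).comp hγ
  have hks : AnalyticAt ℂ (fun z : ℂ × ℂ => k z.swap) 0 :=
    AnalyticAt.comp (g := k) (f := Prod.swap) hk (hs 0)
  rw [swapEquiv_germ hk, ordAlong_germ hγ h0 hk, ordAlong_germ hsw (by rw [h0]; rfl) hks]
  simp

theorem IsRegularCurve.swap {γ : ℂ → ℂ × ℂ} (hγ : IsRegularCurve γ) :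
    IsRegularCurve fun t => (γ t).swap := by
  obtain ⟨hγa, hγ0, hγd⟩ := hγ
  have hs : ∀ p, AnalyticAt ℂ (Prod.swap : ℂ × ℂ → ℂ × ℂ) p := fun p =>
    analyticAt_snd.prod analyticAt_fst
  have hsw : AnalyticAt ℂ (fun t => (γ t).swap) 0 := (hs _).comp hγa
  refine ⟨hsw, by rw [hγ0]; rfl, fun h => hγd ?_⟩
  have h1 := deriv_fst hsw
  have h2 := deriv_snd hsw
  rw [h] at h1 h2
  exact Prod.ext ((deriv_fst hγa).symm.trans h2) ((deriv_snd hγa).symm.trans h1)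

/-- A germ of function is a submersion vanishing at the origin. -/
def IsSmoothGerm (F : OO) : Prop := ev F = 0 ∧ (ev (dX F) ≠ 0 ∨ ev (dY F) ≠ 0)

/-- A smooth curve has a regular parametrisation. -/
theorem IsSmoothGerm.exists_regularCurve (h : IsSmoothGerm F) :
    ∃ γ, IsRegularCurve γ ∧ ordAlong γ F = ⊤ := by
  obtain ⟨h0, hx | hy⟩ := h
  · obtain ⟨γ, hγ, hF⟩ := exists_regularCurve_aux (F := swapEquiv F) (by rwa [ev_swap])
      (by rwa [dY_swap, ev_swap])
    refine ⟨_, hγ.swap, ?_⟩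
    rw [← hF, ← ordAlong_swap hγ.swap.analyticAt hγ.swap.map_zero]
    simp
  · exact exists_regularCurve_aux h0 hy

/-- Intersection numbers with a smooth curve are orders along any regular parametrisation. -/
theorem IsSmoothGerm.inum_eq_ordAlong (h : IsSmoothGerm F) {γ : ℂ → ℂ × ℂ}
    (hγ : IsRegularCurve γ) (hF : ordAlong γ F = ⊤) (H : OO) : inum F H = ordAlong γ H := by
  obtain ⟨h0, hx | hy⟩ := h
  · have h1 := inum_eq_ordAlong_aux (F := swapEquiv F) (by rwa [ev_swap])
      (by rwa [dY_swap, ev_swap]) hγ.swap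
      (by rwa [ordAlong_swap hγ.analyticAt hγ.map_zero]) (swapEquiv H)
    rw [ordAlong_swap hγ.analyticAt hγ.map_zero, inum, codim_span_pair_equiv] at h1
    exact h1
  · exact inum_eq_ordAlong_aux h0 hy hγ hF H

theorem IsSmoothGerm.irreducible (h : IsSmoothGerm F) : Irreducible F := by
  obtain ⟨h0, hd⟩ := h
  rw [irreducible_iff]
  refine ⟨fun hu => isUnit_iff_ev.1 hu h0, fun a b hab => ?_⟩
  by_contra! hcon
  obtain ⟨ha, hb⟩ := hcon
  rw [isUnit_iff_ev, not_not] at ha hb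
  subst hab
  simp [ha, hb] at hd

theorem IsSmoothGerm.inum_zero (h : IsSmoothGerm F) : inum F 0 = ⊤ := by
  obtain ⟨γ, hγ, hF⟩ := h.exists_regularCurve
  rw [h.inum_eq_ordAlong hγ hF, ordAlong_zero hγ.analyticAt hγ.map_zero]

theorem IsSmoothGerm.dvd_iff (h : IsSmoothGerm F) {H : OO} : F ∣ H ↔ inum F H = ⊤ := by
  constructor
  · rintro ⟨k, rfl⟩
    rw [← h.inum_zero]
    exact inum_congr ⟨k, by ring⟩
  · intro h1
    by_contra h2
    exact inum_ne_top_of_not_dvd h.irreducible h2 h1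

end smooth

/-! ### The algebra of the equations of inflections and vertices -/

/-- The germ of `i_f` in terms of the germ of `f`. -/
def iO (F : OO) : OO :=
  dY F ^ 2 * dX (dX F) - 2 * dX F * dY F * dX (dY F) + dX F ^ 2 * dY (dY F)

/-- The germ of `v_f` in terms of the germ of `f`. -/
def vO (F : OO) : OO :=
  (dX F ^ 2 + dY F ^ 2)
      * (dX F ^ 3 * dY (dY (dY F)) - 3 * dX F ^ 2 * dY F * dX (dY (dY F))
        + 3 * dX F * dY F ^ 2 * dX (dX (dY F)) - dY F ^ 3 * dX (dX (dX F)))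
    - 3 * ((dX F ^ 2 - dY F ^ 2) * dX (dY F) - dX F * dY F * (dX (dX F) - dY (dY F))) * iO F

theorem germ_const_mul {f : ℂ × ℂ → ℂ} (c : ℂ) (hf : AnalyticAt ℂ f 0) :
    germ (fun z => c * f z) = algebraMap ℂ OO c * germ f := by
  rw [germ_mul analyticAt_const hf, germ_const]

section equation

variable {f : ℂ × ℂ → ℂ} {p : ℂ × ℂ}

theorem analyticAt_iEq (hf : AnalyticAt ℂ f p) : AnalyticAt ℂ (iEq f) p := by
  have h1 := analyticAt_dx hf
  have h2 := analyticAt_dy hf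
  have h3 := analyticAt_dx h1
  have h4 := analyticAt_dx h2
  have h5 := analyticAt_dy h2
  unfold iEq
  fun_prop

theorem analyticAt_vEq (hf : AnalyticAt ℂ f p) : AnalyticAt ℂ (vEq f) p := by
  have h0 := analyticAt_iEq hf
  have h1 := analyticAt_dx hf
  have h2 := analyticAt_dy hf
  have h3 := analyticAt_dx h1
  have h4 := analyticAt_dx h2
  have h5 := analyticAt_dy h2
  have h6 := analyticAt_dx h3
  have h7 := analyticAt_dx h4
  have h8 := analyticAt_dx h5
  have h9 := analyticAt_dy h5
  unfold vEq
  fun_prop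

theorem germ_iEq (hf : AnalyticAt ℂ f 0) : germ (iEq f) = iO (germ f) := by
  have h1 := analyticAt_dx hf
  have h2 := analyticAt_dy hf
  have h3 := analyticAt_dx h1
  have h4 := analyticAt_dx h2
  have h5 := analyticAt_dy h2
  rw [iO, dX_germ hf, dY_germ hf, dX_germ h1, dX_germ h2, dY_germ h2]
  unfold iEq
  rw [germ_add (by fun_prop) (by fun_prop), germ_sub (by fun_prop) (by fun_prop)]
  simp (disch := fun_prop) only [germ_mul, germ_pow, germ_const]
  rw [map_ofNat]

theorem germ_vEq (hf : AnalyticAt ℂ f 0) : germ (vEq f) = vO (germ f) := by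
  have h0 := analyticAt_iEq hf
  have h1 := analyticAt_dx hf
  have h2 := analyticAt_dy hf
  have h3 := analyticAt_dx h1
  have h4 := analyticAt_dx h2
  have h5 := analyticAt_dy h2
  have h6 := analyticAt_dx h3
  have h7 := analyticAt_dx h4
  have h8 := analyticAt_dx h5
  have h9 := analyticAt_dy h5
  rw [vO, ← germ_iEq hf, dX_germ hf, dY_germ hf, dX_germ h1, dX_germ h2, dY_germ h2, dX_germ h3,
    dX_germ h4, dX_germ h5, dY_germ h5]
  unfold vEq
  simp (disch := fun_prop) only [germ_mul, germ_pow, germ_const, germ_add, germ_sub]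
  rw [map_ofNat]

theorem inflEq_eq_inum (hf : AnalyticAt ℂ f 0) :
    inflEq f 0 = inum (germ f) (iO (germ f)) := by
  rw [inflEq, intersectionNumber_eq_inum, germ_iEq hf]

theorem vertEq_eq_inum (hf : AnalyticAt ℂ f 0) :
    vertEq f 0 = inum (germ f) (vO (germ f)) := by
  rw [vertEq, intersectionNumber_eq_inum, germ_vEq hf]

end equation

/-! ### Products of equations and multiplication by units -/

section product

/-- Modulo F, only those terms of the Leibniz rule survive in which at least one derivative falls on
F. Substituted into i and v, all derivatives of a cancel and only the powers 3 and 6 of a remain. -/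
theorem dvd_iO_vO_mul_sub (a F : OO) :
    F ∣ iO (a * F) - a ^ 3 * iO F ∧ F ∣ vO (a * F) - a ^ 6 * vO F := by
  set π := Ideal.Quotient.mk (Ideal.span {F}) with hπ
  have h0 : π F = 0 := Ideal.Quotient.eq_zero_iff_mem.2 (Ideal.mem_span_singleton_self F)
  have hdvd : ∀ G, F ∣ G ↔ π G = 0 := fun G => by
    rw [hπ, Ideal.Quotient.eq_zero_iff_mem, Ideal.mem_span_singleton]
  have e1 : ∀ v, π (dGerm v (a * F)) = π a * π (dGerm v F) := fun v => by
    simp [Derivation.leibniz, h0]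
  have e2 : ∀ v w, π (dGerm v (dGerm w (a * F))) =
      π a * π (dGerm v (dGerm w F)) + π (dGerm v a) * π (dGerm w F)
        + π (dGerm w a) * π (dGerm v F) := fun v w => by
    simp [Derivation.leibniz, h0]; ring
  have e3 : ∀ u v w, π (dGerm u (dGerm v (dGerm w (a * F)))) =
      π a * π (dGerm u (dGerm v (dGerm w F))) + π (dGerm u a) * π (dGerm v (dGerm w F))
        + π (dGerm v a) * π (dGerm u (dGerm w F)) + π (dGerm w a) * π (dGerm u (dGerm v F))
        + π (dGerm u (dGerm v a)) * π (dGerm w F) + π (dGerm u (dGerm w a)) * π (dGerm v F)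
        + π (dGerm v (dGerm w a)) * π (dGerm u F) := fun u v w => by
    simp [Derivation.leibniz, h0]; ring
  have hi : π (iO (a * F)) = π a ^ 3 * π (iO F) := by
    simp only [iO, map_add, map_sub, map_mul, map_pow, map_ofNat, e1, e2]
    ring
  constructor
  · rw [hdvd, map_sub, hi]
    simp
  · rw [hdvd, map_sub]
    simp only [vO, map_add, map_sub, map_mul, map_pow, map_ofNat, hi, e1, e2, e3]
    simp only [iO, map_add, map_sub, map_mul, map_pow, map_ofNat]
    ring

theorem inum_iO_unit_mul {a : OO} (ha : IsUnit a) (F : OO) :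
    inum (a * F) (iO (a * F)) = inum F (iO F) := by
  rw [← one_mul (iO (a * F)), inum_unit_mul ha isUnit_one, inum_congr (dvd_iO_vO_mul_sub a F).1,
    inum_mul, inum_pow, inum_eq_zero_of_isUnit ha]
  simp

theorem inum_vO_unit_mul {a : OO} (ha : IsUnit a) (F : OO) :
    inum (a * F) (vO (a * F)) = inum F (vO F) := by
  rw [← one_mul (vO (a * F)), inum_unit_mul ha isUnit_one, inum_congr (dvd_iO_vO_mul_sub a F).2,
    inum_mul, inum_pow, inum_eq_zero_of_isUnit ha]
  simp

/-- Additivity splits the left side into intersection numbers with G and with H. On G the germ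
i_{GH} is H³ i_G, and symmetrically on H, so each side contributes 3 · m(G, H). -/
theorem inum_iO_mul (G H : OO) :
    inum (G * H) (iO (G * H)) = inum G (iO G) + inum H (iO H) + 6 * inum G H := by
  have h1 := dvd_iO_vO_mul_sub H G
  rw [mul_comm H G] at h1
  rw [inum_comm, inum_mul, inum_comm _ G, inum_comm _ H, inum_congr h1.1,
    inum_congr (dvd_iO_vO_mul_sub G H).1, inum_mul, inum_mul, inum_pow, inum_pow, inum_comm H G,
    show (6 : ℕ∞) = 3 + 3 by norm_num, add_mul]
  push_cast
  ac_rfl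

theorem inum_vO_mul (G H : OO) :
    inum (G * H) (vO (G * H)) = inum G (vO G) + inum H (vO H) + 12 * inum G H := by
  have h1 := dvd_iO_vO_mul_sub H G
  rw [mul_comm H G] at h1
  rw [inum_comm, inum_mul, inum_comm _ G, inum_comm _ H, inum_congr h1.2,
    inum_congr (dvd_iO_vO_mul_sub G H).2, inum_mul, inum_mul, inum_pow, inum_pow, inum_comm H G,
    show (12 : ℕ∞) = 6 + 6 by norm_num, add_mul]
  push_cast
  ac_rfl

theorem inum_ne_top_of_squarefree_mul {G H : OO} (h : Squarefree (G * H)) : inum G H ≠ ⊤ := by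
  intro htop
  obtain ⟨d, hd, hG, hH⟩ := exists_common_divisor htop
  exact hd (h d (mul_dvd_mul hG hH))

end product

/-! ### The derivation along the curve -/

/-- The hamiltonian derivation `f_y ∂/∂x - f_x ∂/∂y`. -/
def hamD (F : OO) : Derivation ℂ OO OO := dY F • dX - dX F • dY

theorem hamD_apply (F G : OO) : hamD F G = dY F * dX G - dX F * dY G := rfl

theorem hamD_self (F : OO) : hamD F F = 0 := by rw [hamD_apply]; ring

theorem hamD_cX (F : OO) : hamD F cX = dY F := by simp [hamD_apply, dX_cX, dY_cX]

theorem hamD_cY (F : OO) : hamD F cY = -dX F := by simp [hamD_apply, dX_cY, dY_cY]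

theorem hamD_dvd {F G : OO} (h : F ∣ G) : F ∣ hamD F G := by
  obtain ⟨k, rfl⟩ := h
  rw [Derivation.leibniz, hamD_self, smul_zero, add_zero]
  exact ⟨_, rfl⟩

/-- The hamiltonian field (X, Y) = (F_y, -F_x) is tangent to the level curves of F, and i_F is -(X
DY - Y DX), the numerator of their curvature up to sign. The vertex equation follows by one further
application of D. -/
theorem iO_eq_hamD (F : OO) :
    iO F = dX F * -hamD F (dY F) - dY F * -hamD F (dX F) := by
  simp only [iO, hamD_apply, ← dX_dY_comm]
  ring

theorem vO_eq_hamD (F : OO) :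
    vO F = 3 * (dY F * hamD F (dY F) + dX F * hamD F (dX F)) * iO F
      - (dX F ^ 2 + dY F ^ 2) * hamD F (iO F) := by
  simp only [vO, iO, hamD_apply, map_add, map_sub, Derivation.leibniz, smul_eq_mul, pow_two,
    two_mul, ← dX_dY_comm]
  ring

/-! ### Constants of the derivation along the curve -/

/-- Two functions of one variable with vanishing Wronskian are proportional. -/
theorem eventually_eq_const_mul {q r : ℂ → ℂ} (hq : AnalyticAt ℂ q 0) (hr : AnalyticAt ℂ r 0)
    (hq0 : ¬ ∀ᶠ t in 𝓝 (0 : ℂ), q t = 0)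
    (h : ∀ᶠ t in 𝓝 (0 : ℂ), q t * deriv r t = deriv q t * r t) :
    ∃ c, ∀ᶠ t in 𝓝 (0 : ℂ), r t = c * q t := by
  obtain ⟨ε, hε, hball⟩ := Metric.eventually_nhds_iff_ball.1
    (h.and (hq.eventually_analyticAt.and hr.eventually_analyticAt))
  obtain ⟨t₀, ht₀, hqt₀⟩ : ∃ t₀ ∈ Metric.ball (0 : ℂ) ε, q t₀ ≠ 0 := by
    by_contra! hcon
    exact hq0 (Metric.eventually_nhds_iff_ball.2 ⟨ε, hε, hcon⟩)
  have hnhd : ∀ᶠ t in 𝓝 t₀, t ∈ Metric.ball (0 : ℂ) ε ∧ q t ≠ 0 :=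
    (Metric.isOpen_ball.eventually_mem ht₀).and
      ((hball t₀ ht₀).2.1.continuousAt.eventually_ne hqt₀)
  obtain ⟨δ, hδ, hδ'⟩ := Metric.eventually_nhds_iff_ball.1 hnhd
  have hconst : ∀ t ∈ Metric.ball t₀ δ, r t / q t = r t₀ / q t₀ := by
    intro t ht
    refine (Metric.isOpen_ball (x := t₀) (ε := δ)).is_const_of_deriv_eq_zero
      (f := fun t => r t / q t) (convex_ball t₀ δ).isPreconnected ?_ ?_ ht
      (Metric.mem_ball_self hδ)
    · intro s hs
      obtain ⟨h1, h2⟩ := hδ' s hs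
      exact ((hball s h1).2.2.differentiableAt.fun_div (hball s h1).2.1.differentiableAt
        h2).differentiableWithinAt
    · intro s hs
      obtain ⟨h1, h2⟩ := hδ' s hs
      obtain ⟨h3, h4, h5⟩ := hball s h1
      change deriv (fun t => r t / q t) s = 0
      rw [deriv_fun_div h5.differentiableAt h4.differentiableAt h2]
      rw [div_eq_zero_iff]
      left
      linear_combination h3
  set c := r t₀ / q t₀
  refine ⟨c, ?_⟩
  -- The quotient r/q is constant near a point where q ≠ 0; the identity theorem carries the
  -- relation back to the origin, where q may vanish.
  have key : Set.EqOn (fun t => r t - c * q t) 0 (Metric.ball (0 : ℂ) ε) := by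
    refine AnalyticOnNhd.eqOn_zero_of_preconnected_of_eventuallyEq_zero (𝕜 := ℂ) ?_
      (convex_ball (0 : ℂ) ε).isPreconnected ht₀ ?_
    · intro t ht
      exact (hball t ht).2.2.fun_sub (analyticAt_const.fun_mul (hball t ht).2.1)
    · filter_upwards [Metric.ball_mem_nhds t₀ hδ] with t ht
      have h1 := hconst t ht
      have h2 := (hδ' t ht).2
      rw [div_eq_iff h2] at h1
      simp [h1]
  exact Metric.eventually_nhds_iff_ball.2 ⟨ε, hε, fun t ht => sub_eq_zero.1 (key ht)⟩

theorem exists_eq_smul_of_wronskian_RX {p q : OO} (hp : p ∈ RX) (hq : q ∈ RX) (hq0 : q ≠ 0)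
    (h : q * dX p = dX q * p) : ∃ c : ℂ, p = c • q := by
  obtain ⟨p, hp, rfl⟩ := hp
  obtain ⟨q, hq, rfl⟩ := hq
  have hp' : AnalyticAt ℂ (deriv p) 0 := hp.deriv
  have hq' : AnalyticAt ℂ (deriv q) 0 := hq.deriv
  rw [dX_germX hp, dX_germX hq, ← germX_mul hq hp', ← germX_mul hq' hp, ← sub_eq_zero, germX,
    germX, ← germ_sub (analyticAt_comp_fst (hq.fun_mul hp'))
      (analyticAt_comp_fst (hq'.fun_mul hp))] at h
  have h1 := (germX_eq_zero_iff (r := fun t => q t * deriv p t - deriv q t * p t)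
    ((hq.fun_mul hp').fun_sub (hq'.fun_mul hp))).1 h
  rw [Ne, germX_eq_zero_iff hq] at hq0
  obtain ⟨c, hc⟩ := eventually_eq_const_mul hq hp hq0 (h1.mono fun t ht => sub_eq_zero.1 ht)
  refine ⟨c, ?_⟩
  rw [Algebra.smul_def, ← germX_const, ← germX_mul analyticAt_const hq]
  exact germX_congr hc

theorem dY_of_mem_RX {p : OO} (hp : p ∈ RX) : dY p = 0 := by
  obtain ⟨p, hp, rfl⟩ := hp
  exact dY_germX hp

theorem dX_mem_RX {p : OO} (hp : p ∈ RX) : dX p ∈ RX := by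
  obtain ⟨p, hp, rfl⟩ := hp
  rw [dX_germX hp]
  exact germX_mem_RX hp.deriv

section kernel

variable {g : OO}

theorem not_dvd_cX (hg : Prime g) (hX : ¬ cX ∣ g) : ¬ g ∣ cX := fun h =>
  hX ((hg.irreducible.dvd_comm cX_prime.irreducible).1 h)

theorem not_dvd_of_mem_RX (hg : Prime g) (hX : ¬ cX ∣ g) {p : OO} (hp : p ∈ RX) (h0 : p ≠ 0) :
    ¬ g ∣ p := by
  intro h
  obtain ⟨N, u, hu, rfl⟩ := exists_eq_cX_pow_mul_unit hp h0
  rw [hu.dvd_mul_right] at h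
  exact not_dvd_cX hg hX (hg.dvd_of_dvd_pow h)

/-- Differentiation in y lowers the finite, positive y-order of g by exactly one, whereas a multiple
of g has at least that order. -/
theorem not_dvd_dY (hg : ¬ IsUnit g) (hX : ¬ cX ∣ g) : ¬ g ∣ dY g := by
  rintro ⟨k, hk⟩
  rw [isUnit_iff_ev, not_not] at hg
  have h1 := yord_dY_add_one hg
  rw [hk, yord_mul, add_assoc] at h1
  rw [cX_dvd_iff] at hX
  obtain ⟨n, hn⟩ := ENat.ne_top_iff_exists.1 hX
  rw [← hn] at h1
  have h2 : yord k + 1 = 0 :=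
    (ENat.addLECancellable_of_ne_top (ENat.natCast_ne_top n)).inj.1 (h1.trans (add_zero _).symm)
  simp at h2

/-- An algebraic relation of degree `d` over the functions of the first variable between two
germs on the curve. -/
def HasRelation (g a b : OO) (d : ℕ) : Prop :=
  ∃ p : ℕ → OO, (∀ i, p i ∈ RX) ∧ p d ≠ 0 ∧
    g ∣ ∑ i ∈ Finset.range (d + 1), p i * (a ^ i * b ^ (d - i))

/-- Some power x ^ N is congruent to αb modulo g, so a/b = aα / x ^ N on the curve, and aα is
integral over `RX`. Clearing denominators in its monic equation produces the coefficients containing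
cX ^ (N * i). -/
theorem exists_hasRelation (hg : Prime g) (hX : ¬ cX ∣ g) (a : OO) {b : OO} (hb : ¬ g ∣ b) :
    ∃ d, HasRelation g a b d := by
  obtain ⟨N, hN, -⟩ := exists_cX_cY_pow_mem (inum_ne_top_of_not_dvd hg.irreducible hb)
  obtain ⟨β, α, hαβ⟩ := Ideal.mem_span_pair.1 hN
  have := finite_RX_quotient hX
  set π := Ideal.Quotient.mk (Ideal.span {g}) with hπ
  obtain ⟨P, hPm, hP⟩ := IsIntegral.of_finite RX (π (a * α))
  refine ⟨P.natDegree, fun i => (P.coeff i : OO) * cX ^ (N * i), fun i => ?_, ?_, ?_⟩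
  · exact RX.mul_mem (P.coeff i).2 (germX_pow (N * i) ▸ germX_mem_RX (by fun_prop))
  · change (P.coeff P.natDegree : OO) * _ ≠ 0
    rw [hPm.coeff_natDegree]
    rw [OneMemClass.coe_one, one_mul]
    exact pow_ne_zero _ cX_prime.ne_zero
  · rw [← Ideal.mem_span_singleton, ← Ideal.Quotient.eq_zero_iff_mem, ← hπ]
    have h0 : π g = 0 := Ideal.Quotient.eq_zero_iff_mem.2 (Ideal.mem_span_singleton_self g)
    have h1 : π cX ^ N = π α * π b := by
      rw [← map_pow, ← hαβ]
      simp [h0]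
    rw [Polynomial.eval₂_eq_sum_range] at hP
    have h2 := congrArg (fun z => z * π b ^ P.natDegree) hP
    simp only [zero_mul, Finset.sum_mul] at h2
    rw [map_sum, ← h2]
    refine Finset.sum_congr rfl fun i hi => ?_
    have h3 : algebraMap RX (OO ⧸ Ideal.span {g}) (P.coeff i) = π (P.coeff i : OO) := rfl
    have h4 : π b ^ P.natDegree = π b ^ i * π b ^ (P.natDegree - i) := by
      rw [← pow_add, Nat.add_sub_cancel' (Finset.mem_range_succ_iff.1 hi)]
    rw [h3, h4]
    simp only [map_mul, map_pow, pow_mul, h1, mul_pow]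
    ring

/-- Vanishing top coefficients are dropped and the common power of b is cancelled, which primeness
of g allows. This turns a relation without its top term into one of smaller degree. -/
theorem hasRelation_of_lt {a b : OO} {d : ℕ} (hg : Prime g) (hb : ¬ g ∣ b) {q : ℕ → OO}
    (hq : ∀ i, q i ∈ RX) (h : g ∣ ∑ i ∈ Finset.range d, q i * (a ^ i * b ^ (d - i)))
    (hne : ∃ i < d, q i ≠ 0) : ∃ e < d, HasRelation g a b e := by
  classical
  obtain ⟨i₀, hi₀, hqi₀⟩ := hne
  set e := Nat.findGreatest (fun i => i < d ∧ q i ≠ 0) d with he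
  obtain ⟨hed, hqe⟩ : e < d ∧ q e ≠ 0 :=
    Nat.findGreatest_spec (P := fun i => i < d ∧ q i ≠ 0) hi₀.le ⟨hi₀, hqi₀⟩
  refine ⟨e, hed, q, hq, hqe, ?_⟩
  have h1 : ∑ i ∈ Finset.range d, q i * (a ^ i * b ^ (d - i))
      = ∑ i ∈ Finset.range (e + 1), q i * (a ^ i * b ^ (d - i)) := by
    symm
    refine Finset.sum_subset (Finset.range_mono hed) fun i hi hi' => ?_
    rw [Finset.mem_range] at hi hi'
    have h2 := Nat.findGreatest_is_greatest (P := fun i => i < d ∧ q i ≠ 0) (n := d) (k := i)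
      (by omega) hi.le
    rw [not_and, not_not] at h2
    rw [h2 hi, zero_mul]
  have h2 : ∑ i ∈ Finset.range (e + 1), q i * (a ^ i * b ^ (d - i))
      = b ^ (d - e) * ∑ i ∈ Finset.range (e + 1), q i * (a ^ i * b ^ (e - i)) := by
    rw [Finset.mul_sum]
    refine Finset.sum_congr rfl fun i hi => ?_
    have : d - i = (d - e) + (e - i) := by
      have := Finset.mem_range_succ_iff.1 hi
      omega
    rw [this, pow_add]
    ring
  rw [h1, h2] at h
  exact (hg.dvd_or_dvd h).resolve_left fun h3 => hb (hg.dvd_of_dvd_pow h3)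

/-- Since D(a/b) = 0 on the curve, b D(a^i b^k) ≡ (i + k) a^i b^k D(b). Applying bD to the
homogeneous relation thus differentiates only the coefficients, up to a multiple of the relation
itself, and D = g_y d/dx on `RX`. Neither b nor g_y is divisible by g, so both cancel. -/
theorem dvd_sum_dX {a b : OO} (hg : Prime g) (hX : ¬ cX ∣ g) (hb : ¬ g ∣ b)
    (hab : g ∣ b * hamD g a - a * hamD g b) {d : ℕ} {p : ℕ → OO} (hp : ∀ i, p i ∈ RX)
    (h : g ∣ ∑ i ∈ Finset.range (d + 1), p i * (a ^ i * b ^ (d - i))) :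
    g ∣ ∑ i ∈ Finset.range (d + 1), dX (p i) * (a ^ i * b ^ (d - i)) := by
  have hD : ∀ i k, g ∣ b * hamD g (a ^ i * b ^ k) - (i + k : ℕ) * (a ^ i * b ^ k) * hamD g b := by
    intro i k
    rw [← Ideal.mem_span_singleton, ← Ideal.Quotient.eq_zero_iff_mem] at hab ⊢
    simp only [map_sub, map_mul, sub_eq_zero] at hab
    rw [map_sub, sub_eq_zero]
    rcases i with _ | i <;> rcases k with _ | k
    · simp
    · simp [Derivation.leibniz_pow]
      ring
    · simp [Derivation.leibniz_pow]
      linear_combination ((i : OO ⧸ Ideal.span {g}) + 1) * (Ideal.Quotient.mk _ a) ^ i * hab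
    · simp [Derivation.leibniz_pow, Derivation.leibniz]
      linear_combination ((i : OO ⧸ Ideal.span {g}) + 1) * (Ideal.Quotient.mk _ a) ^ i
        * (Ideal.Quotient.mk _ b) ^ (k + 1) * hab
  set T := ∑ i ∈ Finset.range (d + 1), p i * (a ^ i * b ^ (d - i)) with hT
  have h1 : b * hamD g T - b * dY g * ∑ i ∈ Finset.range (d + 1), dX (p i) * (a ^ i * b ^ (d - i))
      - d * hamD g b * T = ∑ i ∈ Finset.range (d + 1),
        p i * (b * hamD g (a ^ i * b ^ (d - i)) - (i + (d - i) : ℕ) * (a ^ i * b ^ (d - i)) * hamD g b) := by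
    rw [hT, map_sum, Finset.mul_sum, Finset.mul_sum, Finset.mul_sum, ← Finset.sum_sub_distrib,
      ← Finset.sum_sub_distrib]
    refine Finset.sum_congr rfl fun i hi => ?_
    rw [Nat.add_sub_cancel' (Finset.mem_range_succ_iff.1 hi), Derivation.leibniz,
      hamD_apply g (p i), dY_of_mem_RX (hp i), smul_eq_mul, smul_eq_mul]
    ring
  have h2 : g ∣ ∑ i ∈ Finset.range (d + 1),
        p i * (b * hamD g (a ^ i * b ^ (d - i)) - (i + (d - i) : ℕ) * (a ^ i * b ^ (d - i)) * hamD g b) :=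
    Finset.dvd_sum fun i _ => (hD i (d - i)).mul_left _
  rw [← h1] at h2
  have h3 := dvd_sub ((hamD_dvd h).mul_left b) (h2.add (h.mul_left (d * hamD g b)))
  have h4 : g ∣ b * dY g * ∑ i ∈ Finset.range (d + 1), dX (p i) * (a ^ i * b ^ (d - i)) := by
    convert h3 using 1
    ring
  refine (hg.dvd_or_dvd h4).resolve_left fun h5 => ?_
  exact (hg.dvd_or_dvd h5).elim hb (not_dvd_dY hg.not_isUnit hX)

/-- In the fraction field of O/(g) the quotient a/b is a root of a non-zero complex polynomial,
hence a complex number. -/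
theorem exists_dvd_sub_smul_of_relation {a b : OO} (hg : Prime g) (hb : ¬ g ∣ b) {d : ℕ}
    {c : ℕ → ℂ} (hc : c d ≠ 0)
    (h : g ∣ ∑ i ∈ Finset.range (d + 1), c i • (a ^ i * b ^ (d - i))) :
    ∃ r : ℂ, g ∣ a - r • b := by
  have : (Ideal.span {g}).IsPrime := (Ideal.span_singleton_prime hg.ne_zero).2 hg
  set A := OO ⧸ Ideal.span {g}
  let K := FractionRing A
  let π : OO →ₐ[ℂ] K := (IsScalarTower.toAlgHom ℂ A K).comp (Ideal.Quotient.mkₐ ℂ _)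
  have hdvd : ∀ G, g ∣ G ↔ π G = 0 := fun G => by
    rw [← Ideal.mem_span_singleton, ← Ideal.Quotient.eq_zero_iff_mem]
    exact (map_eq_zero_iff _ (IsFractionRing.injective A K)).symm
  have hb0 : π b ≠ 0 := fun h => hb ((hdvd b).2 h)
  rw [hdvd, map_sum] at h
  let P : Polynomial ℂ := ∑ i ∈ Finset.range (d + 1), Polynomial.monomial i (c i)
  have hP0 : P ≠ 0 := fun h0 => hc (by
    have := congrArg (Polynomial.coeff · d) h0
    simpa [P, Polynomial.finsetSum_coeff, Polynomial.coeff_monomial] using this)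
  have hPs : Polynomial.aeval (π a / π b) P = 0 := by
    have h1 : Polynomial.aeval (π a / π b) P * π b ^ d = 0 := by
      rw [← h]
      simp only [P, map_sum, Polynomial.aeval_monomial]
      rw [Finset.sum_mul]
      refine Finset.sum_congr rfl fun i hi => ?_
      have h4 : π b ^ d = π b ^ i * π b ^ (d - i) := by
        rw [← pow_add, Nat.add_sub_cancel' (Finset.mem_range_succ_iff.1 hi)]
      rw [map_smul, Algebra.smul_def, map_mul, map_pow, map_pow, h4, div_pow, mul_assoc,
        ← mul_assoc (_ / _), div_mul_cancel₀ _ (pow_ne_zero i hb0)]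
    exact (mul_eq_zero.1 h1).resolve_right (pow_ne_zero _ hb0)
  have hint : IsIntegral ℂ (π a / π b) := IsAlgebraic.isIntegral ⟨P, hP0, hPs⟩
  obtain ⟨r, hr⟩ := minpoly.mem_range_of_degree_eq_one ℂ (π a / π b)
    (IsAlgClosed.degree_eq_one_of_irreducible ℂ (minpoly.irreducible hint))
  refine ⟨r, (hdvd _).2 ?_⟩
  rw [map_sub, map_smul, Algebra.smul_def, hr, div_mul_cancel₀ _ hb0, sub_self]

/-- Germs on an irreducible curve with vanishing Wronskian are proportional. -/
theorem exists_dvd_sub_smul {a b : OO} (hg : Prime g) (hX : ¬ cX ∣ g) (hb : ¬ g ∣ b)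
    (hab : g ∣ b * hamD g a - a * hamD g b) : ∃ r : ℂ, g ∣ a - r • b := by
  classical
  -- Take a relation of least degree d. Combining it with its derivative eliminates the top term, so
  -- by minimality the Wronskians of p_i and p_d vanish. Hence p_i = c_i p_d with c_i ∈ ℂ, and a/b
  -- is algebraic over ℂ.
  have hex := exists_hasRelation hg hX a hb
  set d := Nat.find hex
  obtain ⟨p, hp, hpd, hT⟩ : HasRelation g a b d := Nat.find_spec hex
  have hU := dvd_sum_dX hg hX hb hab hp hT
  have hq : ∀ i < d, p d * dX (p i) - dX (p d) * p i = 0 := by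
    by_contra! hcon
    obtain ⟨e, hed, he⟩ := hasRelation_of_lt (a := a) (b := b) (d := d)
      (q := fun i => p d * dX (p i) - dX (p d) * p i) hg hb
      (fun i => RX.sub_mem (RX.mul_mem (hp d) (dX_mem_RX (hp i)))
        (RX.mul_mem (dX_mem_RX (hp d)) (hp i))) (by
        have h1 := dvd_sub (hU.mul_left (p d)) (hT.mul_left (dX (p d)))
        convert h1 using 1
        rw [Finset.sum_range_succ, Finset.sum_range_succ, mul_add, mul_add, Finset.mul_sum,
          Finset.mul_sum, add_sub_add_comm, ← Finset.sum_sub_distrib]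
        rw [show p d * (dX (p d) * (a ^ d * b ^ (d - d))) - dX (p d) * (p d * (a ^ d * b ^ (d - d)))
          = 0 by ring, add_zero]
        exact Finset.sum_congr rfl fun i _ => by ring) hcon
    exact Nat.find_min hex hed he
  have hc : ∀ i, ∃ c : ℂ, i ≤ d → p i = c • p d := by
    intro i
    rcases lt_trichotomy i d with h | h | h
    · obtain ⟨c, hc⟩ := exists_eq_smul_of_wronskian_RX (hp i) (hp d) hpd (sub_eq_zero.1 (hq i h))
      exact ⟨c, fun _ => hc⟩
    · exact ⟨1, fun _ => by rw [h, one_smul]⟩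
    · exact ⟨0, fun h' => absurd h' (by omega)⟩
  choose c hc using hc
  refine exists_dvd_sub_smul_of_relation (d := d) (c := c) hg hb ?_ ?_
  · intro h0
    have := hc d le_rfl
    rw [h0, zero_smul] at this
    exact hpd this
  · have h1 : ∑ i ∈ Finset.range (d + 1), p i * (a ^ i * b ^ (d - i))
        = p d * ∑ i ∈ Finset.range (d + 1), c i • (a ^ i * b ^ (d - i)) := by
      rw [Finset.mul_sum]
      refine Finset.sum_congr rfl fun i hi => ?_
      rw [hc i (Finset.mem_range_succ_iff.1 hi), smul_mul_assoc, mul_smul_comm]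
    rw [h1] at hT
    exact (hg.dvd_or_dvd hT).resolve_left (not_dvd_of_mem_RX hg hX (hp d) hpd)

end kernel

/-! ### Circles and lines contained in a curve given by an equation -/

namespace CircleOrLine

variable (c : CircleOrLine)

/-- The germ of the equation of a circle or line. -/
def germEqn : OO := c.A • (cX ^ 2 + cY ^ 2) + (2 * c.B) • cX + (2 * c.C) • cY

theorem analyticAt_eqn (p : ℂ × ℂ) : AnalyticAt ℂ c.eqn p := by
  have h1 : AnalyticAt ℂ (fun z : ℂ × ℂ => z.1) p := analyticAt_fst
  have h2 : AnalyticAt ℂ (fun z : ℂ × ℂ => z.2) p := analyticAt_snd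
  unfold eqn
  fun_prop

theorem germ_eqn : germ c.eqn = c.germEqn := by
  have h1 : AnalyticAt ℂ (fun z : ℂ × ℂ => z.1) 0 := analyticAt_fst
  have h2 : AnalyticAt ℂ (fun z : ℂ × ℂ => z.2) 0 := analyticAt_snd
  unfold eqn
  simp (disch := fun_prop) only [germ_add, germ_mul, germ_pow, germ_const]
  simp only [germEqn, Algebra.smul_def, map_mul]
  rfl

theorem dX_germEqn : dX c.germEqn = (2 * c.A) • cX + (2 * c.B) • 1 := by
  simp [germEqn, dX_cX, dX_cY, Derivation.leibniz_pow, Algebra.smul_def]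
  rw [map_ofNat]
  ring

theorem dY_germEqn : dY c.germEqn = (2 * c.A) • cY + (2 * c.C) • 1 := by
  simp [germEqn, dY_cX, dY_cY, Derivation.leibniz_pow, Algebra.smul_def]
  rw [map_ofNat]
  ring

theorem ev_germEqn : ev c.germEqn = 0 := by
  simp [germEqn, ev_cX, ev_cY]

theorem isSmoothGerm_germEqn (h : c.B ≠ 0 ∨ c.C ≠ 0) : IsSmoothGerm c.germEqn := by
  refine ⟨c.ev_germEqn, ?_⟩
  rw [dX_germEqn, dY_germEqn]
  simpa [ev_cX, ev_cY] using h

theorem second_derivatives : dX (dX c.germEqn) = (2 * c.A) • 1 ∧ dX (dY c.germEqn) = 0 ∧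
    dY (dY c.germEqn) = (2 * c.A) • 1 := by
  simp [dX_germEqn, dY_germEqn, dX_cX, dX_cY, dY_cY]

theorem iO_germEqn (h : c.IsLine) : iO c.germEqn = 0 := by
  obtain ⟨h1, h2, h3⟩ := c.second_derivatives
  rw [iO, h1, h2, h3, show c.A = 0 from h]
  simp

theorem vO_germEqn : vO c.germEqn = 0 := by
  obtain ⟨h1, h2, h3⟩ := c.second_derivatives
  rw [vO, h1, h2, h3]
  simp

/-- The only members singular at the origin are A(x² + y²) = 0, pairs of isotropic lines. Replacing
such a pair by the line x + Iy = 0 allows the circle to be assumed smooth at the origin. -/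
theorem exists_isLine_of_eq_zero (hB : c.B = 0) (hC : c.C = 0) :
    ∃ c' : CircleOrLine, c'.IsLine ∧ (c'.B ≠ 0 ∨ c'.C ≠ 0) ∧ c'.carrier ⊆ c.carrier := by
  refine ⟨⟨0, 1, Complex.I, by simp⟩, rfl, by simp, fun z hz => ?_⟩
  simp only [carrier, eqn, Set.mem_ofPred_eq] at hz ⊢
  rw [hB, hC]
  linear_combination c.A / 2 * (z.1 - Complex.I * z.2) * hz
    + c.A * z.2 ^ 2 * Complex.I_sq

theorem IsLine.ne_zero {c : CircleOrLine} (h : c.IsLine) : c.B ≠ 0 ∨ c.C ≠ 0 := by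
  by_contra! hcon
  exact c.nonzero (by rw [show c.A = 0 from h, hcon.1, hcon.2]; rfl)

/-- A germ of curve contains a smooth circle or line if and only if the equation of the latter
divides its equation. -/
theorem germEqn_dvd_iff (h : c.B ≠ 0 ∨ c.C ≠ 0) {f : ℂ × ℂ → ℂ} (hf : AnalyticAt ℂ f 0) :
    c.germEqn ∣ germ f ↔ EqContains f c.carrier := by
  constructor
  · rintro ⟨K, hK⟩
    obtain ⟨k, hk, rfl⟩ := exists_germ_eq K
    rw [← germ_eqn, ← germ_mul (c.analyticAt_eqn 0) hk,
      germ_eq_iff hf ((c.analyticAt_eqn 0).fun_mul hk)] at hK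
    rw [EqContains, eventually_nhdsWithin_iff]
    filter_upwards [hK] with z hz hzc
    rw [hz, show c.eqn z = 0 from hzc, zero_mul]
  · intro hE
    have hs := c.isSmoothGerm_germEqn h
    obtain ⟨γ, hγ, hF⟩ := hs.exists_regularCurve
    rw [hs.dvd_iff, hs.inum_eq_ordAlong hγ hF, ordAlong_germ hγ.analyticAt hγ.map_zero hf,
      analyticOrderAt_eq_top]
    rw [← germ_eqn, ordAlong_germ hγ.analyticAt hγ.map_zero (c.analyticAt_eqn 0),
      analyticOrderAt_eq_top] at hF
    rw [EqContains, eventually_nhdsWithin_iff] at hE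
    filter_upwards [hF, (tendsto_of_analyticAt hγ.analyticAt hγ.map_zero).eventually hE]
      with t h1 h2 using h2 h1

end CircleOrLine

theorem inum_eq_top_of_dvd {C F H : OO} (hC : IsSmoothGerm C) (h1 : C ∣ F) (h2 : C ∣ H) :
    inum F H = ⊤ := by
  rw [eq_top_iff, ← hC.inum_zero]
  apply codim_anti
  rw [Ideal.span_le]
  rintro z (rfl | rfl)
  · obtain ⟨k, rfl⟩ := h1
    exact Ideal.mul_mem_right _ _ (Ideal.subset_span (by simp))
  · obtain ⟨k, rfl⟩ := h2
    exact Ideal.mul_mem_right _ _ (Ideal.subset_span (by simp))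

theorem inum_iO_eq_top_of_dvd {c : CircleOrLine} (hc : c.IsLine) {F : OO} (h : c.germEqn ∣ F) :
    inum F (iO F) = ⊤ := by
  refine inum_eq_top_of_dvd (c.isSmoothGerm_germEqn hc.ne_zero) h ?_
  obtain ⟨k, rfl⟩ := h
  have h1 := (dvd_iO_vO_mul_sub k c.germEqn).1
  rwa [c.iO_germEqn hc, mul_zero, sub_zero, mul_comm] at h1

theorem inum_vO_eq_top_of_dvd {c : CircleOrLine} (hc : c.B ≠ 0 ∨ c.C ≠ 0) {F : OO}
    (h : c.germEqn ∣ F) : inum F (vO F) = ⊤ := by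
  refine inum_eq_top_of_dvd (c.isSmoothGerm_germEqn hc) h ?_
  obtain ⟨k, rfl⟩ := h
  have h1 := (dvd_iO_vO_mul_sub k c.germEqn).2
  rwa [c.vO_germEqn, mul_zero, sub_zero, mul_comm] at h1

/-! ### Irreducible curves on which i or v vanishes -/

section kernel

variable {g : OO}

theorem eq_zero_of_dvd_sub_algebraMap (hg : ¬ IsUnit g) {a : OO} {r : ℂ}
    (h : g ∣ a - r • 1) : r = ev a := by
  obtain ⟨k, hk⟩ := h
  rw [isUnit_iff_ev, not_not] at hg
  have := congrArg ev hk
  simp [hg] at this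
  linear_combination -this

/-- Germs which are constant along an irreducible curve. -/
theorem dvd_sub_ev_of_dvd_hamD (hg : Prime g) (hX : ¬ cX ∣ g) {a : OO} (h : g ∣ hamD g a) :
    g ∣ a - ev a • 1 := by
  obtain ⟨r, hr⟩ := exists_dvd_sub_smul (a := a) (b := 1) hg hX
    (fun h1 => hg.not_isUnit (isUnit_of_dvd_one h1)) (by simpa using h)
  rwa [eq_zero_of_dvd_sub_algebraMap hg.not_isUnit hr] at hr

theorem dvd_of_associated_germEqn (hg : Prime g) (c : CircleOrLine) (hc : c.B ≠ 0 ∨ c.C ≠ 0)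
    (h : g ∣ c.germEqn) {F : OO} (hF : g ∣ F) : c.germEqn ∣ F :=
  ((hg.irreducible.associated_of_dvd (c.isSmoothGerm_germEqn hc).irreducible h).dvd_iff_dvd_left).1
    hF

/-- The numerator of the D-derivative of the slope -g_x/g_y is i_g up to sign, so the slope is a
constant ρ on the curve. Then y - ρx is constant as well, and it is zero at the origin. The axis x =
0, where slopes are unavailable, is treated apart. -/
theorem exists_line_of_dvd_iO (hg : Prime g) (hi : g ∣ iO g) :
    ∃ c : CircleOrLine, c.IsLine ∧ g ∣ c.germEqn := by
  by_cases hX : cX ∣ g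
  · refine ⟨⟨0, 1, 0, by simp⟩, rfl, ?_⟩
    rw [CircleOrLine.germEqn]
    simp only [zero_smul, zero_add, mul_zero, add_zero, mul_one]
    exact (cX_prime.irreducible.dvd_symm hg.irreducible hX |>.trans (Dvd.intro_left (algebraMap ℂ OO 2)
      (Algebra.smul_def _ _).symm))
  · obtain ⟨ρ, hρ⟩ := exists_dvd_sub_smul (a := -dX g) (b := dY g) hg hX
      (not_dvd_dY hg.not_isUnit hX) (by
        rw [← dvd_neg]
        convert hi using 1
        rw [iO_eq_hamD]
        simp only [map_neg]
        ring)
    have h1 := dvd_sub_ev_of_dvd_hamD (a := cY - ρ • cX) hg hX (by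
      rwa [map_sub, Derivation.map_smul, hamD_cX, hamD_cY])
    refine ⟨⟨0, -ρ, 1, by simp⟩, rfl, ?_⟩
    have h2 : ev (cY - ρ • cX) = 0 := by simp [ev_cX, ev_cY]
    rw [h2, zero_smul, sub_zero] at h1
    convert h1.mul_left (algebraMap ℂ OO 2) using 1
    simp only [CircleOrLine.germEqn, Algebra.smul_def, map_mul, map_neg, map_one, map_zero]
    ring

/-- Where i does not vanish identically, v = 0 says that the centre of curvature (α, β) is constant.
Then x² + y² - 2αx - 2βy is constant along the curve, and zero because the curve passes through the
origin. -/
theorem exists_circleOrLine_of_dvd_vO (hg : Prime g) (hv : g ∣ vO g) :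
    ∃ c : CircleOrLine, (c.B ≠ 0 ∨ c.C ≠ 0) ∧ g ∣ c.germEqn := by
  by_cases hi : g ∣ iO g
  · obtain ⟨c, hc, h⟩ := exists_line_of_dvd_iO hg hi
    exact ⟨c, hc.ne_zero, h⟩
  by_cases hX : cX ∣ g
  · refine absurd ?_ hi
    obtain ⟨c, hc, h⟩ : ∃ c : CircleOrLine, c.IsLine ∧ c.germEqn ∣ g := by
      refine ⟨⟨0, 1, 0, by simp⟩, rfl, ?_⟩
      rw [CircleOrLine.germEqn]
      simp only [zero_smul, zero_add, mul_zero, add_zero, mul_one]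
      rw [Algebra.smul_def, IsUnit.mul_left_dvd]
      · exact hX
      · exact (IsUnit.mk0 (2 : ℂ) two_ne_zero).map _
    by_contra h'
    exact inum_ne_top_of_not_dvd hg.irreducible h' (inum_iO_eq_top_of_dvd hc h)
  set X := dY g with hXdef
  set Y := -dX g with hYdef
  have hYg : dX g = -Y := by rw [hYdef, neg_neg]
  set J := -iO g with hJ
  have hiJ : iO g = -J := by rw [hJ, neg_neg]
  have hJg : ¬ g ∣ J := by rwa [hJ, dvd_neg]
  set D := hamD g
  have hDX : D cX = X := hamD_cX g
  have hDY : D cY = Y := hamD_cY g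
  have hJD : J = X * D Y - Y * D X := by
    rw [hJ, iO_eq_hamD, ← hXdef, hYg]
    simp only [map_neg]
    ring
  have hvD : vO g = (X ^ 2 + Y ^ 2) * D J - 3 * (X * D X + Y * D Y) * J := by
    rw [vO_eq_hamD, ← hXdef, hYg, hiJ]
    simp only [map_neg]
    ring
  -- The first coordinate of the centre of curvature is x - (X² + Y²) Y / J; its derivative has
  -- numerator Y v, and that of the second coordinate has numerator -X v.
  obtain ⟨α, hα⟩ := exists_dvd_sub_smul (a := cX * J - (X ^ 2 + Y ^ 2) * Y) (b := J) hg hX hJg (by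
    convert hv.mul_left Y using 1
    change J * D _ - _ * D J = _
    rw [hvD]
    simp only [map_sub, map_add, Derivation.leibniz, pow_two, smul_eq_mul, hDX]
    rw [hJD]
    ring)
  obtain ⟨β, hβ⟩ := exists_dvd_sub_smul (a := cY * J + (X ^ 2 + Y ^ 2) * X) (b := J) hg hX hJg (by
    convert hv.mul_left (-X) using 1
    change J * D _ - _ * D J = _
    rw [hvD]
    simp only [map_add, Derivation.leibniz, pow_two, smul_eq_mul, hDY]
    rw [hJD]
    ring)
  have h1 : g ∣ J * D (cX ^ 2 + cY ^ 2 - (2 * α) • cX - (2 * β) • cY) := by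
    convert (hα.mul_left (2 * X)).add (hβ.mul_left (2 * Y)) using 1
    simp only [map_sub, map_add, Derivation.map_smul, Derivation.leibniz, pow_two, smul_eq_mul, hDX,
      hDY]
    simp only [Algebra.smul_def, map_mul, map_ofNat]
    ring
  have h2 := dvd_sub_ev_of_dvd_hamD hg hX ((hg.dvd_or_dvd h1).resolve_left hJg)
  have h3 : ev (cX ^ 2 + cY ^ 2 - (2 * α) • cX - (2 * β) • cY) = 0 := by simp [ev_cX, ev_cY]
  rw [h3, zero_smul, sub_zero] at h2
  -- A centre at the origin leaves x² + y² = 0, which splits into two isotropic lines; the prime g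
  -- divides one of them.
  by_cases hαβ : α = 0 ∧ β = 0
  · have h4 : cX ^ 2 + cY ^ 2 - (2 * α) • cX - (2 * β) • cY =
        (cX + algebraMap ℂ OO Complex.I * cY) * (cX - algebraMap ℂ OO Complex.I * cY) := by
      have hI : algebraMap ℂ OO Complex.I ^ 2 = -1 := by
        rw [← map_pow, Complex.I_sq, map_neg, map_one]
      rw [hαβ.1, hαβ.2, mul_zero, zero_smul, zero_smul]
      linear_combination cY ^ 2 * hI
    rw [h4] at h2
    rcases hg.dvd_or_dvd h2 with h | h
    · refine ⟨⟨0, 1, Complex.I, by simp⟩, by simp, ?_⟩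
      convert h.mul_left (algebraMap ℂ OO 2) using 1
      simp only [CircleOrLine.germEqn, Algebra.smul_def, map_mul, map_one, map_zero]
      ring
    · refine ⟨⟨0, 1, -Complex.I, by simp⟩, by simp, ?_⟩
      convert h.mul_left (algebraMap ℂ OO 2) using 1
      simp only [CircleOrLine.germEqn, Algebra.smul_def, map_mul, map_one, map_zero, map_neg]
      ring
  · refine ⟨⟨1, -α, -β, by simp⟩, ?_, ?_⟩
    · by_contra! h
      exact hαβ ⟨neg_eq_zero.1 h.1, neg_eq_zero.1 h.2⟩
    · convert h2 using 1
      simp only [CircleOrLine.germEqn, Algebra.smul_def, map_mul, map_one, map_neg]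
      ring

end kernel

/-! ### Infinite invariants of an equation -/

section contains

variable {f : ℂ × ℂ → ℂ}

theorem not_dvd_of_squarefree {g k : OO} (hg : Prime g) (h : Squarefree (g * k)) : ¬ g ∣ k := by
  rintro ⟨l, rfl⟩
  exact hg.not_isUnit (h g ⟨l, by ring⟩)

/-- Let g be a common prime of f = gk and i_f. Modulo g one has i_f ≡ k³ i_g, and g does not divide
k because f is reduced; hence g divides i_g and is a line. -/
theorem inflEq_eq_top_iff (hf : AnalyticAt ℂ f 0) (hsq : Squarefree (germ f)) :
    inflEq f 0 = ⊤ ↔ ∃ c : CircleOrLine, c.IsLine ∧ EqContains f c.carrier := by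
  rw [inflEq_eq_inum hf]
  constructor
  · intro h
    obtain ⟨g, hg, hgF, hgi⟩ := exists_common_prime h
    have hgi' : g ∣ iO g := by
      obtain ⟨k, hk⟩ := hgF
      rw [hk] at hsq hgi
      have h1 := dvd_sub hgi (mul_comm g k ▸ (dvd_iO_vO_mul_sub k g).1)
      rw [sub_sub_cancel] at h1
      exact (hg.dvd_or_dvd h1).resolve_left fun h2 =>
        not_dvd_of_squarefree hg hsq (hg.dvd_of_dvd_pow h2)
    obtain ⟨c, hc, hgc⟩ := exists_line_of_dvd_iO hg hgi'
    exact ⟨c, hc, (c.germEqn_dvd_iff hc.ne_zero hf).1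
      (dvd_of_associated_germEqn hg c hc.ne_zero hgc hgF)⟩
  · rintro ⟨c, hc, h⟩
    exact inum_iO_eq_top_of_dvd hc ((c.germEqn_dvd_iff hc.ne_zero hf).2 h)

theorem vertEq_eq_top_iff (hf : AnalyticAt ℂ f 0) (hsq : Squarefree (germ f)) :
    vertEq f 0 = ⊤ ↔ ∃ c : CircleOrLine, EqContains f c.carrier := by
  rw [vertEq_eq_inum hf]
  constructor
  · intro h
    obtain ⟨g, hg, hgF, hgv⟩ := exists_common_prime h
    have hgv' : g ∣ vO g := by
      obtain ⟨k, hk⟩ := hgF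
      rw [hk] at hsq hgv
      have h1 := dvd_sub hgv (mul_comm g k ▸ (dvd_iO_vO_mul_sub k g).2)
      rw [sub_sub_cancel] at h1
      exact (hg.dvd_or_dvd h1).resolve_left fun h2 =>
        not_dvd_of_squarefree hg hsq (hg.dvd_of_dvd_pow h2)
    obtain ⟨c, hc, hgc⟩ := exists_circleOrLine_of_dvd_vO hg hgv'
    exact ⟨c, (c.germEqn_dvd_iff hc hf).1 (dvd_of_associated_germEqn hg c hc hgc hgF)⟩
  · rintro ⟨c, h⟩
    obtain ⟨c', hc', h'⟩ : ∃ c' : CircleOrLine, (c'.B ≠ 0 ∨ c'.C ≠ 0) ∧ EqContains f c'.carrier := by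
      by_cases hc : c.B ≠ 0 ∨ c.C ≠ 0
      · exact ⟨c, hc, h⟩
      · push Not at hc
        obtain ⟨c', -, hc', hle⟩ := c.exists_isLine_of_eq_zero hc.1 hc.2
        exact ⟨c', hc', h.filter_mono (nhdsWithin_mono 0 hle)⟩
    exact inum_vO_eq_top_of_dvd hc' ((c'.germEqn_dvd_iff hc' hf).2 h')

end contains

/-! ### Powers of the maximal ideal and jets -/

/-- Euler's identity for the homogeneous part of degree j, in ideal-theoretic form and proved by the
Leibniz rule on products. -/
theorem euler_sub_mem {F : OO} {j : ℕ} (hF : F ∈ mm ^ j) :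
    cX * dX F + cY * dY F - j * F ∈ mm ^ (j + 1) := by
  have hx : cX ∈ mm := mem_mm_iff.2 ev_cX
  have hy : cY ∈ mm := mem_mm_iff.2 ev_cY
  have h0 : ∀ a b : OO, cX * a + cY * b ∈ mm := fun a b =>
    add_mem (Ideal.mul_mem_right _ _ hx) (Ideal.mul_mem_right _ _ hy)
  induction j generalizing F with
  | zero => simpa using h0 _ _
  | succ j ih =>
    rw [pow_succ'] at hF
    refine Submodule.mul_induction_on hF (fun a ha b hb => ?_) fun F G hF hG => ?_
    · obtain ⟨u, v, rfl⟩ := Ideal.mem_span_pair.1 ha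
      have h1 := Ideal.mul_mem_mul ha (ih hb)
      have h2 := Ideal.mul_mem_mul (add_mem (Ideal.mul_mem_mul (h0 (dX u) (dY u)) hx)
        (Ideal.mul_mem_mul (h0 (dX v) (dY v)) hy)) hb
      rw [← pow_succ'] at h1
      rw [← pow_two, ← pow_add, add_comm 2 j] at h2
      convert add_mem h1 h2 using 1
      simp only [map_add, Derivation.leibniz, smul_eq_mul, dX_cX, dX_cY, dY_cX, dY_cY]
      push_cast
      ring
    · convert add_mem hF hG using 1
      simp only [map_add]
      ring

/-- Once F is in mm ^ (j + 1), Euler's identity expresses (j + 1) F through its derivatives one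
order deeper, and j + 1 is a unit in characteristic zero. -/
theorem mem_mm_pow_succ {F : OO} {k : ℕ} (h0 : ev F = 0) (hx : dX F ∈ mm ^ k)
    (hy : dY F ∈ mm ^ k) : F ∈ mm ^ (k + 1) := by
  suffices h : ∀ j ≤ k, F ∈ mm ^ (j + 1) from h k le_rfl
  intro j hj
  induction j with
  | zero => simpa using mem_mm_iff.2 h0
  | succ j ih =>
    have h1 := euler_sub_mem (ih (by omega))
    have h2 : cX * dX F + cY * dY F ∈ mm ^ (j + 1 + 1) := by
      refine Ideal.pow_le_pow_right (Nat.succ_le_succ hj) ?_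
      rw [pow_succ']
      exact add_mem (Ideal.mul_mem_mul (mem_mm_iff.2 ev_cX) hx)
        (Ideal.mul_mem_mul (mem_mm_iff.2 ev_cY) hy)
    have h3 := sub_mem h2 h1
    rw [sub_sub_cancel] at h3
    have h4 : IsUnit ((j + 1 : ℕ) : OO) := by
      rw [isUnit_iff_ev, map_natCast]
      exact Nat.cast_ne_zero.2 j.succ_ne_zero
    exact (Ideal.unit_mul_mem_iff_mem _ h4).1 h3

theorem dGerm_mem_mm_pow (v : ℂ × ℂ) {F : OO} {k : ℕ} (hF : F ∈ mm ^ (k + 1)) :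
    dGerm v F ∈ mm ^ k := by
  induction k generalizing F with
  | zero => simp
  | succ k ih =>
    rw [pow_succ'] at hF
    refine Submodule.mul_induction_on hF (fun a ha b hb => ?_) fun F G hF hG => ?_
    · rw [Derivation.leibniz, smul_eq_mul, smul_eq_mul]
      refine add_mem ?_ (Ideal.mul_mem_right _ _ hb)
      rw [pow_succ']
      exact Ideal.mul_mem_mul ha (ih hb)
    · rw [map_add]
      exact add_mem hF hG

/-- At most three derivatives occur, and each costs one power of the maximal ideal. -/
theorem iO_vO_sub_mem {F G : OO} {n : ℕ} (h : G - F ∈ mm ^ (n + 3)) :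
    iO G - iO F ∈ mm ^ n ∧ vO G - vO F ∈ mm ^ n := by
  have e1 : ∀ v, dGerm v G - dGerm v F ∈ mm ^ (n + 2) := fun v => by
    rw [← map_sub]
    exact dGerm_mem_mm_pow v h
  have e2 : ∀ v w, dGerm v (dGerm w G) - dGerm v (dGerm w F) ∈ mm ^ (n + 1) := fun v w => by
    rw [← map_sub]
    exact dGerm_mem_mm_pow v (e1 w)
  have e3 : ∀ u v w, dGerm u (dGerm v (dGerm w G)) - dGerm u (dGerm v (dGerm w F)) ∈ mm ^ n :=
    fun u v w => by
    rw [← map_sub]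
    exact dGerm_mem_mm_pow u (e2 v w)
  set π := Ideal.Quotient.mk (mm ^ n) with hπ
  have hmem : ∀ {a b : OO} (k : ℕ), a - b ∈ mm ^ (n + k) → π a = π b := fun k hab =>
    Ideal.Quotient.eq.2 (Ideal.pow_le_pow_right (Nat.le_add_right n k) hab)
  have f1 := fun v => hmem 2 (e1 v)
  have f2 := fun v w => hmem 1 (e2 v w)
  have f3 := fun u v w => hmem 0 (e3 u v w)
  have hi : π (iO G) = π (iO F) := by
    simp only [iO, map_add, map_sub, map_mul, map_pow, f1, f2]
  refine ⟨Ideal.Quotient.eq.1 hi, Ideal.Quotient.eq.1 ?_⟩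
  change π _ = π _
  simp only [vO, map_add, map_sub, map_mul, map_pow, f1, f2, f3, hi]

theorem SameJet.fderiv_apply {f g : ℂ × ℂ → ℂ} {k : ℕ} (hf : AnalyticAt ℂ f 0)
    (hg : AnalyticAt ℂ g 0) (h : SameJet (k + 1) f g) (v : ℂ × ℂ) :
    SameJet k (fun q => fderiv ℂ f q v) (fun q => fderiv ℂ g q v) := by
  intro j hj
  let L : (ℂ × ℂ →L[ℂ] ℂ) →L[ℂ] ℂ := ContinuousLinearMap.apply ℂ ℂ v
  have hL : ∀ {f : ℂ × ℂ → ℂ}, AnalyticAt ℂ f 0 →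
      iteratedFDeriv ℂ j (fun q => fderiv ℂ f q v) 0 =
        L.compContinuousMultilinearMap (iteratedFDeriv ℂ j (fderiv ℂ f) 0) := fun hf =>
    L.iteratedFDeriv_comp_left (hf.fderiv.contDiffAt (n := ⊤)) (by exact_mod_cast le_top)
  rw [hL hf, hL hg]
  ext m
  have h1 := congrArg (fun M => M (Fin.snoc m v)) (h (j + 1) (by omega))
  simp only [iteratedFDeriv_succ_apply_right, Fin.init_snoc, Fin.snoc_last] at h1
  exact h1

theorem SameJet.germ_sub_mem {f g : ℂ × ℂ → ℂ} {k : ℕ} (hf : AnalyticAt ℂ f 0)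
    (hg : AnalyticAt ℂ g 0) (h : SameJet k f g) : germ g - germ f ∈ mm ^ (k + 1) := by
  have h0 : ev (germ g - germ f) = 0 := by
    have h1 := congrArg (fun M => M 0) (h 0 (Nat.zero_le k))
    simp only [iteratedFDeriv_zero_apply] at h1
    rw [map_sub, ev_germ hf, ev_germ hg, h1, sub_self]
  induction k generalizing f g with
  | zero => simpa using mem_mm_iff.2 h0
  | succ k ih =>
    have key : ∀ v, dGerm v (germ g - germ f) ∈ mm ^ (k + 1) := fun v => by
      rw [map_sub, dGerm_germ hf, dGerm_germ hg]
      have h2 := h.fderiv_apply hf hg v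
      refine ih (analyticAt_fderiv_apply hf v) (analyticAt_fderiv_apply hg v) h2 ?_
      have h1 := congrArg (fun M => M 0) (h2 0 (Nat.zero_le k))
      simp only [iteratedFDeriv_zero_apply] at h1
      rw [map_sub, ev_germ (analyticAt_fderiv_apply hf v), ev_germ (analyticAt_fderiv_apply hg v),
        h1, sub_self]
    exact mem_mm_pow_succ h0 (key _) (key _)

theorem inflEq_finitely_determined {f : ℂ × ℂ → ℂ} (hf : AnalyticAt ℂ f 0)
    (h : inflEq f 0 ≠ ⊤) : ∃ k : ℕ, ∀ g : ℂ × ℂ → ℂ, AnalyticAt ℂ g 0 → SameJet k f g →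
      inflEq g 0 = inflEq f 0 := by
  rw [inflEq_eq_inum hf] at h ⊢
  obtain ⟨n, hn⟩ := exists_pow_le_of_codim_ne_top mm_le_jacobson h
  -- Equal (n + 3)-jets differ by an element of mm ^ (n + 4), so i changes within mm ^ (n + 1): one
  -- power beyond the mm ^ n contained in the ideal, as Nakayama's lemma requires.
  refine ⟨n + 3, fun g hg hj => ?_⟩
  have h1 := hj.germ_sub_mem hf hg
  rw [inflEq_eq_inum hg, inum, span_pair_eq_of_sub_mem_pow mm_le_jacobson hn
    (Ideal.pow_le_pow_right (by omega) h1) (iO_vO_sub_mem (n := n + 1) h1).1]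

theorem vertEq_finitely_determined {f : ℂ × ℂ → ℂ} (hf : AnalyticAt ℂ f 0)
    (h : vertEq f 0 ≠ ⊤) : ∃ k : ℕ, ∀ g : ℂ × ℂ → ℂ, AnalyticAt ℂ g 0 → SameJet k f g →
      vertEq g 0 = vertEq f 0 := by
  rw [vertEq_eq_inum hf] at h ⊢
  obtain ⟨n, hn⟩ := exists_pow_le_of_codim_ne_top mm_le_jacobson h
  refine ⟨n + 3, fun g hg hj => ?_⟩
  have h1 := hj.germ_sub_mem hf hg
  rw [vertEq_eq_inum hg, inum, span_pair_eq_of_sub_mem_pow mm_le_jacobson hn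
    (Ideal.pow_le_pow_right (by omega) h1) (iO_vO_sub_mem (n := n + 1) h1).2]

/-! ### Intersection number one -/

/-- The classes of 1 and x are independent modulo mm ^ 2, as seen by evaluating a relation and its
x-derivative at 0, so the quotient cannot be a line. -/
theorem inum_ne_one {F H : OO} (hF : F ∈ mm ^ 2) (hH : H ∈ mm ^ 2) : inum F H ≠ 1 := by
  intro h
  rw [inum, codim, Cardinal.toENat_eq_one] at h
  have hle : Ideal.span {F, H} ≤ mm ^ 2 := by
    rw [Ideal.span_le]
    rintro z (rfl | rfl)
    exacts [hF, hH]
  obtain ⟨v, hv⟩ := rank_le_one_iff.1 h.le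
  have hmm : ∀ {F : OO}, F ∈ mm ^ 2 → ev F = 0 := fun hF =>
    mem_mm_iff.1 (Ideal.pow_le_self two_ne_zero hF)
  obtain ⟨r, hr⟩ := hv 1
  obtain ⟨s, hs⟩ := hv (Ideal.Quotient.mk _ cX)
  have h1 : r • cX - s • (1 : OO) ∈ Ideal.span {F, H} := by
    rw [← Ideal.Quotient.eq]
    change r • (Ideal.Quotient.mk (Ideal.span {F, H}) cX) = s • 1
    rw [← hr, ← hs, smul_comm]
  have h2 := hmm (hle h1)
  have hs0 : s = 0 := by simpa [ev_cX] using h2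
  have hr0 : r ≠ 0 := by
    rintro rfl
    rw [zero_smul] at hr
    have h3 : (1 : OO) ∈ Ideal.span {F, H} := Ideal.Quotient.eq_zero_iff_mem.1 hr.symm
    exact one_ne_zero (α := ℂ) (by simpa using hmm (hle h3))
  have h3 := mem_mm_iff.1 (pow_one mm ▸ dGerm_mem_mm_pow (1, 0) (k := 1) (hle h1))
  have h4 : dX cX = 1 := dX_cX
  rw [hs0, zero_smul, sub_zero, Derivation.map_smul, h4] at h3
  exact hr0 (by simpa using h3)

theorem iO_vO_mem_mm_pow {F : OO} (hx : ev (dX F) = 0) (hy : ev (dY F) = 0) :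
    iO F ∈ mm ^ 2 ∧ vO F ∈ mm ^ 2 := by
  have h11 : dX F ^ 2 ∈ mm ^ 2 := Ideal.pow_mem_pow (mem_mm_iff.2 hx) 2
  have h22 : dY F ^ 2 ∈ mm ^ 2 := Ideal.pow_mem_pow (mem_mm_iff.2 hy) 2
  have h12 : dX F * dY F ∈ mm ^ 2 := by
    rw [pow_two]
    exact Ideal.mul_mem_mul (mem_mm_iff.2 hx) (mem_mm_iff.2 hy)
  have hi : iO F ∈ mm ^ 2 := by
    rw [iO]
    refine add_mem (sub_mem (Ideal.mul_mem_right _ _ h22) ?_) (Ideal.mul_mem_right _ _ h11)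
    rw [mul_assoc 2]
    exact Ideal.mul_mem_right _ _ (Ideal.mul_mem_left _ _ h12)
  refine ⟨hi, ?_⟩
  rw [vO]
  exact sub_mem (Ideal.mul_mem_right _ _ (add_mem h11 h22)) (Ideal.mul_mem_left _ _ hi)

theorem isSmoothGerm_of_inum_eq_one {F : OO} (h0 : ev F = 0)
    (h : inum F (iO F) = 1 ∨ inum F (vO F) = 1) : IsSmoothGerm F := by
  refine ⟨h0, ?_⟩
  by_contra! hcon
  obtain ⟨h1, h2⟩ := iO_vO_mem_mm_pow hcon.1 hcon.2
  have hF : F ∈ mm ^ 2 := mem_mm_pow_succ (k := 1) h0 (by simpa using mem_mm_iff.2 hcon.1)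
    (by simpa using mem_mm_iff.2 hcon.2)
  exact h.elim (inum_ne_one hF h1) (inum_ne_one hF h2)

/-! ### The algebra of parametrised curves -/

/-- The order of a germ along the first coordinate axis. -/
abbrev ordX (F : OO) : ℕ∞ := ordAlong axisX F

theorem ordX_germX {r : ℂ → ℂ} (hr : AnalyticAt ℂ r 0) : ordX (germX r) = analyticOrderAt r 0 :=
  ordAlong_germ analyticAt_axisX axisX_zero (analyticAt_comp_fst hr)

theorem ordX_mul (F G : OO) : ordX (F * G) = ordX F + ordX G :=
  ordAlong_mul analyticAt_axisX axisX_zero F G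

theorem ordX_eq_zero_iff {F : OO} : ordX F = 0 ↔ IsUnit F :=
  ordAlong_eq_zero_iff analyticAt_axisX axisX_zero

theorem ordX_unit_mul {u : OO} (hu : IsUnit u) (F : OO) : ordX (u * F) = ordX F := by
  rw [ordX_mul, ordX_eq_zero_iff.2 hu, zero_add]

theorem ordX_smul {c : ℂ} (hc : c ≠ 0) (F : OO) : ordX (c • F) = ordX F := by
  rw [Algebra.smul_def, ordX_unit_mul ((IsUnit.mk0 c hc).map _)]

theorem ordX_cX : ordX cX = 1 := by
  rw [← germX_id, ordX_germX analyticAt_id]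
  exact analyticOrderAt_id

theorem ordX_eq_top_iff {F : OO} (hF : F ∈ RX) : ordX F = ⊤ ↔ F = 0 := by
  obtain ⟨r, hr, rfl⟩ := hF
  rw [ordX_germX hr, analyticOrderAt_eq_top, germX_eq_zero_iff hr]

/-- The germ of `i_γ` in terms of the germs of the coordinates. -/
def iP (x y : OO) : OO := dX x * dX (dX y) - dX y * dX (dX x)

/-- The germ of `v_γ` in terms of the germs of the coordinates. -/
def vP (x y : OO) : OO :=
  (dX x ^ 2 + dX y ^ 2) * (dX x * dX (dX (dX y)) - dX (dX (dX x)) * dX y)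
    + 3 * (dX x * dX (dX x) + dX y * dX (dX y)) * (dX (dX x) * dX y - dX x * dX (dX y))

theorem dX_iP (x y : OO) : dX (iP x y) = dX x * dX (dX (dX y)) - dX (dX (dX x)) * dX y := by
  simp only [iP, map_sub, Derivation.leibniz, smul_eq_mul]
  ring

theorem iP_mem_RX {x y : OO} (hx : x ∈ RX) (hy : y ∈ RX) : iP x y ∈ RX :=
  RX.sub_mem (RX.mul_mem (dX_mem_RX hx) (dX_mem_RX (dX_mem_RX hy)))
    (RX.mul_mem (dX_mem_RX hy) (dX_mem_RX (dX_mem_RX hx)))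

/-- The form v = E i' - (3/2) E' i with E = x'² + y'². It relates the orders of v and i and explains
the weights of v. -/
theorem vP_eq (x y : OO) : vP x y = (dX x ^ 2 + dX y ^ 2) * dX (iP x y)
    - 3 * (dX x * dX (dX x) + dX y * dX (dX y)) * iP x y := by
  rw [vP, dX_iP, iP]
  ring

theorem vP_mem_RX {x y : OO} (hx : x ∈ RX) (hy : y ∈ RX) : vP x y ∈ RX := by
  have h1 := dX_mem_RX hx
  have h2 := dX_mem_RX hy
  have h3 := dX_mem_RX h1
  have h4 := dX_mem_RX h2
  have h5 := iP_mem_RX hx hy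
  rw [vP_eq]
  exact RX.sub_mem (RX.mul_mem (RX.add_mem (RX.pow_mem h1 2) (RX.pow_mem h2 2)) (dX_mem_RX h5))
    (RX.mul_mem (RX.mul_mem (natCast_mem RX 3)
      (RX.add_mem (RX.mul_mem h1 h3) (RX.mul_mem h2 h4))) h5)

section param

variable {γ : ℂ → ℂ × ℂ}

theorem analyticAt_fst_curve (hγ : AnalyticAt ℂ γ 0) : AnalyticAt ℂ (fun t => (γ t).1) 0 :=
  analyticAt_fst.comp hγ

theorem analyticAt_snd_curve (hγ : AnalyticAt ℂ γ 0) : AnalyticAt ℂ (fun t => (γ t).2) 0 :=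
  analyticAt_snd.comp hγ

/-- The germ of the first coordinate of a parametrised curve. -/
def xG (γ : ℂ → ℂ × ℂ) : OO := germX fun t => (γ t).1

/-- The germ of the second coordinate of a parametrised curve. -/
def yG (γ : ℂ → ℂ × ℂ) : OO := germX fun t => (γ t).2

theorem xG_mem_RX (hγ : AnalyticAt ℂ γ 0) : xG γ ∈ RX := germX_mem_RX (analyticAt_fst_curve hγ)

theorem yG_mem_RX (hγ : AnalyticAt ℂ γ 0) : yG γ ∈ RX := germX_mem_RX (analyticAt_snd_curve hγ)

theorem inflParam_vertParam_eq (hγ : AnalyticAt ℂ γ 0) :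
    inflParam γ = ordX (iP (xG γ) (yG γ)) ∧ vertParam γ = ordX (vP (xG γ) (yG γ)) := by
  have hx := analyticAt_fst_curve hγ
  have hy := analyticAt_snd_curve hγ
  have hx1 := hx.deriv
  have hy1 := hy.deriv
  have hx2 := hx1.deriv
  have hy2 := hy1.deriv
  have hx3 := hx2.deriv
  have hy3 := hy2.deriv
  have h2 : ∀ f : ℂ → ℂ, iteratedDeriv 2 f = deriv (deriv f) := fun f => by
    rw [iteratedDeriv_succ, iteratedDeriv_one]
  have h3 : ∀ f : ℂ → ℂ, iteratedDeriv 3 f = deriv (deriv (deriv f)) := fun f => by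
    rw [iteratedDeriv_succ, h2]
  constructor
  · rw [iP, xG, yG, dX_germX hx, dX_germX hy, dX_germX hx1, dX_germX hy1]
    simp only [germX]
    rw [← germ_mul (analyticAt_comp_fst hx1) (analyticAt_comp_fst hy2),
      ← germ_mul (analyticAt_comp_fst hy1) (analyticAt_comp_fst hx2),
      ← germ_sub (analyticAt_comp_fst (hx1.fun_mul hy2)) (analyticAt_comp_fst (hy1.fun_mul hx2))]
    rw [inflParam, ← ordX_germX (r := iParam γ)]
    · simp only [germX, iParam, h2]
    · unfold iParam
      simp only [h2]
      fun_prop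
  · have hv : AnalyticAt ℂ (vParam γ) 0 := by
      unfold vParam
      simp only [h2, h3]
      fun_prop
    rw [vertParam, ← ordX_germX hv, vP, xG, yG, dX_germX hx, dX_germX hy, dX_germX hx1,
      dX_germX hy1, dX_germX hx2, dX_germX hy2]
    congr 1
    have a1 := analyticAt_comp_fst hx1
    have a2 := analyticAt_comp_fst hy1
    have a3 := analyticAt_comp_fst hx2
    have a4 := analyticAt_comp_fst hy2
    have a5 := analyticAt_comp_fst hx3
    have a6 := analyticAt_comp_fst hy3
    simp only [germX, vParam, h2, h3]
    simp (disch := fun_prop) only [germ_mul, germ_pow, germ_const, germ_add, germ_sub]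
    rw [map_ofNat]

theorem mem_RX_eq_const {F : OO} (hF : F ∈ RX) (h : dX F = 0) : F = ev F • 1 := by
  obtain ⟨c, hc⟩ := exists_eq_smul_of_wronskian_RX hF RX.one_mem one_ne_zero (by simp [h])
  rw [hc]
  simp

/-! #### Affine changes of coordinates -/

theorem iP_vP_affine {a b c d : ℂ} (x y : OO) (e e' : ℂ) :
    iP (a • x + b • y + e • 1) (c • x + d • y + e' • 1) = (a * d - b * c) • iP x y := by
  simp only [iP, map_add, Derivation.map_smul, Derivation.map_one_eq_zero, smul_zero, add_zero]
  simp only [Algebra.smul_def, map_sub, map_mul]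
  ring

/-- The sign s = ±1 treats both kinds of similarity at once: E is multiplied by a² + b², and i by
the determinant s(a² + b²). -/
theorem vP_similarity {a b s : ℂ} (hs : s ^ 2 = 1) (x y : OO) (e e' : ℂ) :
    vP (a • x + b • y + e • 1) ((-(s * b)) • x + (s * a) • y + e' • 1)
      = (s * (a ^ 2 + b ^ 2) ^ 2) • vP x y := by
  have hs' : algebraMap ℂ OO s ^ 2 = 1 := by rw [← map_pow, hs, map_one]
  simp only [vP, map_add, Derivation.map_smul, Derivation.map_one_eq_zero, smul_zero, add_zero]
  simp only [Algebra.smul_def, map_neg, map_mul, map_add, map_pow]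
  generalize algebraMap ℂ OO s = s at *
  generalize algebraMap ℂ OO a = a
  generalize algebraMap ℂ OO b = b
  generalize dX (dX (dX x)) = x3
  generalize dX (dX (dX y)) = y3
  generalize dX (dX x) = x2
  generalize dX (dX y) = y2
  generalize dX x = x1
  generalize dX y = y1
  have h1 : (a * x1 + b * y1) ^ 2 + (-(s * b) * x1 + s * a * y1) ^ 2
      = (a ^ 2 + b ^ 2) * (x1 ^ 2 + y1 ^ 2) := by
    linear_combination (-b * x1 + a * y1) ^ 2 * hs'
  have h2 : (a * x1 + b * y1) * (a * x2 + b * y2)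
      + (-(s * b) * x1 + s * a * y1) * (-(s * b) * x2 + s * a * y2)
      = (a ^ 2 + b ^ 2) * (x1 * x2 + y1 * y2) := by
    linear_combination (-b * x1 + a * y1) * (-b * x2 + a * y2) * hs'
  rw [h1, h2]
  ring

end param

/-! ### Invariance of the invariants of parametrised curves -/

section affine

variable {γ : ℂ → ℂ × ℂ}

theorem affine_apply (A : (ℂ × ℂ) ≃ᵃ[ℂ] (ℂ × ℂ)) (z : ℂ × ℂ) :
    A z = z.1 • A.linear (1, 0) + z.2 • A.linear (0, 1) + A 0 := by
  have h1 := A.map_vadd 0 z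
  rw [vadd_eq_add, vadd_eq_add, add_zero] at h1
  rw [h1, ← map_smul, ← map_smul, ← map_add]
  simp

theorem affine_det_ne_zero (A : (ℂ × ℂ) ≃ᵃ[ℂ] (ℂ × ℂ)) :
    (A.linear (1, 0)).1 * (A.linear (0, 1)).2 - (A.linear (0, 1)).1 * (A.linear (1, 0)).2 ≠ 0 := by
  intro h
  set u := A.linear (1, 0) with hu
  set v := A.linear (0, 1) with hv
  have hlin : ∀ a b : ℂ, A.linear (a, b) = a • u + b • v := fun a b => by
    rw [hu, hv, ← map_smul, ← map_smul, ← map_add]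
    simp
  have h1 : A.linear (v.1, -u.1) = 0 := by
    rw [hlin]
    ext
    · simp; ring
    · simp; linear_combination -h
  have h2 : A.linear (v.2, -u.2) = 0 := by
    rw [hlin]
    ext
    · simp; linear_combination h
    · simp; ring
  rw [LinearEquiv.map_eq_zero_iff] at h1 h2
  have h3 : u = 0 := by
    ext
    · simpa using congrArg Prod.snd h1
    · simpa using congrArg Prod.snd h2
  rw [hu, LinearEquiv.map_eq_zero_iff] at h3
  simpa using congrArg Prod.fst h3

theorem analyticAt_affine (A : (ℂ × ℂ) ≃ᵃ[ℂ] (ℂ × ℂ)) (p : ℂ × ℂ) : AnalyticAt ℂ A p := by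
  have h1 : AnalyticAt ℂ (fun z : ℂ × ℂ => z.1) p := analyticAt_fst
  have h2 : AnalyticAt ℂ (fun z : ℂ × ℂ => z.2) p := analyticAt_snd
  have h3 : (A : ℂ × ℂ → ℂ × ℂ) = fun z => z.1 • A.linear (1, 0) + z.2 • A.linear (0, 1) + A 0 :=
    funext (affine_apply A)
  rw [h3]
  fun_prop

theorem germX_linear_combination {r s : ℂ → ℂ} (hr : AnalyticAt ℂ r 0) (hs : AnalyticAt ℂ s 0)
    (a b e : ℂ) : germX (fun t => r t * a + s t * b + e) = a • germX r + b • germX s + e • 1 := by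
  rw [germX_add ((hr.fun_mul analyticAt_const).fun_add (hs.fun_mul analyticAt_const))
    analyticAt_const, germX_add (hr.fun_mul analyticAt_const) (hs.fun_mul analyticAt_const),
    germX_mul hr analyticAt_const, germX_mul hs analyticAt_const, germX_const, germX_const,
    germX_const]
  simp only [Algebra.smul_def]
  ring

theorem xG_yG_affine (hγ : AnalyticAt ℂ γ 0) (A : (ℂ × ℂ) ≃ᵃ[ℂ] (ℂ × ℂ)) :
    xG (fun t => A (γ t)) = (A.linear (1, 0)).1 • xG γ + (A.linear (0, 1)).1 • yG γ + (A 0).1 • 1 ∧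
    yG (fun t => A (γ t)) =
      (A.linear (1, 0)).2 • xG γ + (A.linear (0, 1)).2 • yG γ + (A 0).2 • 1 := by
  have hx := analyticAt_fst_curve hγ
  have hy := analyticAt_snd_curve hγ
  constructor
  · rw [xG, xG, yG, ← germX_linear_combination hx hy]
    congr 1
    funext t
    rw [affine_apply]
    simp
  · rw [yG, xG, yG, ← germX_linear_combination hx hy]
    congr 1
    funext t
    rw [affine_apply]
    simp

theorem inflParam_affine (hγ : AnalyticAt ℂ γ 0) (A : (ℂ × ℂ) ≃ᵃ[ℂ] (ℂ × ℂ)) :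
    inflParam (fun t => A (γ t)) = inflParam γ := by
  have hA : AnalyticAt ℂ (fun t => A (γ t)) 0 := (analyticAt_affine A _).comp hγ
  rw [(inflParam_vertParam_eq hA).1, (inflParam_vertParam_eq hγ).1, (xG_yG_affine hγ A).1,
    (xG_yG_affine hγ A).2, iP_vP_affine, ordX_smul (affine_det_ne_zero A)]

theorem vertParam_similarity (hγ : AnalyticAt ℂ γ 0) {A : (ℂ × ℂ) ≃ᵃ[ℂ] (ℂ × ℂ)}
    (h : IsSimilarity A) : vertParam (fun t => A (γ t)) = vertParam γ := by
  have hA : AnalyticAt ℂ (fun t => A (γ t)) 0 := (analyticAt_affine A _).comp hγ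
  obtain ⟨a, b, hab, h⟩ := h
  obtain ⟨s, hs, h1⟩ : ∃ s : ℂ, s ^ 2 = 1 ∧
      ∀ x y : ℂ, A.linear (x, y) = (a * x + b * y, -(s * b) * x + s * a * y) := by
    rcases h with h | h
    · exact ⟨1, one_pow 2, fun x y => by rw [h]; simp⟩
    · exact ⟨-1, by norm_num, fun x y => by rw [h]; simp; ring⟩
  rw [(inflParam_vertParam_eq hA).2, (inflParam_vertParam_eq hγ).2, (xG_yG_affine hγ A).1,
    (xG_yG_affine hγ A).2, h1, h1]
  simp only [mul_one, mul_zero, add_zero, zero_add]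
  rw [vP_similarity hs, ordX_smul]
  refine mul_ne_zero ?_ (pow_ne_zero 2 hab)
  rintro rfl
  norm_num at hs

end affine

/-! ### Changes of parameter -/

section reparametrisation

variable {φ : ℂ → ℂ}

/-- Substitution of a function of one variable for the first coordinate. -/
def substX (φ : ℂ → ℂ) (hφ : AnalyticAt ℂ φ 0) (h0 : φ 0 = 0) : OO →ₐ[ℂ] OO :=
  pullback (p := 0) (q := 0) (fun z => (φ z.1, z.2))
    ((analyticAt_comp_fst hφ).prod analyticAt_snd) (by simp [h0])

theorem substX_germX (hφ : AnalyticAt ℂ φ 0) (h0 : φ 0 = 0) {r : ℂ → ℂ} (hr : AnalyticAt ℂ r 0) :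
    substX φ hφ h0 (germX r) = germX fun t => r (φ t) :=
  pullback_germAt (p := 0) (q := 0) (φ := fun z => (φ z.1, z.2))
    ((analyticAt_comp_fst hφ).prod analyticAt_snd) (by simp [h0]) (analyticAt_comp_fst hr)

theorem dX_substX (hφ : AnalyticAt ℂ φ 0) (h0 : φ 0 = 0) {F : OO} (hF : F ∈ RX) :
    dX (substX φ hφ h0 F) = germX (deriv φ) * substX φ hφ h0 (dX F) := by
  obtain ⟨r, hr, rfl⟩ := hF
  have hr' : AnalyticAt ℂ r (φ 0) := by rwa [h0]
  have hd : AnalyticAt ℂ (deriv r) (φ 0) := by rw [h0]; exact hr.deriv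
  have hrφ : AnalyticAt ℂ (fun t => r (φ t)) 0 := AnalyticAt.comp (g := r) hr' hφ
  have hdφ : AnalyticAt ℂ (fun t => deriv r (φ t)) 0 := AnalyticAt.comp (g := deriv r) hd hφ
  rw [substX_germX hφ h0 hr, dX_germX hr, substX_germX hφ h0 hr.deriv,
    ← germX_mul hφ.deriv hdφ, dX_germX hrφ]
  apply germX_congr
  filter_upwards [hφ.eventually_analyticAt, hφ.continuousAt.tendsto.eventually
    hr'.eventually_analyticAt] with t h1 h2
  rw [mul_comm]
  exact deriv_comp (h₂ := r) t h2.differentiableAt h1.differentiableAt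

theorem ordX_substX (hφ : AnalyticAt ℂ φ 0) (h0 : φ 0 = 0) (h' : deriv φ 0 ≠ 0) {F : OO}
    (hF : F ∈ RX) : ordX (substX φ hφ h0 F) = ordX F := by
  obtain ⟨r, hr, rfl⟩ := hF
  have hr' : AnalyticAt ℂ r (φ 0) := by rwa [h0]
  have hrφ : AnalyticAt ℂ (fun t => r (φ t)) 0 := AnalyticAt.comp (g := r) hr' hφ
  rw [substX_germX hφ h0 hr, ordX_germX hr, ordX_germX hrφ]
  have h1 := analyticOrderAt_comp_of_deriv_ne_zero (f := r) hφ h'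
  rw [h0] at h1
  exact h1

/-- By the chain rule i and v acquire the factors φ'³ and φ'⁶, the terms containing φ'' and φ'''
cancelling. For φ'(0) ≠ 0 these factors are units. -/
theorem iP_vP_substX (hφ : AnalyticAt ℂ φ 0) (h0 : φ 0 = 0) {x y : OO} (hx : x ∈ RX)
    (hy : y ∈ RX) :
    iP (substX φ hφ h0 x) (substX φ hφ h0 y) = germX (deriv φ) ^ 3 * substX φ hφ h0 (iP x y) ∧
    vP (substX φ hφ h0 x) (substX φ hφ h0 y) = germX (deriv φ) ^ 6 * substX φ hφ h0 (vP x y) := by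
  have hx1 := dX_mem_RX hx
  have hy1 := dX_mem_RX hy
  have hx2 := dX_mem_RX hx1
  have hy2 := dX_mem_RX hy1
  constructor
  · simp only [iP, dX_substX hφ h0 hx, dX_substX hφ h0 hy, Derivation.leibniz, smul_eq_mul,
      dX_substX hφ h0 hx1, dX_substX hφ h0 hy1, map_sub, map_mul]
    ring
  · simp only [vP, dX_substX hφ h0 hx, dX_substX hφ h0 hy, Derivation.leibniz, smul_eq_mul,
      dX_substX hφ h0 hx1, dX_substX hφ h0 hy1, dX_substX hφ h0 hx2, dX_substX hφ h0 hy2,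
      map_sub, map_mul, map_add, map_pow, map_ofNat]
    ring

theorem inflParam_vertParam_comp {γ : ℂ → ℂ × ℂ} (hγ : AnalyticAt ℂ γ 0) (hφ : AnalyticAt ℂ φ 0)
    (h0 : φ 0 = 0) (h' : deriv φ 0 ≠ 0) :
    inflParam (γ ∘ φ) = inflParam γ ∧ vertParam (γ ∘ φ) = vertParam γ := by
  have hc : AnalyticAt ℂ (γ ∘ φ) 0 := AnalyticAt.comp (by rwa [h0]) hφ
  have hx : xG (γ ∘ φ) = substX φ hφ h0 (xG γ) := (substX_germX hφ h0 (analyticAt_fst_curve hγ)).symm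
  have hy : yG (γ ∘ φ) = substX φ hφ h0 (yG γ) := (substX_germX hφ h0 (analyticAt_snd_curve hγ)).symm
  have hu : IsUnit (germX (deriv φ)) := by
    rwa [isUnit_iff_ev, germX, ev_germ (analyticAt_comp_fst hφ.deriv)]
  have hxm := xG_mem_RX hγ
  have hym := yG_mem_RX hγ
  rw [(inflParam_vertParam_eq hc).1, (inflParam_vertParam_eq hc).2, (inflParam_vertParam_eq hγ).1,
    (inflParam_vertParam_eq hγ).2, hx, hy, (iP_vP_substX hφ h0 hxm hym).1,
    (iP_vP_substX hφ h0 hxm hym).2, ordX_unit_mul (hu.pow 3), ordX_unit_mul (hu.pow 6),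
    ordX_substX hφ h0 h' (iP_mem_RX hxm hym), ordX_substX hφ h0 h' (vP_mem_RX hxm hym)]
  exact ⟨rfl, rfl⟩

end reparametrisation

/-! ### Finite determinacy of parametrised curves -/

section jets

theorem cX_pow_dvd_germX {r : ℂ → ℂ} (hr : AnalyticAt ℂ r 0) {n : ℕ}
    (h : (n : ℕ∞) ≤ analyticOrderAt r 0) : cX ^ n ∣ germX r := by
  obtain ⟨s, hs, h⟩ := (natCast_le_analyticOrderAt hr).1 h
  refine ⟨germX s, ?_⟩
  rw [← germX_pow, ← germX_mul (by fun_prop) hs]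
  apply germX_congr
  filter_upwards [h] with t ht
  rw [ht, sub_zero, smul_eq_mul]

theorem le_ordX_of_cX_pow_dvd {F : OO} {n : ℕ} (h : cX ^ n ∣ F) : (n : ℕ∞) ≤ ordX F := by
  obtain ⟨G, rfl⟩ := h
  rw [ordX_mul]
  refine le_add_right ?_
  clear G
  induction n with
  | zero => simp
  | succ n ih =>
    rw [pow_succ, ordX_mul, ordX_cX]
    push_cast
    gcongr

theorem ordX_eq_of_cX_pow_dvd_sub {F G : OO} {n : ℕ} (hF : ordX F < n) (h : cX ^ n ∣ G - F) :
    ordX G = ordX F := by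
  have h1 := le_ordX_of_cX_pow_dvd h
  have h2 := le_ordAlong_add analyticAt_axisX axisX_zero F (G - F)
  have h3 := le_ordAlong_add analyticAt_axisX axisX_zero G (-(G - F))
  have h4 : ordX (-(G - F)) = ordX (G - F) := by
    rw [← neg_one_mul, ordX_unit_mul isUnit_one.neg]
  have e1 : F + (G - F) = G := by ring
  have e2 : G + -(G - F) = F := by ring
  change ordX _ < _ at hF
  rw [e1] at h2
  rw [e2] at h3
  change min (ordX F) (ordX (G - F)) ≤ ordX G at h2
  change min (ordX G) (ordX (-(G - F))) ≤ ordX F at h3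
  rw [h4] at h3
  rw [min_eq_left (hF.trans_le h1).le] at h2
  refine le_antisymm ?_ h2
  rcases min_le_iff.1 h3 with h | h
  · exact h
  · exact absurd (h1.trans h) (not_le.2 hF)

theorem cX_pow_dvd_dX {F : OO} {n : ℕ} (h : cX ^ (n + 1) ∣ F) : cX ^ n ∣ dX F := by
  obtain ⟨G, rfl⟩ := h
  rw [Derivation.leibniz, Derivation.leibniz_pow, dX_cX]
  refine dvd_add ?_ ?_
  · exact ⟨cX * dX G, by rw [smul_eq_mul]; ring⟩
  · exact ⟨G * (n + 1 : ℕ), by simp; ring⟩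

theorem iP_vP_congr {x y x' y' : OO} {n : ℕ} (hx : cX ^ (n + 3) ∣ x' - x)
    (hy : cX ^ (n + 3) ∣ y' - y) :
    cX ^ n ∣ iP x' y' - iP x y ∧ cX ^ n ∣ vP x' y' - vP x y := by
  set π := Ideal.Quotient.mk (Ideal.span {cX ^ n}) with hπ
  have hdvd : ∀ F G : OO, cX ^ n ∣ F - G ↔ π F = π G := fun F G => by
    rw [hπ, Ideal.Quotient.eq, Ideal.mem_span_singleton]
  have key : ∀ {x x' : OO}, cX ^ (n + 3) ∣ x' - x → π (dX x') = π (dX x) ∧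
      π (dX (dX x')) = π (dX (dX x)) ∧ π (dX (dX (dX x'))) = π (dX (dX (dX x))) := by
    intro x x' h
    have h1 := cX_pow_dvd_dX h
    have h2 := cX_pow_dvd_dX h1
    have h3 := cX_pow_dvd_dX h2
    simp only [map_sub] at h1 h2 h3
    exact ⟨(hdvd _ _).1 ((pow_dvd_pow _ (by omega)).trans h1),
      (hdvd _ _).1 ((pow_dvd_pow _ (by omega)).trans h2), (hdvd _ _).1 h3⟩
  obtain ⟨x1, x2, x3⟩ := key hx
  obtain ⟨y1, y2, y3⟩ := key hy
  rw [hdvd, hdvd]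
  simp only [iP, vP, map_sub, map_add, map_mul, map_pow, x1, x2, x3, y1, y2, y3, and_self]

theorem SameJet.comp_clm {γ δ : ℂ → ℂ × ℂ} {k : ℕ} (hγ : AnalyticAt ℂ γ 0)
    (hδ : AnalyticAt ℂ δ 0) (h : SameJet k γ δ) (L : ℂ × ℂ →L[ℂ] ℂ) :
    cX ^ (k + 1) ∣ germX (fun t => L (δ t)) - germX fun t => L (γ t) := by
  have hLγ : AnalyticAt ℂ (fun t => L (γ t)) 0 := (L.analyticAt _).comp hγ
  have hLδ : AnalyticAt ℂ (fun t => L (δ t)) 0 := (L.analyticAt _).comp hδ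
  have h1 : germX (fun t => L (δ t)) - germX (fun t => L (γ t))
      = germX fun t => L (δ t) - L (γ t) :=
    (germ_sub (analyticAt_comp_fst hLδ) (analyticAt_comp_fst hLγ)).symm
  rw [h1]
  apply cX_pow_dvd_germX (hLδ.fun_sub hLγ)
  rw [natCast_le_analyticOrderAt_iff_iteratedDeriv_eq_zero (hLδ.fun_sub hLγ)]
  intro j hj
  rw [iteratedDeriv_fun_sub hLδ.contDiffAt hLγ.contDiffAt, sub_eq_zero]
  have key : ∀ {γ : ℂ → ℂ × ℂ}, AnalyticAt ℂ γ 0 → iteratedDeriv j (fun t => L (γ t)) 0 =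
      L (iteratedFDeriv ℂ j γ 0 fun _ => 1) := fun hγ => by
    rw [iteratedDeriv_eq_iteratedFDeriv]
    have := L.iteratedFDeriv_comp_left (i := j) (hγ.contDiffAt (n := ⊤)) (by exact_mod_cast le_top)
    change (iteratedFDeriv ℂ j (L ∘ _) 0) _ = _
    rw [this]
    rfl
  rw [key hγ, key hδ, h j (by omega)]

theorem param_finitely_determined {γ : ℂ → ℂ × ℂ} (hγ : AnalyticAt ℂ γ 0) :
    (inflParam γ ≠ ⊤ → ∃ k : ℕ, ∀ δ : ℂ → ℂ × ℂ, AnalyticAt ℂ δ 0 → SameJet k γ δ →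
      inflParam δ = inflParam γ) ∧
    (vertParam γ ≠ ⊤ → ∃ k : ℕ, ∀ δ : ℂ → ℂ × ℂ, AnalyticAt ℂ δ 0 → SameJet k γ δ →
      vertParam δ = vertParam γ) := by
  have key : ∀ (n : ℕ) (δ : ℂ → ℂ × ℂ), AnalyticAt ℂ δ 0 → SameJet (n + 2) γ δ →
      cX ^ n ∣ iP (xG δ) (yG δ) - iP (xG γ) (yG γ) ∧
      cX ^ n ∣ vP (xG δ) (yG δ) - vP (xG γ) (yG γ) := fun n δ hδ hj =>
    iP_vP_congr (hj.comp_clm hγ hδ (ContinuousLinearMap.fst ℂ ℂ ℂ))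
      (hj.comp_clm hγ hδ (ContinuousLinearMap.snd ℂ ℂ ℂ))
  constructor
  · intro h
    obtain ⟨n, hn⟩ := ENat.ne_top_iff_exists.1 h
    -- Equal (n + 3)-jets agree modulo t ^ (n + 4); after three derivatives the invariants agree
    -- modulo t ^ (n + 1), which determines an order equal to n.
    refine ⟨n + 1 + 2, fun δ hδ hj => ?_⟩
    rw [(inflParam_vertParam_eq hδ).1]
    rw [(inflParam_vertParam_eq hγ).1] at hn ⊢
    refine ordX_eq_of_cX_pow_dvd_sub ?_ (key (n + 1) δ hδ hj).1
    rw [← hn]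
    exact_mod_cast n.lt_succ_self
  · intro h
    obtain ⟨n, hn⟩ := ENat.ne_top_iff_exists.1 h
    refine ⟨n + 1 + 2, fun δ hδ hj => ?_⟩
    rw [(inflParam_vertParam_eq hδ).2]
    rw [(inflParam_vertParam_eq hγ).2] at hn ⊢
    refine ordX_eq_of_cX_pow_dvd_sub ?_ (key (n + 1) δ hδ hj).2
    rw [← hn]
    exact_mod_cast n.lt_succ_self

end jets

/-! ### Circles and lines along parametrised curves -/

namespace CircleOrLine

variable (c : CircleOrLine)

/-- The restriction of the equation of a circle or line to a parametrised curve. -/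
def along (x y : OO) : OO := c.A • (x ^ 2 + y ^ 2) + (2 * c.B) • x + (2 * c.C) • y

theorem germX_eqn {γ : ℂ → ℂ × ℂ} (hγ : AnalyticAt ℂ γ 0) :
    germX (fun t => c.eqn (γ t)) = c.along (xG γ) (yG γ) := by
  have hx := analyticAt_comp_fst (analyticAt_fst_curve hγ)
  have hy := analyticAt_comp_fst (analyticAt_snd_curve hγ)
  simp only [germX, eqn, along, xG, yG]
  simp (disch := fun_prop) only [germ_add, germ_mul, germ_pow, germ_const]
  simp only [Algebra.smul_def, map_mul]

theorem dX_along (x y : OO) : dX (c.along x y) =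
    2 * (dX x * (c.A • x + c.B • 1) + dX y * (c.A • y + c.C • 1)) := by
  simp only [along, map_add, Derivation.map_smul, Derivation.leibniz_pow, smul_eq_mul]
  simp only [Algebra.smul_def, map_mul, map_ofNat]
  push_cast
  ring

theorem dX_dX_along (x y : OO) : dX (dX (c.along x y)) =
    2 * (dX (dX x) * (c.A • x + c.B • 1) + dX (dX y) * (c.A • y + c.C • 1)
      + c.A • (dX x ^ 2 + dX y ^ 2)) := by
  have h2 : dX (2 : OO) = 0 := dX.map_natCast 2
  rw [dX_along]
  simp only [map_add, Derivation.map_smul, Derivation.leibniz, smul_eq_mul, h2,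
    Derivation.map_one_eq_zero]
  simp only [Algebra.smul_def]
  ring

theorem dX_dX_dX_along (x y : OO) : dX (dX (dX (c.along x y))) =
    2 * (dX (dX (dX x)) * (c.A • x + c.B • 1) + dX (dX (dX y)) * (c.A • y + c.C • 1)
      + c.A • (3 * (dX x * dX (dX x) + dX y * dX (dX y)))) := by
  have h2 : dX (2 : OO) = 0 := dX.map_natCast 2
  rw [dX_dX_along]
  simp only [map_add, Derivation.map_smul, Derivation.leibniz, smul_eq_mul, h2, pow_two,
    Derivation.map_one_eq_zero]
  simp only [Algebra.smul_def]
  ring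

theorem exists_regularCurve (h : c.B ≠ 0 ∨ c.C ≠ 0) :
    ∃ α, IsRegularCurve α ∧ ∀ᶠ t in 𝓝 (0 : ℂ), α t ∈ c.carrier := by
  obtain ⟨α, hα, hF⟩ := (c.isSmoothGerm_germEqn h).exists_regularCurve
  rw [← germ_eqn, ordAlong_germ hα.analyticAt hα.map_zero (c.analyticAt_eqn 0),
    analyticOrderAt_eq_top] at hF
  exact ⟨α, hα, hF⟩

end CircleOrLine

section along

variable {x y : OO}

/-- Here i is the Wronskian of x' and y', so its vanishing gives y' = ρx' even where x' has zeros;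
integrating from the origin gives y = ρx. -/
theorem exists_line_along_eq_zero (hx : x ∈ RX) (hy : y ∈ RX) (hx0 : ev x = 0) (hy0 : ev y = 0)
    (hi : iP x y = 0) : ∃ c : CircleOrLine, c.IsLine ∧ c.along x y = 0 := by
  by_cases h : dX x = 0
  · refine ⟨⟨0, 1, 0, by simp⟩, rfl, ?_⟩
    rw [CircleOrLine.along, mem_RX_eq_const hx h, hx0]
    simp
  · obtain ⟨ρ, hρ⟩ := exists_eq_smul_of_wronskian_RX (dX_mem_RX hy) (dX_mem_RX hx) h (by
      rw [iP, sub_eq_zero] at hi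
      rw [hi, mul_comm])
    have h1 := mem_RX_eq_const (RX.sub_mem hy (RX.smul_mem hx ρ)) (by
      rw [map_sub, Derivation.map_smul, hρ, sub_self])
    rw [map_sub, map_smul, hx0, hy0, smul_zero, sub_zero, zero_smul, sub_eq_zero] at h1
    refine ⟨⟨0, -ρ, 1, by simp⟩, rfl, ?_⟩
    rw [CircleOrLine.along, h1]
    simp only [Algebra.smul_def, map_mul, map_neg, map_one, map_zero]
    ring

/-- The parametrised counterpart of the argument for equations: v = 0 makes the centre of curvature
(α, β) constant. Vanishing Wronskians against i replace division by i, which may vanish at the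
origin. -/
theorem exists_circleOrLine_along_eq_zero (hx : x ∈ RX) (hy : y ∈ RX) (hx0 : ev x = 0)
    (hy0 : ev y = 0) (hv : vP x y = 0) :
    ∃ c : CircleOrLine, (c.B ≠ 0 ∨ c.C ≠ 0) ∧ c.along x y = 0 := by
  by_cases hi : iP x y = 0
  · obtain ⟨c, hc, h⟩ := exists_line_along_eq_zero hx hy hx0 hy0 hi
    exact ⟨c, hc.ne_zero, h⟩
  have hx1 := dX_mem_RX hx
  have hy1 := dX_mem_RX hy
  have hE := RX.add_mem (RX.pow_mem hx1 2) (RX.pow_mem hy1 2)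
  have hiR := iP_mem_RX hx hy
  have hJ : iP x y = dX x * dX (dX y) - dX y * dX (dX x) := rfl
  rw [vP_eq] at hv
  obtain ⟨α, hα⟩ := exists_eq_smul_of_wronskian_RX
    (p := x * iP x y - (dX x ^ 2 + dX y ^ 2) * dX y) (q := iP x y)
    (RX.sub_mem (RX.mul_mem hx hiR) (RX.mul_mem hE hy1)) hiR hi (by
      rw [← sub_eq_zero]
      simp only [map_sub, map_add, Derivation.leibniz, pow_two, smul_eq_mul]
      linear_combination dX y * hv + iP x y * dX x * hJ)
  obtain ⟨β, hβ⟩ := exists_eq_smul_of_wronskian_RX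
    (p := y * iP x y + (dX x ^ 2 + dX y ^ 2) * dX x) (q := iP x y)
    (RX.add_mem (RX.mul_mem hy hiR) (RX.mul_mem hE hx1)) hiR hi (by
      rw [← sub_eq_zero]
      simp only [map_add, Derivation.leibniz, pow_two, smul_eq_mul]
      linear_combination -(dX x) * hv + iP x y * dX y * hJ)
  have h1 : iP x y * dX (x ^ 2 + y ^ 2 - (2 * α) • x - (2 * β) • y) = 0 := by
    simp only [map_sub, map_add, Derivation.map_smul, Derivation.leibniz, pow_two, smul_eq_mul]
    simp only [Algebra.smul_def, map_mul, map_ofNat] at hα hβ ⊢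
    linear_combination 2 * dX x * hα + 2 * dX y * hβ
  have h2 := mem_RX_eq_const (RX.sub_mem (RX.sub_mem (RX.add_mem (RX.pow_mem hx 2)
    (RX.pow_mem hy 2)) (RX.smul_mem hx (2 * α))) (RX.smul_mem hy (2 * β)))
    ((mul_eq_zero.1 h1).resolve_left hi)
  have h3 : ev (x ^ 2 + y ^ 2 - (2 * α) • x - (2 * β) • y) = 0 := by simp [hx0, hy0]
  rw [h3, zero_smul] at h2
  by_cases hαβ : α = 0 ∧ β = 0
  · have hI : algebraMap ℂ OO Complex.I ^ 2 = -1 := by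
      rw [← map_pow, Complex.I_sq, map_neg, map_one]
    rw [hαβ.1, hαβ.2, mul_zero, zero_smul, zero_smul, sub_zero, sub_zero] at h2
    have h4 : (x + algebraMap ℂ OO Complex.I * y) * (x - algebraMap ℂ OO Complex.I * y) = 0 := by
      linear_combination h2 - y ^ 2 * hI
    rcases mul_eq_zero.1 h4 with h | h
    · refine ⟨⟨0, 1, Complex.I, by simp⟩, by simp, ?_⟩
      simp only [CircleOrLine.along, Algebra.smul_def, map_mul, map_one, map_zero]
      linear_combination algebraMap ℂ OO 2 * h
    · refine ⟨⟨0, 1, -Complex.I, by simp⟩, by simp, ?_⟩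
      simp only [CircleOrLine.along, Algebra.smul_def, map_mul, map_one, map_zero, map_neg]
      linear_combination algebraMap ℂ OO 2 * h
  · refine ⟨⟨1, -α, -β, by simp⟩, ?_, ?_⟩
    · by_contra! h
      exact hαβ ⟨neg_eq_zero.1 h.1, neg_eq_zero.1 h.2⟩
    · rw [← h2]
      simp only [CircleOrLine.along, Algebra.smul_def, map_mul, map_one, map_neg]
      ring

theorem iP_eq_zero_of_along {c : CircleOrLine} (hc : c.IsLine) (h : c.along x y = 0) :
    iP x y = 0 := by
  have h1 := c.dX_along x y
  have h2 := c.dX_dX_along x y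
  rw [h, map_zero, show c.A = 0 from hc] at h1
  rw [h, map_zero, map_zero, show c.A = 0 from hc] at h2
  simp only [zero_smul, zero_add, add_zero] at h1 h2
  simp only [Algebra.smul_def, mul_one] at h1 h2
  have two : (2 : OO) ≠ 0 := by
    intro h
    have := congrArg ev h
    rw [map_ofNat, map_zero] at this
    norm_num at this
  replace h1 := (mul_eq_zero.1 h1.symm).resolve_left two
  replace h2 := (mul_eq_zero.1 h2.symm).resolve_left two
  have hB : algebraMap ℂ OO c.B * iP x y = 0 := by
    rw [iP]
    linear_combination dX (dX y) * h1 - dX y * h2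
  have hC : algebraMap ℂ OO c.C * iP x y = 0 := by
    rw [iP]
    linear_combination dX x * h2 - dX (dX x) * h1
  have hinj : ∀ b : ℂ, algebraMap ℂ OO b = 0 → b = 0 := fun b hb =>
    (map_eq_zero_iff _ (algebraMap ℂ OO).injective).1 hb
  rcases hc.ne_zero with h | h
  · exact (mul_eq_zero.1 hB).resolve_left fun h' => h (hinj _ h')
  · exact (mul_eq_zero.1 hC).resolve_left fun h' => h (hinj _ h')

/-- Eliminating between the first three derivatives of the circle equation gives pv = qv = 0, where
p = Ax + B and q = Ay + C. At the origin p and q take the values B and C, so one of them is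
non-zero. -/
theorem vP_eq_zero_of_along {c : CircleOrLine} (hc : c.B ≠ 0 ∨ c.C ≠ 0) (hx0 : ev x = 0)
    (hy0 : ev y = 0) (h : c.along x y = 0) : vP x y = 0 := by
  have h1 := c.dX_along x y
  have h2 := c.dX_dX_along x y
  have h3 := c.dX_dX_dX_along x y
  rw [h, map_zero] at h1 h2 h3
  rw [map_zero] at h2 h3
  rw [map_zero] at h3
  have two : (2 : OO) ≠ 0 := by
    intro h
    have := congrArg ev h
    rw [map_ofNat, map_zero] at this
    norm_num at this
  replace h1 := (mul_eq_zero.1 h1.symm).resolve_left two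
  replace h2 := (mul_eq_zero.1 h2.symm).resolve_left two
  replace h3 := (mul_eq_zero.1 h3.symm).resolve_left two
  have hp : c.A • x + c.B • 1 ≠ 0 ∨ c.A • y + c.C • 1 ≠ 0 := by
    refine hc.imp (fun hB h => hB ?_) (fun hC h => hC ?_)
    · simpa [hx0] using congrArg ev h
    · simpa [hy0] using congrArg ev h
  set p := c.A • x + c.B • (1 : OO)
  set q := c.A • y + c.C • (1 : OO)
  rw [Algebra.smul_def] at h2 h3
  have hvp : p * vP x y = 0 := by
    rw [vP]
    linear_combination (-3 * (dX x * dX (dX x) + dX y * dX (dX y)) * dX (dX y)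
        + (dX x ^ 2 + dX y ^ 2) * dX (dX (dX y))) * h1
      + 3 * (dX x * dX (dX x) + dX y * dX (dX y)) * dX y * h2
      - (dX x ^ 2 + dX y ^ 2) * dX y * h3
  have hvq : q * vP x y = 0 := by
    rw [vP]
    linear_combination (3 * (dX x * dX (dX x) + dX y * dX (dX y)) * dX (dX x)
        - (dX x ^ 2 + dX y ^ 2) * dX (dX (dX x))) * h1
      - 3 * (dX x * dX (dX x) + dX y * dX (dX y)) * dX x * h2
      + (dX x ^ 2 + dX y ^ 2) * dX x * h3
  rcases hp with h | h
  · exact (mul_eq_zero.1 hvp).resolve_left h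
  · exact (mul_eq_zero.1 hvq).resolve_left h

end along

/-! ### Circles and lines contained in a parametrised curve -/

/-- The circle or line obtained by exchanging the coordinates. -/
def CircleOrLine.swap (c : CircleOrLine) : CircleOrLine :=
  ⟨c.A, c.C, c.B, fun h => c.nonzero (by
    simp only [Prod.ext_iff] at h
    exact Prod.ext h.1 (Prod.ext h.2.2 h.2.1))⟩

theorem CircleOrLine.eqn_swap (c : CircleOrLine) (z : ℂ × ℂ) : c.swap.eqn z.swap = c.eqn z := by
  simp only [eqn, swap, Prod.fst_swap, Prod.snd_swap]
  ring

theorem IsParametrisation.swap {γ : ℂ → ℂ × ℂ} (hγ : IsParametrisation γ) :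
    IsParametrisation fun t => (γ t).swap := by
  have hs : ∀ p, AnalyticAt ℂ (Prod.swap : ℂ × ℂ → ℂ × ℂ) p := fun p =>
    analyticAt_snd.prod analyticAt_fst
  refine ⟨(hs _).comp hγ.analyticAt, by rw [hγ.map_zero]; rfl, fun h => hγ.nonconstant ?_⟩
  filter_upwards [h] with t ht
  have := congrArg Prod.swap ht
  simpa using this

/-- When C ≠ 0, points of the circle near the origin are determined by their abscissa. The abscissa
of γ is then non-constant, hence open at 0, so γ covers every point of the circle near the origin.
-/
theorem paramContains_of_eqn_eq_zero_aux {γ : ℂ → ℂ × ℂ} (hγ : IsParametrisation γ)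
    {c : CircleOrLine} (hC : c.C ≠ 0) (h : ∀ᶠ t in 𝓝 (0 : ℂ), c.eqn (γ t) = 0) :
    ParamContains γ c.carrier := by
  have htend := tendsto_of_analyticAt hγ.analyticAt hγ.map_zero
  have hx := analyticAt_fst_curve hγ.analyticAt
  have hcont : ∀ᶠ z in 𝓝 (0 : ℂ × ℂ), c.A * (z.1 + z.2) + 2 * c.C ≠ 0 := by
    have h1 : ContinuousAt (fun z : ℂ × ℂ => c.A * (z.1 + z.2) + 2 * c.C) 0 := by fun_prop
    exact h1.eventually_ne (by simpa using hC)
  obtain ⟨ε, hε, hball⟩ := Metric.eventually_nhds_iff_ball.1 hcont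
  have huniq : ∀ z w : ℂ × ℂ, ‖z‖ < ε → ‖w‖ < ε → c.eqn z = 0 → c.eqn w = 0 → z.1 = w.1 →
      z = w := by
    intro z w hz hw hcz hcw h1
    have h2 : (z.2 - w.2) * (c.A * (z.2 + w.2) + 2 * c.C) = 0 := by
      simp only [CircleOrLine.eqn] at hcz hcw
      rw [h1] at hcz
      linear_combination hcz - hcw
    have h3 : c.A * (z.2 + w.2) + 2 * c.C ≠ 0 := hball (z.2, w.2) (by
      rw [mem_ball_zero_iff, Prod.norm_def]
      exact max_lt ((norm_snd_le z).trans_lt hz) ((norm_snd_le w).trans_lt hw))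
    exact Prod.ext h1 (sub_eq_zero.1 ((mul_eq_zero.1 h2).resolve_right h3))
  have hsmall : ∀ᶠ z in 𝓝 (0 : ℂ × ℂ), ‖z‖ < ε := by
    filter_upwards [Metric.ball_mem_nhds (0 : ℂ × ℂ) hε] with z hz using mem_ball_zero_iff.1 hz
  have hopen : 𝓝 (0 : ℂ) ≤ map (fun t => (γ t).1) (𝓝 0) := by
    have h1 := hx.eventually_constant_or_nhds_le_map_nhds
    rw [hγ.map_zero] at h1
    refine h1.resolve_left fun hconst => hγ.nonconstant ?_
    filter_upwards [hconst, h, htend.eventually hsmall] with t h2 h3 h4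
    refine huniq (γ t) 0 h4 (by simpa using hε) h3 (by simp [CircleOrLine.eqn]) h2
  intro U hU
  rw [eventually_nhdsWithin_iff]
  have hV : ∀ᶠ t in 𝓝 (0 : ℂ), t ∈ U ∧ c.eqn (γ t) = 0 ∧ ‖γ t‖ < ε :=
    (show ∀ᶠ t in 𝓝 (0 : ℂ), t ∈ U from hU).and (h.and (htend.eventually hsmall))
  have h5 : ∀ᶠ s in 𝓝 (0 : ℂ), ∃ t, (t ∈ U ∧ c.eqn (γ t) = 0 ∧ ‖γ t‖ < ε) ∧ (γ t).1 = s :=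
    hopen (image_mem_map hV)
  filter_upwards [(continuous_fst.tendsto (0 : ℂ × ℂ)).eventually h5, hsmall] with z h6 h7 hz
  obtain ⟨t, ⟨htU, htc, htn⟩, ht⟩ := h6
  exact ⟨t, htU, huniq _ _ htn h7 htc hz ht⟩

theorem paramContains_of_eqn_eq_zero {γ : ℂ → ℂ × ℂ} (hγ : IsParametrisation γ)
    {c : CircleOrLine} (hc : c.B ≠ 0 ∨ c.C ≠ 0) (h : ∀ᶠ t in 𝓝 (0 : ℂ), c.eqn (γ t) = 0) :
    ParamContains γ c.carrier := by
  rcases hc with hB | hC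
  · have h1 := paramContains_of_eqn_eq_zero_aux hγ.swap (c := c.swap) hB (by
      simpa only [c.eqn_swap] using h)
    intro U hU
    have h2 := h1 U hU
    rw [eventually_nhdsWithin_iff] at h2 ⊢
    have hs : Tendsto (Prod.swap : ℂ × ℂ → ℂ × ℂ) (𝓝 0) (𝓝 0) :=
      continuous_swap.tendsto' 0 0 rfl
    filter_upwards [hs.eventually h2] with z hz hzc
    obtain ⟨t, htU, ht⟩ := hz ((c.eqn_swap z).trans hzc)
    exact ⟨t, htU, Prod.swap_injective ht⟩
  · exact paramContains_of_eqn_eq_zero_aux hγ hC h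

/-- Otherwise t = 0 is an isolated zero of the equation along γ. The image of a small disc then
meets the circle only at the origin and cannot contain its germ. -/
theorem eqn_eq_zero_of_paramContains {γ : ℂ → ℂ × ℂ} (hγ : IsParametrisation γ)
    {c : CircleOrLine} (hc : c.B ≠ 0 ∨ c.C ≠ 0) (h : ParamContains γ c.carrier) :
    ∀ᶠ t in 𝓝 (0 : ℂ), c.eqn (γ t) = 0 := by
  have han : AnalyticAt ℂ (fun t => c.eqn (γ t)) 0 := (c.analyticAt_eqn _).comp hγ.analyticAt
  refine han.eventually_eq_zero_or_eventually_ne_zero.resolve_right fun hne => ?_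
  obtain ⟨α, hα, hαc⟩ := c.exists_regularCurve hc
  rw [eventually_nhdsWithin_iff] at hne
  have h1 := h _ hne
  rw [eventually_nhdsWithin_iff] at h1
  have hα0 : α =ᶠ[𝓝 0] fun _ => 0 := by
    filter_upwards [(tendsto_of_analyticAt hα.analyticAt hα.map_zero).eventually h1, hαc]
      with s hs hsc
    obtain ⟨t, ht, hts⟩ := hs hsc
    have h2 : c.eqn (γ t) = 0 := by rw [hts]; exact hsc
    by_cases ht0 : t = 0
    · rw [← hts, ht0, hγ.map_zero]
    · exact absurd h2 (ht ht0)
  exact hα.deriv_ne_zero (by rw [hα0.deriv_eq, deriv_const])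

theorem along_eq_zero_iff {γ : ℂ → ℂ × ℂ} (hγ : IsParametrisation γ) {c : CircleOrLine}
    (hc : c.B ≠ 0 ∨ c.C ≠ 0) : c.along (xG γ) (yG γ) = 0 ↔ ParamContains γ c.carrier := by
  have han : AnalyticAt ℂ (fun t => c.eqn (γ t)) 0 := (c.analyticAt_eqn _).comp hγ.analyticAt
  rw [← c.germX_eqn hγ.analyticAt, germX_eq_zero_iff han]
  exact ⟨paramContains_of_eqn_eq_zero hγ hc, eqn_eq_zero_of_paramContains hγ hc⟩

theorem ev_xG {γ : ℂ → ℂ × ℂ} (hγ : AnalyticAt ℂ γ 0) : ev (xG γ) = (γ 0).1 :=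
  ev_germ (analyticAt_comp_fst (analyticAt_fst_curve hγ))

theorem ev_yG {γ : ℂ → ℂ × ℂ} (hγ : AnalyticAt ℂ γ 0) : ev (yG γ) = (γ 0).2 :=
  ev_germ (analyticAt_comp_fst (analyticAt_snd_curve hγ))

theorem inflParam_eq_top_iff {γ : ℂ → ℂ × ℂ} (hγ : IsParametrisation γ) :
    inflParam γ = ⊤ ↔ ∃ c : CircleOrLine, c.IsLine ∧ ParamContains γ c.carrier := by
  have hx := xG_mem_RX hγ.analyticAt
  have hy := yG_mem_RX hγ.analyticAt
  have hx0 : ev (xG γ) = 0 := by rw [ev_xG hγ.analyticAt, hγ.map_zero]; rfl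
  have hy0 : ev (yG γ) = 0 := by rw [ev_yG hγ.analyticAt, hγ.map_zero]; rfl
  rw [(inflParam_vertParam_eq hγ.analyticAt).1, ordX_eq_top_iff (iP_mem_RX hx hy)]
  constructor
  · intro h
    obtain ⟨c, hc, h⟩ := exists_line_along_eq_zero hx hy hx0 hy0 h
    exact ⟨c, hc, (along_eq_zero_iff hγ hc.ne_zero).1 h⟩
  · rintro ⟨c, hc, h⟩
    exact iP_eq_zero_of_along hc ((along_eq_zero_iff hγ hc.ne_zero).2 h)

theorem vertParam_eq_top_iff {γ : ℂ → ℂ × ℂ} (hγ : IsParametrisation γ) :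
    vertParam γ = ⊤ ↔ ∃ c : CircleOrLine, ParamContains γ c.carrier := by
  have hx := xG_mem_RX hγ.analyticAt
  have hy := yG_mem_RX hγ.analyticAt
  have hx0 : ev (xG γ) = 0 := by rw [ev_xG hγ.analyticAt, hγ.map_zero]; rfl
  have hy0 : ev (yG γ) = 0 := by rw [ev_yG hγ.analyticAt, hγ.map_zero]; rfl
  rw [(inflParam_vertParam_eq hγ.analyticAt).2, ordX_eq_top_iff (vP_mem_RX hx hy)]
  constructor
  · intro h
    obtain ⟨c, hc, h⟩ := exists_circleOrLine_along_eq_zero hx hy hx0 hy0 h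
    exact ⟨c, (along_eq_zero_iff hγ hc).1 h⟩
  · rintro ⟨c, h⟩
    obtain ⟨c', hc', h'⟩ : ∃ c' : CircleOrLine, (c'.B ≠ 0 ∨ c'.C ≠ 0) ∧
        ParamContains γ c'.carrier := by
      by_cases hc : c.B ≠ 0 ∨ c.C ≠ 0
      · exact ⟨c, hc, h⟩
      · push Not at hc
        obtain ⟨c', -, hc', hle⟩ := c.exists_isLine_of_eq_zero hc.1 hc.2
        exact ⟨c', hc', fun U hU => (h U hU).filter_mono (nhdsWithin_mono 0 hle)⟩
    exact vP_eq_zero_of_along hc' hx0 hy0 ((along_eq_zero_iff hγ hc').2 h')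

/-! ### Affine invariance of the invariants of an equation -/

section affine

variable {f : ℂ × ℂ → ℂ} {p : ℂ × ℂ}

/-- The partial derivatives of a composition with an affine map. -/
theorem dx_dy_comp_affine (B : (ℂ × ℂ) ≃ᵃ[ℂ] (ℂ × ℂ)) (hf : AnalyticAt ℂ f (B p)) :
    dx (fun z => f (B z)) p =
      (B.linear (1, 0)).1 * dx f (B p) + (B.linear (1, 0)).2 * dy f (B p) ∧
    dy (fun z => f (B z)) p =
      (B.linear (0, 1)).1 * dx f (B p) + (B.linear (0, 1)).2 * dy f (B p) := by
  let L : ℂ × ℂ →L[ℂ] ℂ × ℂ := LinearMap.toContinuousLinearMap B.linear.toLinearMap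
  have hB : HasFDerivAt B L p := by
    have h1 : (B : ℂ × ℂ → ℂ × ℂ) = fun z => L z + B 0 := by
      funext z
      have h1 := B.map_vadd 0 z
      rwa [vadd_eq_add, vadd_eq_add, add_zero] at h1
    rw [h1]
    exact L.hasFDerivAt.add_const _
  have h2 := (hf.differentiableAt.hasFDerivAt.comp p hB).fderiv
  have h3 : ∀ w : ℂ × ℂ, fderiv ℂ f (B p) w = w.1 * dx f (B p) + w.2 * dy f (B p) := fun w => by
    have h4 : w = w.1 • ((1, 0) : ℂ × ℂ) + w.2 • ((0, 1) : ℂ × ℂ) := by ext <;> simp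
    conv_lhs => rw [h4]
    rw [map_add, map_smul, map_smul]
    rfl
  constructor
  · rw [← h3, dx]
    change fderiv ℂ (f ∘ B) p _ = _
    rw [h2]
    rfl
  · rw [← h3, dy]
    change fderiv ℂ (f ∘ B) p _ = _
    rw [h2]
    rfl

end affine

/-! ### Reduction to the origin by translation -/

section translation

theorem two_ne_zero_OO : (2 : OO) ≠ 0 := by
  intro h
  have := congrArg ev h
  rw [map_ofNat, map_zero] at this
  norm_num at this

theorem intersectionNumber_translate {f g : ℂ × ℂ → ℂ} {p : ℂ × ℂ} (hf : AnalyticAt ℂ f p)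
    (hg : AnalyticAt ℂ g p) : intersectionNumber f g p =
      intersectionNumber (fun z => f (z + p)) (fun z => g (z + p)) 0 := by
  have h1 : AnalyticAt ℂ (fun z : ℂ × ℂ => z + p) 0 := by fun_prop
  have h2 : AnalyticAt ℂ (fun z : ℂ × ℂ => z - p) p := by fun_prop
  let e := pullbackEquiv (p := 0) (q := p) (fun z => z + p) (fun z => z - p) h1 (by simp) h2
    (by simp) (by simp) (by simp)
  have h3 := codim_span_pair_equiv e (germAt f p) (germAt g p)
  have h4 : ∀ {f : ℂ × ℂ → ℂ}, AnalyticAt ℂ f p → e (germAt f p) = germAt (fun z => f (z + p)) 0 :=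
    fun hf => pullback_germAt h1 (by simp) hf
  rw [h4 hf, h4 hg] at h3
  exact h3.symm

theorem dx_dy_translate (f : ℂ × ℂ → ℂ) (p : ℂ × ℂ) :
    dx (fun z => f (z + p)) = (fun z => dx f (z + p)) ∧
    dy (fun z => f (z + p)) = fun z => dy f (z + p) := by
  constructor
  · funext z
    rw [dx, fderiv_comp_add_right, dx]
  · funext z
    rw [dy, fderiv_comp_add_right, dy]

theorem iEq_vEq_translate (f : ℂ × ℂ → ℂ) (p : ℂ × ℂ) :
    iEq (fun z => f (z + p)) = (fun z => iEq f (z + p)) ∧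
    vEq (fun z => f (z + p)) = fun z => vEq f (z + p) := by
  have h := fun f => (dx_dy_translate f p).1
  have h' := fun f => (dx_dy_translate f p).2
  have hi : iEq (fun z => f (z + p)) = (fun z => iEq f (z + p)) := by
    funext z
    simp only [iEq, h, h']
  refine ⟨hi, ?_⟩
  funext z
  simp only [vEq, hi, h, h']

theorem inflEq_vertEq_translate {f : ℂ × ℂ → ℂ} {p : ℂ × ℂ} (hf : AnalyticAt ℂ f p) :
    inflEq f p = inflEq (fun z => f (z + p)) 0 ∧ vertEq f p = vertEq (fun z => f (z + p)) 0 := by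
  rw [inflEq, vertEq, intersectionNumber_translate hf (analyticAt_iEq hf),
    intersectionNumber_translate hf (analyticAt_vEq hf), inflEq, vertEq,
    (iEq_vEq_translate f p).1, (iEq_vEq_translate f p).2]
  exact ⟨rfl, rfl⟩

end translation

/-! ### Linear changes of coordinates in an equation -/

section linear

theorem analyticAt_linearEquiv (L : (ℂ × ℂ) ≃ₗ[ℂ] (ℂ × ℂ)) (p : ℂ × ℂ) : AnalyticAt ℂ L p :=
  (LinearMap.toContinuousLinearMap L.toLinearMap).analyticAt p

/-- The automorphism of the ring of germs induced by a linear change of coordinates. -/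
def linEquiv (L : (ℂ × ℂ) ≃ₗ[ℂ] (ℂ × ℂ)) : OO ≃ₐ[ℂ] OO :=
  pullbackEquiv (p := 0) (q := 0) L L.symm (analyticAt_linearEquiv L 0) L.map_zero
    (analyticAt_linearEquiv L.symm 0) L.symm.map_zero L.apply_symm_apply L.symm_apply_apply

variable (L : (ℂ × ℂ) ≃ₗ[ℂ] (ℂ × ℂ)) (F : OO)

theorem linEquiv_germ {f : ℂ × ℂ → ℂ} (hf : AnalyticAt ℂ f 0) :
    linEquiv L (germ f) = germ fun z => f (L z) :=
  pullback_germAt (p := 0) (q := 0) (φ := L) (analyticAt_linearEquiv L 0) L.map_zero hf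

theorem dX_dY_linEquiv :
    dX (linEquiv L F) = (L (1, 0)).1 • linEquiv L (dX F) + (L (1, 0)).2 • linEquiv L (dY F) ∧
    dY (linEquiv L F) = (L (0, 1)).1 • linEquiv L (dX F) + (L (0, 1)).2 • linEquiv L (dY F) := by
  obtain ⟨f, hf, rfl⟩ := exists_germ_eq F
  have hcomp : ∀ {f : ℂ × ℂ → ℂ}, AnalyticAt ℂ f 0 → AnalyticAt ℂ (fun z => f (L z)) 0 :=
    fun {f} hf => AnalyticAt.comp (g := f) (by rwa [L.map_zero]) (analyticAt_linearEquiv L 0)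
  have hfL := hcomp hf
  have h1 := hcomp (analyticAt_dx hf)
  have h2 := hcomp (analyticAt_dy hf)
  have htend : Tendsto L (𝓝 0) (𝓝 0) := by
    have := (analyticAt_linearEquiv L 0).continuousAt.tendsto
    rwa [L.map_zero] at this
  have key : ∀ᶠ z in 𝓝 (0 : ℂ × ℂ), AnalyticAt ℂ f (L z) := htend.eventually hf.eventually_analyticAt
  rw [linEquiv_germ L hf, dX_germ hf, dY_germ hf, dX_germ hfL, dY_germ hfL,
    linEquiv_germ L (analyticAt_dx hf), linEquiv_germ L (analyticAt_dy hf)]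
  simp only [Algebra.smul_def]
  rw [← germ_const_mul _ h1, ← germ_const_mul _ h2, ← germ_const_mul _ h1, ← germ_const_mul _ h2,
    ← germ_add (analyticAt_const.fun_mul h1) (analyticAt_const.fun_mul h2),
    ← germ_add (analyticAt_const.fun_mul h1) (analyticAt_const.fun_mul h2)]
  constructor
  · apply germ_congr
    filter_upwards [key] with z hz
    exact (dx_dy_comp_affine L.toAffineEquiv hz).1
  · apply germ_congr
    filter_upwards [key] with z hz
    exact (dx_dy_comp_affine L.toAffineEquiv hz).2

theorem hamD_linEquiv (G : OO) : hamD (linEquiv L F) (linEquiv L G) =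
    ((L (1, 0)).1 * (L (0, 1)).2 - (L (0, 1)).1 * (L (1, 0)).2) • linEquiv L (hamD F G) := by
  rw [hamD_apply, hamD_apply, (dX_dY_linEquiv L F).1, (dX_dY_linEquiv L F).2,
    (dX_dY_linEquiv L G).1, (dX_dY_linEquiv L G).2]
  simp only [Algebra.smul_def, map_sub, map_mul]
  ring

theorem iO_linEquiv : iO (linEquiv L F) =
    ((L (1, 0)).1 * (L (0, 1)).2 - (L (0, 1)).1 * (L (1, 0)).2) ^ 2 • linEquiv L (iO F) := by
  simp only [iO, (dX_dY_linEquiv L _).1, (dX_dY_linEquiv L _).2, map_add, Derivation.map_smul,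
    map_sub, map_mul, map_pow, map_ofNat, dX_dY_comm]
  simp only [Algebra.smul_def, map_sub, map_mul, map_pow]
  ring

/-- In this form v depends only on E = F_x² + F_y², i and D. A similarity rescales these by a² + b²,
det² and det, so invariance needs no third derivatives; the factor 2 clears the fraction. -/
theorem two_mul_vO : 2 * vO F = 3 * hamD F (dX F ^ 2 + dY F ^ 2) * iO F
    - 2 * (dX F ^ 2 + dY F ^ 2) * hamD F (iO F) := by
  rw [vO_eq_hamD]
  simp only [map_add, Derivation.leibniz, pow_two, smul_eq_mul]
  ring

variable {L}

theorem vO_linEquiv {a b s : ℂ} (hs : s ^ 2 = 1) (h1 : L (1, 0) = (a, b))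
    (h2 : L (0, 1) = (-(s * b), s * a)) :
    vO (linEquiv L F) = (s * (a ^ 2 + b ^ 2) ^ 4) • linEquiv L (vO F) := by
  have hdet : (L (1, 0)).1 * (L (0, 1)).2 - (L (0, 1)).1 * (L (1, 0)).2 = s * (a ^ 2 + b ^ 2) := by
    rw [h1, h2]
    ring
  have hE : dX (linEquiv L F) ^ 2 + dY (linEquiv L F) ^ 2 =
      (a ^ 2 + b ^ 2) • linEquiv L (dX F ^ 2 + dY F ^ 2) := by
    have hs' : algebraMap ℂ OO s ^ 2 = 1 := by rw [← map_pow, hs, map_one]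
    rw [(dX_dY_linEquiv L F).1, (dX_dY_linEquiv L F).2, h1, h2]
    simp only [Algebra.smul_def, map_add, map_mul, map_pow, map_neg]
    linear_combination (-(algebraMap ℂ OO b * linEquiv L (dX F))
      + algebraMap ℂ OO a * linEquiv L (dY F)) ^ 2 * hs'
  have hi : iO (linEquiv L F) = ((a ^ 2 + b ^ 2) ^ 2) • linEquiv L (iO F) := by
    rw [iO_linEquiv, hdet, mul_pow, hs, one_mul]
  apply mul_left_cancel₀ two_ne_zero_OO
  rw [two_mul_vO, hE, hi, Derivation.map_smul, Derivation.map_smul, hamD_linEquiv, hamD_linEquiv,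
    hdet]
  have h3 := congrArg (linEquiv L) (two_mul_vO F)
  simp only [map_sub, map_mul, map_ofNat] at h3
  simp only [Algebra.smul_def, map_mul, map_pow, map_add] at h3 ⊢
  linear_combination -(algebraMap ℂ OO s * (algebraMap ℂ OO a ^ 2 + algebraMap ℂ OO b ^ 2) ^ 4) * h3

end linear

section affine

variable {f : ℂ × ℂ → ℂ}

theorem comp_symm_translate (A : (ℂ × ℂ) ≃ᵃ[ℂ] (ℂ × ℂ)) :
    (fun z => f (A.symm (z + A 0))) = fun z => f (A.linear.symm z) := by
  funext z
  congr 1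
  rw [A.symm_apply_eq]
  have h1 := A.map_vadd 0 (A.linear.symm z)
  rw [vadd_eq_add, vadd_eq_add, add_zero] at h1
  rw [h1, LinearEquiv.apply_symm_apply]

theorem inum_linEquiv (L : (ℂ × ℂ) ≃ₗ[ℂ] (ℂ × ℂ)) (F G : OO) {c : ℂ} (hc : c ≠ 0) :
    inum (linEquiv L F) (c • linEquiv L G) = inum F G := by
  have h := inum_unit_mul isUnit_one ((IsUnit.mk0 c hc).map (algebraMap ℂ OO)) (linEquiv L F)
    (linEquiv L G)
  rw [one_mul, ← Algebra.smul_def] at h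
  rw [h]
  exact codim_span_pair_equiv (linEquiv L) F G

theorem inum_iO_linEquiv (L : (ℂ × ℂ) ≃ₗ[ℂ] (ℂ × ℂ)) (F : OO) :
    inum (linEquiv L F) (iO (linEquiv L F)) = inum F (iO F) := by
  rw [iO_linEquiv]
  exact inum_linEquiv L F _ (pow_ne_zero 2 (affine_det_ne_zero L.toAffineEquiv))

theorem inum_vO_linEquiv {L : (ℂ × ℂ) ≃ₗ[ℂ] (ℂ × ℂ)} (F : OO) {a b s : ℂ} (hs : s ^ 2 = 1)
    (hab : a ^ 2 + b ^ 2 ≠ 0) (h1 : L (1, 0) = (a, b)) (h2 : L (0, 1) = (-(s * b), s * a)) :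
    inum (linEquiv L F) (vO (linEquiv L F)) = inum F (vO F) := by
  have hs0 : s ≠ 0 := by
    rintro rfl
    norm_num at hs
  rw [vO_linEquiv F hs h1 h2]
  exact inum_linEquiv L F _ (mul_ne_zero hs0 (pow_ne_zero 4 hab))

theorem analyticAt_comp_symm (hf : AnalyticAt ℂ f 0) (A : (ℂ × ℂ) ≃ᵃ[ℂ] (ℂ × ℂ)) :
    AnalyticAt ℂ (fun z => f (A.symm z)) (A 0) :=
  AnalyticAt.comp (g := f) (by simpa using hf) (analyticAt_affine A.symm _)

theorem inflEq_affine (hf : AnalyticAt ℂ f 0) (A : (ℂ × ℂ) ≃ᵃ[ℂ] (ℂ × ℂ)) :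
    inflEq (fun z => f (A.symm z)) (A 0) = inflEq f 0 := by
  rw [(inflEq_vertEq_translate (analyticAt_comp_symm hf A)).1, comp_symm_translate,
    inflEq_eq_inum hf, inflEq_eq_inum, ← linEquiv_germ _ hf, inum_iO_linEquiv]
  exact AnalyticAt.comp (g := f) (by simpa using hf) (analyticAt_linearEquiv _ _)

theorem vertEq_similarity (hf : AnalyticAt ℂ f 0) {A : (ℂ × ℂ) ≃ᵃ[ℂ] (ℂ × ℂ)}
    (h : IsSimilarity A) : vertEq (fun z => f (A.symm z)) (A 0) = vertEq f 0 := by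
  obtain ⟨a, b, hab, h⟩ := h
  obtain ⟨s, hs, h1⟩ : ∃ s : ℂ, s ^ 2 = 1 ∧
      ∀ x y : ℂ, A.linear (x, y) = (a * x + b * y, -(s * b) * x + s * a * y) := by
    rcases h with h | h
    · exact ⟨1, one_pow 2, fun x y => by rw [h]; simp⟩
    · exact ⟨-1, by norm_num, fun x y => by rw [h]; simp; ring⟩
  -- The equation is transported by the inverse map, again a similarity, with a and b divided by a²
  -- + b² and the same sign s.
  have e1 : A.linear.symm (1, 0) = (a / (a ^ 2 + b ^ 2), b / (a ^ 2 + b ^ 2)) := by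
    rw [LinearEquiv.symm_apply_eq, h1]
    ext
    · field_simp
    · field_simp
      ring
  have e2 : A.linear.symm (0, 1) = (-(s * (b / (a ^ 2 + b ^ 2))), s * (a / (a ^ 2 + b ^ 2))) := by
    rw [LinearEquiv.symm_apply_eq, h1]
    ext
    · field_simp
      ring
    · field_simp
      linear_combination (-(a ^ 2) - b ^ 2) * hs
  rw [(inflEq_vertEq_translate (analyticAt_comp_symm hf A)).2, comp_symm_translate,
    vertEq_eq_inum hf, vertEq_eq_inum, ← linEquiv_germ _ hf, inum_vO_linEquiv _ hs ?_ e1 e2]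
  · have : (a / (a ^ 2 + b ^ 2)) ^ 2 + (b / (a ^ 2 + b ^ 2)) ^ 2 = 1 / (a ^ 2 + b ^ 2) := by
      field_simp
    rw [this]
    exact one_div_ne_zero hab
  · exact AnalyticAt.comp (g := f) (by simpa using hf) (analyticAt_linearEquiv _ _)

end affine

/-! ### Restriction of germs to a parametrised curve -/

section restrict

variable {α : ℂ → ℂ × ℂ}

/-- Restriction of germs to a parametrised curve, as germs of functions of the first variable. -/
def restrict (α : ℂ → ℂ × ℂ) (hα : AnalyticAt ℂ α 0) (h0 : α 0 = 0) : OO →ₐ[ℂ] OO :=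
  pullback (p := 0) (q := 0) (fun z => α z.1) (AnalyticAt.comp (g := α) (f := fun z : ℂ × ℂ => z.1)
    (by simpa using hα) analyticAt_fst) (by simpa using h0)

theorem restrict_germ (hα : AnalyticAt ℂ α 0) (h0 : α 0 = 0) {f : ℂ × ℂ → ℂ}
    (hf : AnalyticAt ℂ f 0) : restrict α hα h0 (germ f) = germX fun t => f (α t) :=
  pullback_germAt (p := 0) (q := 0) (φ := fun z => α z.1)
    (AnalyticAt.comp (g := α) (f := fun z : ℂ × ℂ => z.1) (by simpa using hα) analyticAt_fst)
    (by simpa using h0) hf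

theorem restrict_mem_RX (hα : AnalyticAt ℂ α 0) (h0 : α 0 = 0) (F : OO) :
    restrict α hα h0 F ∈ RX := by
  obtain ⟨f, hf, rfl⟩ := exists_germ_eq F
  rw [restrict_germ hα h0 hf]
  exact germX_mem_RX (analyticAt_comp_curve hf hα h0)

theorem ordX_restrict (hα : AnalyticAt ℂ α 0) (h0 : α 0 = 0) (F : OO) :
    ordX (restrict α hα h0 F) = ordAlong α F := by
  obtain ⟨f, hf, rfl⟩ := exists_germ_eq F
  rw [restrict_germ hα h0 hf, ordX_germX (analyticAt_comp_curve hf hα h0), ordAlong_germ hα h0 hf]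

theorem ev_restrict (hα : AnalyticAt ℂ α 0) (h0 : α 0 = 0) (F : OO) :
    ev (restrict α hα h0 F) = ev F := by
  obtain ⟨f, hf, rfl⟩ := exists_germ_eq F
  rw [restrict_germ hα h0 hf, ev_germ hf, germX,
    ev_germ (analyticAt_comp_fst (analyticAt_comp_curve hf hα h0))]
  exact congrArg f h0

theorem dX_restrict (hα : AnalyticAt ℂ α 0) (h0 : α 0 = 0) (F : OO) :
    dX (restrict α hα h0 F) = dX (xG α) * restrict α hα h0 (dX F)
      + dX (yG α) * restrict α hα h0 (dY F) := by
  obtain ⟨f, hf, rfl⟩ := exists_germ_eq F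
  have hx := analyticAt_fst_curve hα
  have hy := analyticAt_snd_curve hα
  have h1 := analyticAt_comp_curve (analyticAt_dx hf) hα h0
  have h2 := analyticAt_comp_curve (analyticAt_dy hf) hα h0
  rw [restrict_germ hα h0 hf, dX_germX (analyticAt_comp_curve hf hα h0), dX_germ hf, dY_germ hf,
    restrict_germ hα h0 (analyticAt_dx hf), restrict_germ hα h0 (analyticAt_dy hf), xG, yG,
    dX_germX hx, dX_germX hy, ← germX_mul hx.deriv h1, ← germX_mul hy.deriv h2,
    ← germX_add (hx.deriv.fun_mul h1) (hy.deriv.fun_mul h2)]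
  apply germX_congr
  filter_upwards [hα.eventually_analyticAt,
    (tendsto_of_analyticAt hα h0).eventually hf.eventually_analyticAt] with t h3 h4
  rw [deriv_fst h3, deriv_snd h3]
  have h5 := (h4.differentiableAt.hasFDerivAt.comp_hasDerivAt t
    h3.differentiableAt.hasDerivAt).deriv
  change deriv (f ∘ α) t = _
  rw [h5]
  have h6 : deriv α t = (deriv α t).1 • ((1, 0) : ℂ × ℂ) + (deriv α t).2 • ((0, 1) : ℂ × ℂ) := by
    ext <;> simp
  conv_lhs => rw [h6]
  rw [map_add, map_smul, map_smul]
  rfl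

theorem restrict_germEqn (hα : AnalyticAt ℂ α 0) (h0 : α 0 = 0) (c : CircleOrLine) :
    restrict α hα h0 c.germEqn = c.along (xG α) (yG α) := by
  rw [← c.germ_eqn, restrict_germ hα h0 (c.analyticAt_eqn 0), c.germX_eqn hα]

theorem ev_dX_xG (hα : AnalyticAt ℂ α 0) : ev (dX (xG α)) = (deriv α 0).1 := by
  rw [xG, dX_germX (analyticAt_fst_curve hα), germX,
    ev_germ (analyticAt_comp_fst (analyticAt_fst_curve hα).deriv)]
  exact deriv_fst hα

theorem ev_dX_yG (hα : AnalyticAt ℂ α 0) : ev (dX (yG α)) = (deriv α 0).2 := by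
  rw [yG, dX_germX (analyticAt_snd_curve hα), germX,
    ev_germ (analyticAt_comp_fst (analyticAt_snd_curve hα).deriv)]
  exact deriv_snd hα

end restrict

/-- The velocity of a regular parametrisation is a multiple of the hamiltonian vector field. -/
theorem IsSmoothGerm.exists_velocity {F : OO} (hF : IsSmoothGerm F) {α : ℂ → ℂ × ℂ}
    (hα : IsRegularCurve α) (h : ordAlong α F = ⊤) :
    ∃ l, IsUnit l ∧ dX (xG α) = l * restrict α hα.analyticAt hα.map_zero (dY F) ∧
      dX (yG α) = -(l * restrict α hα.analyticAt hα.map_zero (dX F)) := by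
  set ρ := restrict α hα.analyticAt hα.map_zero
  have h0 : ρ F = 0 := by
    rwa [← ordX_eq_top_iff (restrict_mem_RX _ _ F), ordX_restrict]
  have h1 := dX_restrict hα.analyticAt hα.map_zero F
  change dX (ρ F) = _ * ρ _ + _ * ρ _ at h1
  rw [h0, map_zero] at h1
  have hne : ev (dX (xG α)) ≠ 0 ∨ ev (dX (yG α)) ≠ 0 := by
    rw [ev_dX_xG hα.analyticAt, ev_dX_yG hα.analyticAt]
    by_contra! hcon
    exact hα.deriv_ne_zero (Prod.ext hcon.1 hcon.2)
  have hu : ∀ G, ev G ≠ 0 → IsUnit (ρ G) := fun G hG => by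
    rwa [isUnit_iff_ev, ev_restrict]
  -- Differentiating F ∘ α = 0 gives x' F_x + y' F_y = 0. Dividing by whichever partial derivative
  -- is a unit yields the factor l, itself a unit because the velocity is non-zero.
  obtain ⟨l, hl1, hl2⟩ : ∃ l, dX (xG α) = l * ρ (dY F) ∧ dX (yG α) = -(l * ρ (dX F)) := by
    rcases hF.2 with hx | hy
    · obtain ⟨u, hu⟩ := (hu _ hx).exists_right_inv
      refine ⟨-(dX (yG α) * u), ?_, ?_⟩
      · linear_combination -(dX (xG α)) * hu - u * h1
      · linear_combination -(dX (yG α)) * hu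
    · obtain ⟨u, hu⟩ := (hu _ hy).exists_right_inv
      refine ⟨dX (xG α) * u, ?_, ?_⟩
      · linear_combination -(dX (xG α)) * hu
      · linear_combination -(dX (yG α)) * hu - u * h1
  refine ⟨l, ?_, hl1, hl2⟩
  rw [isUnit_iff_ev]
  intro hl
  rw [hl1, hl2] at hne
  simp [hl] at hne

/-- The equations of inflections and vertices restrict to those of a regular parametrisation. -/
theorem iP_vP_eq_restrict {F : OO} {α : ℂ → ℂ × ℂ} (hα : AnalyticAt ℂ α 0) (h0 : α 0 = 0) {l : OO}
    (h1 : dX (xG α) = l * restrict α hα h0 (dY F))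
    (h2 : dX (yG α) = -(l * restrict α hα h0 (dX F))) :
    iP (xG α) (yG α) = -l ^ 3 * restrict α hα h0 (iO F) ∧
    vP (xG α) (yG α) = l ^ 6 * restrict α hα h0 (vO F) := by
  set ρ := restrict α hα h0
  have hD : ∀ G, dX (ρ G) = l * ρ (hamD F G) := fun G => by
    have h3 := dX_restrict hα h0 G
    change dX (ρ G) = _ * ρ _ + _ * ρ _ at h3
    rw [h3, h1, h2, hamD_apply, map_sub, map_mul, map_mul]
    ring
  have hi : iP (xG α) (yG α) = -l ^ 3 * ρ (iO F) := by
    rw [iP, h1, h2, iO_eq_hamD]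
    simp only [map_neg, map_sub, map_mul, Derivation.leibniz, smul_eq_mul, hD]
    ring
  refine ⟨hi, mul_left_cancel₀ two_ne_zero_OO ?_⟩
  -- E carries the factor l² and i the factor l³, so the derivatives of l cancel in 2E i' - 3E' i,
  -- leaving l² · l · l³ = l⁶.
  have hE : dX (xG α) ^ 2 + dX (yG α) ^ 2 = l ^ 2 * ρ (dX F ^ 2 + dY F ^ 2) := by
    rw [h1, h2]
    simp only [map_add, map_pow]
    ring
  have hS : 2 * (dX (xG α) * dX (dX (xG α)) + dX (yG α) * dX (dX (yG α)))
      = dX (dX (xG α) ^ 2 + dX (yG α) ^ 2) := by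
    simp only [map_add, Derivation.leibniz, pow_two, smul_eq_mul]
    ring
  have h3 := congrArg ρ (two_mul_vO F)
  simp only [map_sub, map_mul, map_ofNat] at h3
  have h4 : 2 * vP (xG α) (yG α) = 2 * (dX (xG α) ^ 2 + dX (yG α) ^ 2) * dX (iP (xG α) (yG α))
      - 3 * dX (dX (xG α) ^ 2 + dX (yG α) ^ 2) * iP (xG α) (yG α) := by
    rw [vP_eq, ← hS]
    ring
  rw [h4, hE, hi]
  simp only [map_neg, Derivation.leibniz, smul_eq_mul, hD, Derivation.leibniz_pow, nsmul_eq_mul,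
    neg_mul]
  push_cast
  linear_combination -l ^ 6 * h3

/-! ### Orders of functions of one variable -/

theorem ordX_dX_add_one {F : OO} (hF : F ∈ RX) (h : ev F = 0) : ordX (dX F) + 1 = ordX F := by
  obtain ⟨r, hr, rfl⟩ := hF
  rw [germX, ev_germ (analyticAt_comp_fst hr)] at h
  have h1 := hr.analyticOrderAt_deriv_add_one
  rw [show r 0 = 0 from h] at h1
  simp only [sub_zero] at h1
  rw [dX_germX hr, ordX_germX hr.deriv, ordX_germX hr, h1]

theorem cX_pow_dvd_of_mem_RX {F : OO} (hF : F ∈ RX) {n : ℕ} (h : (n : ℕ∞) ≤ ordX F) :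
    cX ^ n ∣ F := by
  obtain ⟨r, hr, rfl⟩ := hF
  rw [ordX_germX hr] at h
  exact cX_pow_dvd_germX hr h

theorem ordX_zero : ordX 0 = ⊤ := ordAlong_zero analyticAt_axisX axisX_zero

theorem ordX_eq_zero_iff_ev {F : OO} : ordX F = 0 ↔ ev F ≠ 0 := by
  rw [ordX_eq_zero_iff, isUnit_iff_ev]

/-- The order of a first-order differential expression with unit leading coefficient is decided by
its leading term, because l' vanishes to one order less than l. The second-order analogue follows in
the same way. -/
theorem ordX_dX_sub {l u w : OO} (hl : l ∈ RX) (h0 : ev l = 0) (hu : IsUnit u) :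
    ordX (u * dX l - w * l) + 1 = ordX l := by
  by_cases htop : ordX l = ⊤
  · rw [htop]
    rw [ordX_eq_top_iff hl] at htop
    rw [htop, map_zero, mul_zero, mul_zero, sub_zero, ordX_zero, top_add]
  · obtain ⟨n, hn⟩ := ENat.ne_top_iff_exists.1 htop
    rw [← ordX_dX_add_one hl h0]
    congr 1
    have h1 := ordX_dX_add_one hl h0
    rw [ordX_eq_of_cX_pow_dvd_sub (F := u * dX l) (n := n), ordX_unit_mul hu]
    · rw [ordX_unit_mul hu, hn, ← h1]
      refine ENat.lt_add_one_iff ?_ |>.2 le_rfl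
      intro h
      rw [h, top_add] at h1
      exact htop h1.symm
    · rw [sub_sub_cancel_left, dvd_neg]
      exact (cX_pow_dvd_of_mem_RX hl hn.le).mul_left w

theorem ordX_dX_dX_sub {l u w m : OO} (hl : l ∈ RX) (h0 : ev l = 0) (h1 : ev (dX l) = 0)
    (hu : IsUnit u) : ordX (u * dX (dX l) - w * dX l + m * l) + 2 = ordX l := by
  by_cases htop : ordX l = ⊤
  · rw [htop]
    rw [ordX_eq_top_iff hl] at htop
    rw [htop, map_zero, map_zero, mul_zero, mul_zero, mul_zero, sub_zero, add_zero, ordX_zero,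
      top_add]
  · obtain ⟨n, hn⟩ := ENat.ne_top_iff_exists.1 htop
    have h2 := ordX_dX_add_one hl h0
    have h3 := ordX_dX_sub (w := w) (dX_mem_RX hl) h1 hu
    rw [← h2, ← h3, add_assoc, one_add_one_eq_two]
    congr 1
    refine ordX_eq_of_cX_pow_dvd_sub (n := n) ?_ ?_
    · rw [hn, ← h2, ← h3]
      refine lt_of_lt_of_le (ENat.lt_add_one_iff ?_ |>.2 le_rfl) le_self_add
      intro h
      rw [h, top_add] at h3
      rw [← h3, top_add] at h2
      exact htop h2.symm
    · rw [add_sub_cancel_left]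
      exact (cX_pow_dvd_of_mem_RX hl hn.le).mul_left m

theorem one_le_ordX_iff {F : OO} : 1 ≤ ordX F ↔ ev F = 0 := by
  rw [Order.one_le_iff_ne_zero, Ne, ordX_eq_zero_iff_ev, not_not]

theorem succ_le_ordX_iff {F : OO} (hF : F ∈ RX) (h : ev F = 0) (k : ℕ∞) :
    k + 1 ≤ ordX F ↔ k ≤ ordX (dX F) := by
  rw [← ordX_dX_add_one hF h]
  exact ENat.add_le_add_iff_right ENat.one_ne_top

/-! ### Contact of a regular curve with circles and lines -/

/-- Germs of the coordinates of a regular parametrisation of a smooth curve at the origin. -/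
structure IsRegularPair (x y : OO) : Prop where
  x_mem : x ∈ RX
  y_mem : y ∈ RX
  ev_x : ev x = 0
  ev_y : ev y = 0
  regular : ev (dX x) ≠ 0 ∨ ev (dX y) ≠ 0

namespace CircleOrLine

variable (c : CircleOrLine)

theorem along_mem_RX {x y : OO} (hx : x ∈ RX) (hy : y ∈ RX) : c.along x y ∈ RX :=
  RX.add_mem (RX.add_mem (RX.smul_mem (RX.add_mem (RX.pow_mem hx 2) (RX.pow_mem hy 2)) _)
    (RX.smul_mem hx _)) (RX.smul_mem hy _)

end CircleOrLine

namespace IsRegularPair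

variable {x y : OO}

theorem along_ev (h : IsRegularPair x y) (c : CircleOrLine) : ev (c.along x y) = 0 := by
  simp [CircleOrLine.along, h.ev_x, h.ev_y]

theorem ev_dX_along (h : IsRegularPair x y) (c : CircleOrLine)
    : ev (dX (c.along x y)) = 2 * (ev (dX x) * c.B + ev (dX y) * c.C) := by
  rw [c.dX_along]
  simp only [map_mul, map_add, map_smul, map_one, map_ofNat, h.ev_x, h.ev_y, smul_eq_mul]
  ring

theorem ev_dX_dX_along (h : IsRegularPair x y) (c : CircleOrLine) : ev (dX (dX (c.along x y))) =
    2 * (ev (dX (dX x)) * c.B + ev (dX (dX y)) * c.C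
      + c.A * (ev (dX x) ^ 2 + ev (dX y) ^ 2)) := by
  rw [c.dX_dX_along]
  simp only [map_mul, map_add, map_smul, map_pow, map_one, map_ofNat, h.ev_x, h.ev_y, smul_eq_mul]
  ring

theorem ev_dX_dX_dX_along (h : IsRegularPair x y) (c : CircleOrLine)
    : ev (dX (dX (dX (c.along x y)))) =
    2 * (ev (dX (dX (dX x))) * c.B + ev (dX (dX (dX y))) * c.C
      + c.A * (3 * (ev (dX x) * ev (dX (dX x)) + ev (dX y) * ev (dX (dX y))))) := by
  rw [c.dX_dX_dX_along]
  simp only [map_mul, map_add, map_smul, map_one, map_ofNat, h.ev_x, h.ev_y, smul_eq_mul]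
  ring

theorem two_le_ordX_along_iff (h : IsRegularPair x y) (c : CircleOrLine)
    : 2 ≤ ordX (c.along x y) ↔ ev (dX x) * c.B + ev (dX y) * c.C = 0 := by
  rw [← one_add_one_eq_two, succ_le_ordX_iff (c.along_mem_RX h.x_mem h.y_mem) (h.along_ev c),
    one_le_ordX_iff, h.ev_dX_along]
  simp

theorem three_le_ordX_along_iff (h : IsRegularPair x y) (c : CircleOrLine)
    : 3 ≤ ordX (c.along x y) ↔
    ev (dX x) * c.B + ev (dX y) * c.C = 0 ∧
    ev (dX (dX x)) * c.B + ev (dX (dX y)) * c.C + c.A * (ev (dX x) ^ 2 + ev (dX y) ^ 2) = 0 := by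
  have hm := c.along_mem_RX h.x_mem h.y_mem
  have key : ev (dX (c.along x y)) = 0 → (3 ≤ ordX (c.along x y) ↔
      ev (dX (dX x)) * c.B + ev (dX (dX y)) * c.C
        + c.A * (ev (dX x) ^ 2 + ev (dX y) ^ 2) = 0) := fun h1 => by
    rw [← two_add_one_eq_three, succ_le_ordX_iff hm (h.along_ev c), ← one_add_one_eq_two,
      succ_le_ordX_iff (dX_mem_RX hm) h1, one_le_ordX_iff, h.ev_dX_dX_along]
    simp
  have h2 : ev (dX (c.along x y)) = 0 ↔ ev (dX x) * c.B + ev (dX y) * c.C = 0 := by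
    rw [h.ev_dX_along]
    simp
  constructor
  · intro h3
    have h4 := (h.two_le_ordX_along_iff c).1 (le_trans (by norm_num) h3)
    exact ⟨h4, (key (h2.2 h4)).1 h3⟩
  · rintro ⟨h4, h5⟩
    exact (key (h2.2 h4)).2 h5

theorem four_le_ordX_along_iff (h : IsRegularPair x y) (c : CircleOrLine)
    : 4 ≤ ordX (c.along x y) ↔
    (ev (dX x) * c.B + ev (dX y) * c.C = 0 ∧
    ev (dX (dX x)) * c.B + ev (dX (dX y)) * c.C + c.A * (ev (dX x) ^ 2 + ev (dX y) ^ 2) = 0) ∧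
    ev (dX (dX (dX x))) * c.B + ev (dX (dX (dX y))) * c.C
      + c.A * (3 * (ev (dX x) * ev (dX (dX x)) + ev (dX y) * ev (dX (dX y)))) = 0 := by
  have hm := c.along_mem_RX h.x_mem h.y_mem
  rw [← h.three_le_ordX_along_iff]
  have key : 3 ≤ ordX (c.along x y) → (4 ≤ ordX (c.along x y) ↔
      ev (dX (dX (dX (c.along x y)))) = 0) := fun h3 => by
    rw [h.three_le_ordX_along_iff] at h3
    have h1 : ev (dX (c.along x y)) = 0 := by rw [h.ev_dX_along, h3.1, mul_zero]
    have h2 : ev (dX (dX (c.along x y))) = 0 := by rw [h.ev_dX_dX_along, h3.2, mul_zero]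
    rw [← three_add_one_eq_four, succ_le_ordX_iff hm (h.along_ev c), ← two_add_one_eq_three,
      succ_le_ordX_iff (dX_mem_RX hm) h1, ← one_add_one_eq_two,
      succ_le_ordX_iff (dX_mem_RX (dX_mem_RX hm)) h2, one_le_ordX_iff]
  constructor
  · intro h4
    have h3 : 3 ≤ ordX (c.along x y) := le_trans (by norm_num) h4
    refine ⟨h3, ?_⟩
    have := (key h3).1 h4
    rw [h.ev_dX_dX_dX_along] at this
    simpa using this
  · rintro ⟨h3, h4⟩
    rw [key h3, h.ev_dX_dX_dX_along, h4, mul_zero]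

theorem ev_iP : ev (iP x y) = ev (dX x) * ev (dX (dX y)) - ev (dX y) * ev (dX (dX x)) := by
  simp [iP]

theorem ev_vP : ev (vP x y) = (ev (dX x) ^ 2 + ev (dX y) ^ 2)
      * (ev (dX x) * ev (dX (dX (dX y))) - ev (dX (dX (dX x))) * ev (dX y))
    + 3 * (ev (dX x) * ev (dX (dX x)) + ev (dX y) * ev (dX (dX y)))
      * (ev (dX (dX x)) * ev (dX y) - ev (dX x) * ev (dX (dX y))) := by
  simp only [vP, map_mul, map_add, map_sub, map_pow, map_ofNat]

/-- Inflections are the points with a line having contact of order at least three. -/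
theorem ev_iP_eq_zero_iff (h : IsRegularPair x y) :
    ev (iP x y) = 0 ↔ ∃ c : CircleOrLine, c.IsLine ∧ 3 ≤ ordX (c.along x y) := by
  rw [ev_iP]
  constructor
  · intro hi
    have hne : (0, -ev (dX y), ev (dX x)) ≠ (0 : ℂ × ℂ × ℂ) := by
      intro h0
      simp only [Prod.ext_iff] at h0
      exact h.regular.elim (fun hx => hx h0.2.2) fun hy => hy (neg_eq_zero.1 h0.2.1)
    refine ⟨⟨0, -ev (dX y), ev (dX x), hne⟩, rfl, ?_⟩
    rw [h.three_le_ordX_along_iff]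
    constructor
    · simp only
      ring
    · simp only
      linear_combination hi
  · rintro ⟨c, hc, h3⟩
    rw [h.three_le_ordX_along_iff, show c.A = 0 from hc] at h3
    obtain ⟨h1, h2⟩ := h3
    rcases hc.ne_zero with hB | hC
    · refine (mul_eq_zero.1 (?_ : c.B * _ = 0)).resolve_left hB
      linear_combination ev (dX (dX y)) * h1 - ev (dX y) * h2
    · refine (mul_eq_zero.1 (?_ : c.C * _ = 0)).resolve_left hC
      linear_combination ev (dX x) * h2 - ev (dX (dX x)) * h1

/-- Vertices are the points with a circle or line having contact of order at least four. -/
theorem ev_vP_eq_zero_iff (h : IsRegularPair x y) :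
    ev (vP x y) = 0 ↔ ∃ c : CircleOrLine, 4 ≤ ordX (c.along x y) := by
  -- Contact of order four is a homogeneous linear system of three equations in (A, B, C), with
  -- determinant -v at the origin; a circle or line is a non-zero solution.
  let M : Matrix (Fin 3) (Fin 3) ℂ :=
    !![0, ev (dX x), ev (dX y);
      ev (dX x) ^ 2 + ev (dX y) ^ 2, ev (dX (dX x)), ev (dX (dX y));
      3 * (ev (dX x) * ev (dX (dX x)) + ev (dX y) * ev (dX (dX y))),
        ev (dX (dX (dX x))), ev (dX (dX (dX y)))]
  have hdet : M.det = -ev (vP x y) := by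
    rw [Matrix.det_fin_three, ev_vP]
    simp [M]
    ring
  have hM : ∀ a b c : ℂ, M.mulVec ![a, b, c] = 0 ↔
      (ev (dX x) * b + ev (dX y) * c = 0 ∧
      ev (dX (dX x)) * b + ev (dX (dX y)) * c + a * (ev (dX x) ^ 2 + ev (dX y) ^ 2) = 0) ∧
      ev (dX (dX (dX x))) * b + ev (dX (dX (dX y))) * c
        + a * (3 * (ev (dX x) * ev (dX (dX x)) + ev (dX y) * ev (dX (dX y)))) = 0 := by
    intro a b c
    rw [funext_iff]
    simp only [Fin.forall_fin_succ, Matrix.mulVec, dotProduct, Fin.sum_univ_three]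
    simp [M]
    rw [and_assoc]
    refine and_congr Iff.rfl (and_congr ?_ ?_)
    · rw [show ∀ u v w : ℂ, u + v + w = v + w + u from fun u v w => by ring, mul_comm a]
    · rw [show ∀ u v w : ℂ, u + v + w = v + w + u from fun u v w => by ring, mul_comm a]
  rw [← neg_eq_zero, ← hdet, ← Matrix.exists_mulVec_eq_zero_iff]
  constructor
  · rintro ⟨w, hw, hMw⟩
    have hw' : w = ![w 0, w 1, w 2] := by
      funext i
      fin_cases i <;> rfl
    refine ⟨⟨w 0, w 1, w 2, fun h0 => hw ?_⟩, ?_⟩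
    · simp only [Prod.ext_iff] at h0
      rw [hw', show w 0 = 0 from h0.1, show w 1 = 0 from h0.2.1, show w 2 = 0 from h0.2.2]
      simp
    · rw [h.four_le_ordX_along_iff, ← hM, ← hw', hMw]
  · rintro ⟨c, hc⟩
    refine ⟨![c.A, c.B, c.C], fun h0 => c.nonzero ?_, ?_⟩
    · have e0 := congrFun h0 0
      have e1 := congrFun h0 1
      have e2 := congrFun h0 2
      simp at e0 e1 e2
      rw [e0, e1, e2]
      rfl
    · rw [hM, ← h.four_le_ordX_along_iff]
      exact hc

/-- The order of contact with the tangent line. -/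
theorem ordX_along_tangent (h : IsRegularPair x y) (c : CircleOrLine)
    (hc : c.IsLine) (h2 : 2 ≤ ordX (c.along x y)) :
    ordX (c.along x y) = ordX (iP x y) + 2 := by
  have hm := c.along_mem_RX h.x_mem h.y_mem
  have h1 : ev (dX (c.along x y)) = 0 := by
    rw [h.ev_dX_along, (h.two_le_ordX_along_iff c).1 h2, mul_zero]
  rw [h.two_le_ordX_along_iff] at h2
  have e1 := c.dX_along x y
  have e2 := c.dX_dX_along x y
  rw [show c.A = 0 from hc] at e1 e2
  simp only [zero_smul, zero_add, add_zero] at e1 e2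
  rw [← ordX_dX_add_one hm (h.along_ev c), ← one_add_one_eq_two, ← add_assoc]
  congr 1
  simp only [Algebra.smul_def, mul_one] at e1 e2
  by_cases hx : ev (dX x) = 0
  · have hy := h.regular.resolve_left (not_not.2 hx)
    have hC : c.C = 0 := by
      rw [hx, zero_mul, zero_add] at h2
      exact (mul_eq_zero.1 h2).resolve_left hy
    have hB : c.B ≠ 0 := hc.ne_zero.resolve_right (not_not.2 hC)
    -- The Wronskian of y' and l' is a non-zero multiple of i, and its order is one less than that
    -- of l'; in the other case x' plays the same role.
    rw [← ordX_dX_sub (w := dX (dX y)) (dX_mem_RX hm) h1 (isUnit_iff_ev.2 hy)]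
    have e3 : dX y * dX (dX (c.along x y)) - dX (dX y) * dX (c.along x y)
        = (-2 * c.B) • iP x y := by
      rw [e2, e1, iP, Algebra.smul_def, map_mul, map_neg, map_ofNat]
      ring
    rw [e3, ordX_smul (by simpa using hB)]
  · have hC : c.C ≠ 0 := by
      intro hC
      rw [hC, mul_zero, add_zero] at h2
      exact hc.ne_zero.elim (fun hB => hB ((mul_eq_zero.1 h2).resolve_left hx)) fun h' => h' hC
    rw [← ordX_dX_sub (w := dX (dX x)) (dX_mem_RX hm) h1 (isUnit_iff_ev.2 hx)]
    have e3 : dX x * dX (dX (c.along x y)) - dX (dX x) * dX (c.along x y)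
        = (2 * c.C) • iP x y := by
      rw [e2, e1, iP, Algebra.smul_def, map_mul, map_ofNat]
      ring
    rw [e3, ordX_smul (by simpa using hC)]

/-- At an inflection with non-isotropic tangent line, `i` vanishes to one order more than `v`. -/
theorem ordX_vP_add_one (h : IsRegularPair x y)
    (hi : ev (iP x y) = 0) (hE : ev (dX x) ^ 2 + ev (dX y) ^ 2 ≠ 0) :
    ordX (iP x y) = ordX (vP x y) + 1 := by
  rw [vP_eq, ordX_dX_sub (iP_mem_RX h.x_mem h.y_mem) hi]
  rw [isUnit_iff_ev]
  simpa using hE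

/-- Cramer's rule for the conditions on the first two derivatives. For i ≠ 0 it fixes the centre;
for i = 0 and E ≠ 0 it forces A = 0, so that the curve is the tangent line. -/
theorem circle_relations (h : IsRegularPair x y) (c : CircleOrLine) (h3 : 3 ≤ ordX (c.along x y)) :
    ev (iP x y) * c.B = c.A * (ev (dX x) ^ 2 + ev (dX y) ^ 2) * ev (dX y) ∧
    ev (iP x y) * c.C = -(c.A * (ev (dX x) ^ 2 + ev (dX y) ^ 2) * ev (dX x)) := by
  rw [h.three_le_ordX_along_iff] at h3
  obtain ⟨h1, h2⟩ := h3
  rw [ev_iP]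
  constructor
  · linear_combination ev (dX (dX y)) * h1 - ev (dX y) * h2
  · linear_combination ev (dX x) * h2 - ev (dX (dX x)) * h1

theorem A_ne_zero (h : IsRegularPair x y) (c : CircleOrLine)
    (hi : ev (iP x y) ≠ 0) (h3 : 3 ≤ ordX (c.along x y)) : c.A ≠ 0 := by
  intro hA
  obtain ⟨h1, h2⟩ := h.circle_relations c h3
  rw [hA, zero_mul, zero_mul] at h1 h2
  rw [neg_zero] at h2
  apply c.nonzero
  rw [hA, (mul_eq_zero.1 h1).resolve_left hi, (mul_eq_zero.1 h2).resolve_left hi]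
  rfl

/-- The order of contact with a circle or line having contact of order at least three. -/
theorem ordX_along_eq (h : IsRegularPair x y) (c : CircleOrLine)
    (hr : ev (iP x y) ≠ 0 ∨ ev (dX x) ^ 2 + ev (dX y) ^ 2 ≠ 0)
    (h3 : 3 ≤ ordX (c.along x y)) : ordX (c.along x y) = ordX (vP x y) + 3 := by
  by_cases hi : ev (iP x y) = 0
  · have hE := hr.resolve_left (not_not.2 hi)
    have hA : c.IsLine := by
      obtain ⟨h1, h2⟩ := h.circle_relations c h3
      rw [hi, zero_mul] at h1 h2
      by_contra hA
      have hAE := mul_ne_zero hA hE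
      refine h.regular.elim (fun hx => ?_) fun hy => ?_
      · exact mul_ne_zero hAE hx (neg_eq_zero.1 h2.symm)
      · exact mul_ne_zero hAE hy h1.symm
    rw [h.ordX_along_tangent c hA (le_trans (by norm_num) h3), h.ordX_vP_add_one hi hE, add_assoc,
      show (1 : ℕ∞) + 2 = 3 from rfl]
  · have hA := h.A_ne_zero c hi h3
    have hm := c.along_mem_RX h.x_mem h.y_mem
    rw [h.three_le_ordX_along_iff] at h3
    have h1 : ev (dX (c.along x y)) = 0 := by rw [h.ev_dX_along, h3.1, mul_zero]
    have h2 : ev (dX (dX (c.along x y))) = 0 := by rw [h.ev_dX_dX_along, h3.2, mul_zero]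
    rw [← ordX_dX_add_one hm (h.along_ev c), ← two_add_one_eq_three, ← add_assoc]
    congr 1
    rw [← ordX_dX_dX_sub (u := iP x y) (w := dX (iP x y))
      (m := dX (dX x) * dX (dX (dX y)) - dX (dX y) * dX (dX (dX x))) (dX_mem_RX hm) h1 h2
      (isUnit_iff_ev.2 hi)]
    -- The left side is the Wronskian of x', y' and l'. It vanishes when A = 0, since l' is then a
    -- constant combination of x' and y', and in general it is -2A v. Its order is two less than
    -- that of l' because i is a unit.
    have e : iP x y * dX (dX (dX (c.along x y))) - dX (iP x y) * dX (dX (c.along x y))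
        + (dX (dX x) * dX (dX (dX y)) - dX (dX y) * dX (dX (dX x))) * dX (c.along x y)
        = (-2 * c.A) • vP x y := by
      rw [c.dX_dX_dX_along, c.dX_dX_along, c.dX_along, dX_iP, iP, vP]
      simp only [Algebra.smul_def, map_mul, map_neg, map_ofNat]
      ring
    rw [e, ordX_smul (by simpa using hA)]

/-- There is a circle or line having contact of order at least three. -/
theorem exists_three_le_ordX_along (h : IsRegularPair x y)
    (hr : ev (iP x y) ≠ 0 ∨ ev (dX x) ^ 2 + ev (dX y) ^ 2 ≠ 0) :
    ∃ c : CircleOrLine, 3 ≤ ordX (c.along x y) := by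
  set E := ev (dX x) ^ 2 + ev (dX y) ^ 2 with hE
  refine ⟨⟨ev (iP x y), E * ev (dX y), -(E * ev (dX x)), fun h0 => ?_⟩, ?_⟩
  · simp only [Prod.ext_iff] at h0
    have hE0 := hr.resolve_left (not_not.2 h0.1)
    refine h.regular.elim (fun hx => ?_) fun hy => ?_
    · exact mul_ne_zero hE0 hx (neg_eq_zero.1 h0.2.2)
    · exact mul_ne_zero hE0 hy h0.2.1
  · rw [h.three_le_ordX_along_iff]
    constructor
    · simp only
      ring
    · simp only [ev_iP]
      rw [← hE]
      ring

/-- A point with isotropic tangent line is not an ordinary vertex. -/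
theorem ordX_vP_ne_one (h : IsRegularPair x y)
    (hE : ev (dX x) ^ 2 + ev (dX y) ^ 2 = 0) : ordX (vP x y) ≠ 1 := by
  intro hv
  have hm := vP_mem_RX h.x_mem h.y_mem
  have h0 : ev (vP x y) = 0 := one_le_ordX_iff.1 hv.ge
  have h1 : ev (dX (vP x y)) ≠ 0 := by
    rw [← ordX_dX_add_one hm h0] at hv
    rw [← ordX_eq_zero_iff_ev]
    exact (WithTop.add_right_inj ENat.one_ne_top).1 (hv.trans (zero_add 1).symm)
  -- Put S = x'x'' + y'y''. Lagrange's identity gives S² + i² = E (x''² + y''²) = 0, and v = -3Si at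
  -- the origin since E = 0. Hence S and i both vanish, and so does v' = E i'' - S i' - 3S' i.
  have hS : ev (dX x) * ev (dX (dX x)) + ev (dX y) * ev (dX (dX y)) = 0 ∧ ev (iP x y) = 0 := by
    have e : (ev (dX x) * ev (dX (dX x)) + ev (dX y) * ev (dX (dX y))) ^ 2 + ev (iP x y) ^ 2 = 0 := by
      rw [ev_iP]
      linear_combination (ev (dX (dX x)) ^ 2 + ev (dX (dX y)) ^ 2) * hE
    have e2 : (ev (dX x) * ev (dX (dX x)) + ev (dX y) * ev (dX (dX y))) * ev (iP x y) = 0 := by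
      rw [vP_eq] at h0
      simp only [map_sub, map_add, map_mul, map_pow, hE, map_ofNat] at h0
      linear_combination -h0 / 3
    rcases mul_eq_zero.1 e2 with e3 | e3
    · rw [e3] at e
      exact ⟨e3, by simpa using e⟩
    · rw [e3] at e
      exact ⟨by simpa using e, e3⟩
  apply h1
  rw [vP_eq]
  have h3 : dX (3 : OO) = 0 := dX.map_natCast 3
  simp only [map_sub, map_add, map_mul, map_pow, Derivation.leibniz, Derivation.leibniz_pow,
    smul_eq_mul, h3, map_ofNat, hS.2, nsmul_eq_mul, map_natCast]
  push_cast
  linear_combination (ev (dX (dX (iP x y)))) * hE - ev (dX (iP x y)) * hS.1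

end IsRegularPair

/-! ### Smooth points -/

section smoothPoint

variable {f : ℂ × ℂ → ℂ}

theorem fderiv_eq_zero_iff : fderiv ℂ f 0 = 0 ↔ dx f 0 = 0 ∧ dy f 0 = 0 := by
  constructor
  · intro h
    rw [dx, dy, h]
    simp
  · rintro ⟨h1, h2⟩
    ext
    · simpa [dx] using h1
    · simpa [dy] using h2

theorem ev_dX_germ (hf : AnalyticAt ℂ f 0) : ev (dX (germ f)) = dx f 0 := by
  rw [dX_germ hf, ev_germ (analyticAt_dx hf)]

theorem ev_dY_germ (hf : AnalyticAt ℂ f 0) : ev (dY (germ f)) = dy f 0 := by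
  rw [dY_germ hf, ev_germ (analyticAt_dy hf)]

theorem isSmoothGerm_germ_iff (hf : AnalyticAt ℂ f 0) (h0 : f 0 = 0) :
    IsSmoothGerm (germ f) ↔ fderiv ℂ f 0 ≠ 0 := by
  rw [IsSmoothGerm, ev_germ hf, ev_dX_germ hf, ev_dY_germ hf, and_iff_right h0, ne_eq, ne_eq, ← not_and_or]
  exact fderiv_eq_zero_iff.not.symm

theorem hasContact_iff (hf : AnalyticAt ℂ f 0) (hs : IsSmoothGerm (germ f)) {g : ℂ × ℂ → ℂ}
    (hg : AnalyticAt ℂ g 0) (k : ℕ∞) : HasContact f g k ↔ inum (germ f) (germ g) = k := by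
  have key : ∀ {γ : ℂ → ℂ × ℂ}, IsRegularCurve γ → (∀ᶠ t in 𝓝 (0 : ℂ), f (γ t) = 0) →
      analyticOrderAt (fun t => g (γ t)) 0 = inum (germ f) (germ g) := fun hγ h => by
    rw [hs.inum_eq_ordAlong hγ, ordAlong_germ hγ.analyticAt hγ.map_zero hg]
    rwa [ordAlong_germ hγ.analyticAt hγ.map_zero hf, analyticOrderAt_eq_top]
  constructor
  · rintro ⟨γ, h1, h2, h3, h4, rfl⟩
    exact (key ⟨h1, h2, h3⟩ h4).symm
  · rintro rfl
    obtain ⟨γ, hγ, hF⟩ := hs.exists_regularCurve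
    rw [ordAlong_germ hγ.analyticAt hγ.map_zero hf, analyticOrderAt_eq_top] at hF
    exact ⟨γ, hγ.analyticAt, hγ.map_zero, hγ.deriv_ne_zero, hF, key hγ hF⟩

/-- A smooth curve together with the coordinates of a regular parametrisation. -/
structure IsParametrisedBy (f : ℂ × ℂ → ℂ) (x y : OO) (l : ℂ) : Prop where
  regular : IsRegularPair x y
  contact : ∀ (c : CircleOrLine) (k : ℕ∞), HasContact f c.eqn k ↔ ordX (c.along x y) = k
  infl : inflEq f 0 = ordX (iP x y)
  vert : vertEq f 0 = ordX (vP x y)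
  factor : l ≠ 0
  ev_dX_x : ev (dX x) = l * dy f 0
  ev_dX_y : ev (dX y) = -(l * dx f 0)
  ev_iP : ev (iP x y) = -l ^ 3 * iEq f 0
  ev_vP : ev (vP x y) = l ^ 6 * vEq f 0

/-- One regular parametrisation is chosen for all questions at a smooth point. Orders of contact are
intersection numbers, so they do not depend on this choice. -/
theorem exists_isParametrisedBy (hf : AnalyticAt ℂ f 0) (h0 : f 0 = 0) (hd : fderiv ℂ f 0 ≠ 0) :
    ∃ x y l, IsParametrisedBy f x y l := by
  have hs := (isSmoothGerm_germ_iff hf h0).2 hd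
  obtain ⟨α, hα, hF⟩ := hs.exists_regularCurve
  obtain ⟨l, hl, h1, h2⟩ := hs.exists_velocity hα hF
  obtain ⟨hi, hv⟩ := iP_vP_eq_restrict hα.analyticAt hα.map_zero h1 h2
  have hord : ∀ G, inum (germ f) G = ordX (restrict α hα.analyticAt hα.map_zero G) := fun G => by
    rw [hs.inum_eq_ordAlong hα hF, ordX_restrict]
  refine ⟨xG α, yG α, ev l, ⟨xG_mem_RX hα.analyticAt, yG_mem_RX hα.analyticAt, ?_, ?_, ?_⟩,
    fun c k => ?_, ?_, ?_, isUnit_iff_ev.1 hl, ?_, ?_, ?_, ?_⟩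
  · rw [ev_xG hα.analyticAt, hα.map_zero]
    rfl
  · rw [ev_yG hα.analyticAt, hα.map_zero]
    rfl
  · rw [ev_dX_xG hα.analyticAt, ev_dX_yG hα.analyticAt]
    by_contra! hcon
    exact hα.deriv_ne_zero (Prod.ext hcon.1 hcon.2)
  · rw [hasContact_iff hf hs (c.analyticAt_eqn 0), c.germ_eqn, hord, restrict_germEqn]
  · rw [inflEq_eq_inum hf, hord, hi, ordX_unit_mul (by simpa using hl.pow 3)]
  · rw [vertEq_eq_inum hf, hord, hv, ordX_unit_mul (hl.pow 6)]
  · rw [h1, map_mul, ev_restrict, ev_dY_germ hf]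
  · rw [h2, map_neg, map_mul, ev_restrict, ev_dX_germ hf]
  · rw [hi, map_mul, ev_restrict, ← germ_iEq hf, ev_germ (analyticAt_iEq hf), map_neg, map_pow]
  · rw [hv, map_mul, ev_restrict, ← germ_vEq hf, ev_germ (analyticAt_vEq hf), map_pow]

namespace IsParametrisedBy

variable {x y : OO} {l : ℂ}

theorem ev_iP_eq_zero (h : IsParametrisedBy f x y l) : ev (iP x y) = 0 ↔ iEq f 0 = 0 := by
  rw [h.ev_iP]
  simp [h.factor]

theorem ev_vP_eq_zero (h : IsParametrisedBy f x y l) : ev (vP x y) = 0 ↔ vEq f 0 = 0 := by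
  rw [h.ev_vP]
  simp [h.factor]

theorem isotropic_iff (h : IsParametrisedBy f x y l) :
    ev (dX x) ^ 2 + ev (dX y) ^ 2 = 0 ↔ dx f 0 ^ 2 + dy f 0 ^ 2 = 0 := by
  rw [h.ev_dX_x, h.ev_dX_y, show (l * dy f 0) ^ 2 + (-(l * dx f 0)) ^ 2
    = l ^ 2 * (dx f 0 ^ 2 + dy f 0 ^ 2) by ring]
  simp [h.factor]

theorem isInflection_iff (h : IsParametrisedBy f x y l) (h0 : f 0 = 0) :
    IsInflection f 0 ↔ ∃ c : CircleOrLine, c.IsLine ∧ ∃ k ≥ 3, HasContact f c.eqn k := by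
  rw [IsInflection, and_iff_right h0, ← h.ev_iP_eq_zero, h.regular.ev_iP_eq_zero_iff]
  simp only [h.contact]
  refine exists_congr fun c => and_congr_right fun _ => ?_
  exact ⟨fun h3 => ⟨_, h3, rfl⟩, fun ⟨k, hk, he⟩ => he ▸ hk⟩

theorem isVertex_iff (h : IsParametrisedBy f x y l) (h0 : f 0 = 0) :
    IsVertex f 0 ↔ ∃ c : CircleOrLine, ∃ k ≥ 4, HasContact f c.eqn k := by
  rw [IsVertex, and_iff_right h0, ← h.ev_vP_eq_zero, h.regular.ev_vP_eq_zero_iff]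
  simp only [h.contact]
  refine exists_congr fun c => ?_
  exact ⟨fun h3 => ⟨_, h3, rfl⟩, fun ⟨k, hk, he⟩ => he ▸ hk⟩

theorem hasContact_tangentLine_iff (h : IsParametrisedBy f x y l) (k : ℕ∞) :
    HasContact f (tangentLine f) k ↔ inflEq f 0 + 2 = k := by
  have hne : (0, dx f 0 / 2, dy f 0 / 2) ≠ (0 : ℂ × ℂ × ℂ) := by
    intro h1
    simp only [Prod.ext_iff] at h1
    have hx : dx f 0 = 0 := by simpa using h1.2.1
    have hy : dy f 0 = 0 := by simpa using h1.2.2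
    have h2 := h.regular.regular
    rw [h.ev_dX_x, h.ev_dX_y, hx, hy] at h2
    simp at h2
  let c : CircleOrLine := ⟨0, dx f 0 / 2, dy f 0 / 2, hne⟩
  have hc : c.eqn = tangentLine f := by
    funext z
    simp only [CircleOrLine.eqn, tangentLine, c]
    ring
  have h2 : 2 ≤ ordX (c.along x y) := by
    rw [h.regular.two_le_ordX_along_iff, h.ev_dX_x, h.ev_dX_y]
    simp only [c]
    ring
  rw [← hc, h.contact, h.regular.ordX_along_tangent c rfl h2, h.infl]

theorem isOsculating_iff (h : IsParametrisedBy f x y l) (c : CircleOrLine) :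
    IsOsculating f c ↔ ∀ c' : CircleOrLine, ordX (c'.along x y) ≤ ordX (c.along x y) := by
  simp only [IsOsculating, h.contact]
  constructor
  · rintro ⟨k, rfl, hk⟩ c'
    exact hk c' _ rfl
  · intro hk
    exact ⟨_, rfl, fun c' k' hk' => hk' ▸ hk c'⟩

/-- When the centre of curvature is defined, some circle or line has contact at least three, and all
of these have the same order V + 3; this common order is therefore maximal. -/
theorem isOsculating_iff_three_le (h : IsParametrisedBy f x y l)
    (hr : ev (iP x y) ≠ 0 ∨ ev (dX x) ^ 2 + ev (dX y) ^ 2 ≠ 0) (c : CircleOrLine) :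
    IsOsculating f c ↔ 3 ≤ ordX (c.along x y) := by
  rw [h.isOsculating_iff]
  constructor
  · intro hc
    obtain ⟨c', hc'⟩ := h.regular.exists_three_le_ordX_along hr
    exact hc'.trans (hc c')
  · intro hc c'
    by_cases hc' : 3 ≤ ordX (c'.along x y)
    · rw [h.regular.ordX_along_eq c' hr hc', h.regular.ordX_along_eq c hr hc]
    · exact (not_le.1 hc').le.trans hc

theorem hasContact_of_isOsculating (h : IsParametrisedBy f x y l)
    (hr : ev (iP x y) ≠ 0 ∨ ev (dX x) ^ 2 + ev (dX y) ^ 2 ≠ 0) {c : CircleOrLine}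
    (hc : IsOsculating f c) (k : ℕ∞) : HasContact f c.eqn k ↔ vertEq f 0 + 3 = k := by
  rw [h.isOsculating_iff_three_le hr] at hc
  rw [h.contact, h.regular.ordX_along_eq c hr hc, h.vert]

theorem exists_isOsculating (h : IsParametrisedBy f x y l)
    (hr : ev (iP x y) ≠ 0 ∨ ev (dX x) ^ 2 + ev (dX y) ^ 2 ≠ 0) : ∃ c, IsOsculating f c := by
  obtain ⟨c, hc⟩ := h.regular.exists_three_le_ordX_along hr
  exact ⟨c, (h.isOsculating_iff_three_le hr c).2 hc⟩

theorem isCentred (h : IsParametrisedBy f x y l) (hi : iEq f 0 ≠ 0) {c : CircleOrLine}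
    (hc : IsOsculating f c) : IsCentredAtCentreOfCurvature f c := by
  have hi' : ev (iP x y) ≠ 0 := fun h' => hi (h.ev_iP_eq_zero.1 h')
  rw [h.isOsculating_iff_three_le (Or.inl hi')] at hc
  have hA := h.regular.A_ne_zero c hi' hc
  obtain ⟨h1, h2⟩ := h.regular.circle_relations c hc
  rw [h.ev_iP, h.ev_dX_x, h.ev_dX_y] at h1 h2
  have hl := pow_ne_zero 3 h.factor
  refine ⟨hA, ?_, ?_⟩
  · rw [centreOfCurvature, div_eq_div_iff hA hi]
    apply mul_left_cancel₀ hl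
    linear_combination h1
  · rw [centreOfCurvature, div_eq_div_iff hA hi]
    apply mul_left_cancel₀ hl
    linear_combination h2

theorem infl_of_isInflection (h : IsParametrisedBy f x y l) (hi : iEq f 0 = 0)
    (hE : dx f 0 ^ 2 + dy f 0 ^ 2 ≠ 0) : inflEq f 0 = vertEq f 0 + 1 := by
  rw [h.infl, h.vert, ← h.regular.ordX_vP_add_one (h.ev_iP_eq_zero.2 hi)]
  exact fun h' => hE (h.isotropic_iff.1 h')

end IsParametrisedBy

theorem inflEq_eq_one_iff (hf : AnalyticAt ℂ f 0) (h0 : f 0 = 0) :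
    inflEq f 0 = 1 ↔ fderiv ℂ f 0 ≠ 0 ∧ HasContact f (tangentLine f) 3 := by
  have key : fderiv ℂ f 0 ≠ 0 → (inflEq f 0 = 1 ↔ HasContact f (tangentLine f) 3) := fun hd => by
    obtain ⟨x, y, l, h⟩ := exists_isParametrisedBy hf h0 hd
    rw [h.hasContact_tangentLine_iff, show (3 : ℕ∞) = 1 + 2 from rfl]
    exact (WithTop.add_right_inj (ENat.natCast_ne_top 2)).symm
  constructor
  · intro h
    have hd : fderiv ℂ f 0 ≠ 0 := (isSmoothGerm_germ_iff hf h0).1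
      (isSmoothGerm_of_inum_eq_one (by rwa [ev_germ hf]) (Or.inl (inflEq_eq_inum hf ▸ h)))
    exact ⟨hd, (key hd).1 h⟩
  · rintro ⟨hd, h⟩
    exact (key hd).2 h

/-- The value one excludes singular points by codimension and isotropic tangents by the first
derivative of v. What remains is the formula V + 3 for the osculating order. -/
theorem vertEq_eq_one_iff (hf : AnalyticAt ℂ f 0) (h0 : f 0 = 0) :
    vertEq f 0 = 1 ↔ fderiv ℂ f 0 ≠ 0 ∧ dx f 0 ^ 2 + dy f 0 ^ 2 ≠ 0 ∧
      ∃ c, IsOsculating f c ∧ HasContact f c.eqn 4 := by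
  constructor
  · intro hv
    have hd : fderiv ℂ f 0 ≠ 0 := (isSmoothGerm_germ_iff hf h0).1
      (isSmoothGerm_of_inum_eq_one (by rwa [ev_germ hf]) (Or.inr (vertEq_eq_inum hf ▸ hv)))
    obtain ⟨x, y, l, h⟩ := exists_isParametrisedBy hf h0 hd
    have hE : ev (dX x) ^ 2 + ev (dX y) ^ 2 ≠ 0 := fun hE =>
      h.regular.ordX_vP_ne_one hE (h.vert ▸ hv)
    obtain ⟨c, hc⟩ := h.exists_isOsculating (Or.inr hE)
    refine ⟨hd, fun h' => hE (h.isotropic_iff.2 h'), c, hc, ?_⟩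
    rw [h.hasContact_of_isOsculating (Or.inr hE) hc, hv]
    rfl
  · rintro ⟨hd, hE, c, hc, h4⟩
    obtain ⟨x, y, l, h⟩ := exists_isParametrisedBy hf h0 hd
    rw [h.hasContact_of_isOsculating (Or.inr fun h' => hE (h.isotropic_iff.1 h')) hc,
      show (4 : ℕ∞) = 1 + 3 from rfl] at h4
    exact (WithTop.add_right_inj (ENat.natCast_ne_top 3)).1 h4

theorem isInflection_isVertex_of_fderiv_eq_zero (h0 : f 0 = 0) (hd : fderiv ℂ f 0 = 0) :
    IsInflection f 0 ∧ IsVertex f 0 := by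
  obtain ⟨hx, hy⟩ := fderiv_eq_zero_iff.1 hd
  have hi : iEq f 0 = 0 := by
    rw [iEq, hx, hy]
    ring
  refine ⟨⟨h0, hi⟩, h0, ?_⟩
  rw [vEq, hi, hx, hy]
  ring

end smoothPoint

/-! ### Products and units -/

section products

variable {f g h : ℂ × ℂ → ℂ}

theorem inflEq_of_eq_mul (hf : AnalyticAt ℂ f 0) (hfs : Squarefree (germ f))
    (hg : AnalyticAt ℂ g 0) (hh : AnalyticAt ℂ h 0) (e : f =ᶠ[𝓝 0] g * h)
    (h1 : inflEq g 0 ≠ ⊤) (h2 : inflEq h 0 ≠ ⊤) :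
    inflEq f 0 ≠ ⊤ ∧ inflEq f 0 = inflEq g 0 + inflEq h 0 + 6 * intersectionNumber g h 0 := by
  have e' : germ f = germ g * germ h := (germ_congr e).trans (germ_mul hg hh)
  -- A common component of the two factors would be a repeated factor of f, so the intersection
  -- number in the formula is finite.
  have hm : inum (germ g) (germ h) ≠ ⊤ := inum_ne_top_of_squarefree_mul (e' ▸ hfs)
  have key : inflEq f 0 = inflEq g 0 + inflEq h 0 + 6 * intersectionNumber g h 0 := by
    rw [inflEq_eq_inum hf, inflEq_eq_inum hg, inflEq_eq_inum hh, intersectionNumber_eq_inum, e',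
      inum_iO_mul]
  exact ⟨key ▸ WithTop.add_ne_top.2 ⟨WithTop.add_ne_top.2 ⟨h1, h2⟩,
    WithTop.mul_ne_top (ENat.natCast_ne_top 6) hm⟩, key⟩

theorem vertEq_of_eq_mul (hf : AnalyticAt ℂ f 0) (hfs : Squarefree (germ f))
    (hg : AnalyticAt ℂ g 0) (hh : AnalyticAt ℂ h 0) (e : f =ᶠ[𝓝 0] g * h)
    (h1 : vertEq g 0 ≠ ⊤) (h2 : vertEq h 0 ≠ ⊤) :
    vertEq f 0 ≠ ⊤ ∧ vertEq f 0 = vertEq g 0 + vertEq h 0 + 12 * intersectionNumber g h 0 := by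
  have e' : germ f = germ g * germ h := (germ_congr e).trans (germ_mul hg hh)
  have hm : inum (germ g) (germ h) ≠ ⊤ := inum_ne_top_of_squarefree_mul (e' ▸ hfs)
  have key : vertEq f 0 = vertEq g 0 + vertEq h 0 + 12 * intersectionNumber g h 0 := by
    rw [vertEq_eq_inum hf, vertEq_eq_inum hg, vertEq_eq_inum hh, intersectionNumber_eq_inum, e',
      inum_vO_mul]
  exact ⟨key ▸ WithTop.add_ne_top.2 ⟨WithTop.add_ne_top.2 ⟨h1, h2⟩,
    WithTop.mul_ne_top (ENat.natCast_ne_top 12) hm⟩, key⟩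

theorem inflEq_vertEq_unit_mul (hf : AnalyticAt ℂ f 0) {a : ℂ × ℂ → ℂ} (ha : AnalyticAt ℂ a 0)
    (ha0 : a 0 ≠ 0) : inflEq (a * f) 0 = inflEq f 0 ∧ vertEq (a * f) 0 = vertEq f 0 := by
  have e : germ (a * f) = germ a * germ f := germ_mul ha hf
  have hu : IsUnit (germ a) := isUnit_iff_ev.2 (by rwa [ev_germ ha])
  rw [inflEq_eq_inum (ha.mul hf), vertEq_eq_inum (ha.mul hf), inflEq_eq_inum hf, vertEq_eq_inum hf,
    e]
  exact ⟨inum_iO_unit_mul hu _, inum_vO_unit_mul hu _⟩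

end products

theorem HasInfiniteCentre.ne_zero {f : ℂ × ℂ → ℂ} (h : HasInfiniteCentre f) :
    dx f 0 ^ 2 + dy f 0 ^ 2 ≠ 0 := fun he => h.1 <| by
  have h2 : iEq f 0 = 0 := h.2
  rw [centreOfCurvature, he, h2]
  simp

theorem smooth_point {f : ℂ × ℂ → ℂ} (hf : AnalyticAt ℂ f 0) (h0 : f 0 = 0)
    (hd : fderiv ℂ f 0 ≠ 0) :
    (IsInflection f 0 ↔ ∃ c : CircleOrLine, c.IsLine ∧ ∃ k ≥ 3, HasContact f c.eqn k) ∧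
    (IsVertex f 0 ↔ ∃ c : CircleOrLine, ∃ k ≥ 4, HasContact f c.eqn k) ∧
    HasContact f (tangentLine f) (inflEq f 0 + 2) ∧
    (HasFiniteCentre f →
      (∃ c, IsOsculating f c) ∧
      ∀ c, IsOsculating f c →
        IsCentredAtCentreOfCurvature f c ∧ HasContact f c.eqn (vertEq f 0 + 3)) ∧
    (HasInfiniteCentre f → IsInflection f 0 ∧ inflEq f 0 = vertEq f 0 + 1) := by
  obtain ⟨x, y, l, h⟩ := exists_isParametrisedBy hf h0 hd
  refine ⟨h.isInflection_iff h0, h.isVertex_iff h0, (h.hasContact_tangentLine_iff _).2 rfl,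
    fun hc => ?_, fun hc => ⟨⟨h0, hc.2⟩, h.infl_of_isInflection hc.2 hc.ne_zero⟩⟩
  have hr : ev (iP x y) ≠ 0 ∨ ev (dX x) ^ 2 + ev (dX y) ^ 2 ≠ 0 :=
    Or.inl fun h' => hc (h.ev_iP_eq_zero.1 h')
  exact ⟨h.exists_isOsculating hr, fun c hosc =>
    ⟨h.isCentred hc hosc, (h.hasContact_of_isOsculating hr hosc _).2 rfl⟩⟩

end PlaneCurve

end

open PlaneCurve

theorem mainTheorem3 (γ : ℂ → ℂ × ℂ) (hγ : IsParametrisation γ)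
    (f : ℂ × ℂ → ℂ) (hf : IsReducedEquation f 0) :
    -- (1) affine and similarity invariance
    (∀ A : (ℂ × ℂ) ≃ᵃ[ℂ] (ℂ × ℂ),
      inflParam (fun t => A (γ t)) = inflParam γ ∧
      inflEq (fun z => f (A.symm z)) (A 0) = inflEq f 0 ∧
      (IsSimilarity A →
        vertParam (fun t => A (γ t)) = vertParam γ ∧
        vertEq (fun z => f (A.symm z)) (A 0) = vertEq f 0)) ∧
    -- (1) ordinary inflections and vertices
    (inflEq f 0 = 1 ↔ fderiv ℂ f 0 ≠ 0 ∧ HasContact f (tangentLine f) 3) ∧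
    (vertEq f 0 = 1 ↔ fderiv ℂ f 0 ≠ 0 ∧ dx f 0 ^ 2 + dy f 0 ^ 2 ≠ 0 ∧
      ∃ c, IsOsculating f c ∧ HasContact f c.eqn 4) ∧
    -- (2) smooth points
    (fderiv ℂ f 0 ≠ 0 →
      (IsInflection f 0 ↔ ∃ c : CircleOrLine, c.IsLine ∧ ∃ k ≥ 3, HasContact f c.eqn k) ∧
      (IsVertex f 0 ↔ ∃ c : CircleOrLine, ∃ k ≥ 4, HasContact f c.eqn k) ∧
      HasContact f (tangentLine f) (inflEq f 0 + 2) ∧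
      (HasFiniteCentre f →
        (∃ c, IsOsculating f c) ∧
        ∀ c, IsOsculating f c →
          IsCentredAtCentreOfCurvature f c ∧ HasContact f c.eqn (vertEq f 0 + 3)) ∧
      (HasInfiniteCentre f → IsInflection f 0 ∧ inflEq f 0 = vertEq f 0 + 1)) ∧
    -- (3) singular points
    (fderiv ℂ f 0 = 0 → IsInflection f 0 ∧ IsVertex f 0) ∧
    -- (4) dependence on a finite jet
    (inflParam γ ≠ ⊤ → ∃ k : ℕ, ∀ δ : ℂ → ℂ × ℂ, AnalyticAt ℂ δ 0 → SameJet k γ δ →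
      inflParam δ = inflParam γ) ∧
    (vertParam γ ≠ ⊤ → ∃ k : ℕ, ∀ δ : ℂ → ℂ × ℂ, AnalyticAt ℂ δ 0 → SameJet k γ δ →
      vertParam δ = vertParam γ) ∧
    (inflEq f 0 ≠ ⊤ → ∃ k : ℕ, ∀ g : ℂ × ℂ → ℂ, AnalyticAt ℂ g 0 → SameJet k f g →
      inflEq g 0 = inflEq f 0) ∧
    (vertEq f 0 ≠ ⊤ → ∃ k : ℕ, ∀ g : ℂ × ℂ → ℂ, AnalyticAt ℂ g 0 → SameJet k f g →
      vertEq g 0 = vertEq f 0) ∧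
    -- (5) products
    (∀ g h : ℂ × ℂ → ℂ, AnalyticAt ℂ g 0 → AnalyticAt ℂ h 0 → g 0 = 0 → h 0 = 0 →
      f =ᶠ[𝓝 0] g * h →
      (inflEq g 0 ≠ ⊤ → inflEq h 0 ≠ ⊤ → inflEq f 0 ≠ ⊤ ∧
        inflEq f 0 = inflEq g 0 + inflEq h 0 + 6 * intersectionNumber g h 0) ∧
      (vertEq g 0 ≠ ⊤ → vertEq h 0 ≠ ⊤ → vertEq f 0 ≠ ⊤ ∧
        vertEq f 0 = vertEq g 0 + vertEq h 0 + 12 * intersectionNumber g h 0)) ∧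
    -- (6) invariance under changes of parameter and multiplication by units
    (∀ φ : ℂ → ℂ, AnalyticAt ℂ φ 0 → φ 0 = 0 → deriv φ 0 ≠ 0 →
      inflParam (γ ∘ φ) = inflParam γ ∧ vertParam (γ ∘ φ) = vertParam γ) ∧
    (∀ a : ℂ × ℂ → ℂ, AnalyticAt ℂ a 0 → a 0 ≠ 0 →
      inflEq (a * f) 0 = inflEq f 0 ∧ vertEq (a * f) 0 = vertEq f 0) ∧
    -- (7) infinite invariants
    (inflParam γ = ⊤ ↔ ∃ c : CircleOrLine, c.IsLine ∧ ParamContains γ c.carrier) ∧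
    (inflEq f 0 = ⊤ ↔ ∃ c : CircleOrLine, c.IsLine ∧ EqContains f c.carrier) ∧
    (vertParam γ = ⊤ ↔ ∃ c : CircleOrLine, ParamContains γ c.carrier) ∧
    (vertEq f 0 = ⊤ ↔ ∃ c : CircleOrLine, EqContains f c.carrier) := by
  have ha := hf.analyticAt
  have h0 := hf.map_eq_zero
  exact ⟨fun A => ⟨inflParam_affine hγ.analyticAt A, inflEq_affine ha A, fun h =>
      ⟨vertParam_similarity hγ.analyticAt h, vertEq_similarity ha h⟩⟩,
    inflEq_eq_one_iff ha h0, vertEq_eq_one_iff ha h0, smooth_point ha h0,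
    isInflection_isVertex_of_fderiv_eq_zero h0,
    (param_finitely_determined hγ.analyticAt).1, (param_finitely_determined hγ.analyticAt).2,
    inflEq_finitely_determined ha, vertEq_finitely_determined ha,
    fun g h hg hh _ _ e =>
      ⟨inflEq_of_eq_mul ha hf.squarefree hg hh e, vertEq_of_eq_mul ha hf.squarefree hg hh e⟩,
    fun φ hφ hφ0 hφ1 => inflParam_vertParam_comp hγ.analyticAt hφ hφ0 hφ1,
    fun a haa ha0 => inflEq_vertEq_unit_mul ha haa ha0,
    inflParam_eq_top_iff hγ, inflEq_eq_top_iff ha hf.squarefree,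
    vertParam_eq_top_iff hγ, vertEq_eq_top_iff ha hf.squarefree⟩
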